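/- All vector spaces are over $\mathbb{C}$; super vector spaces are $\mathbb{Z}/2$-graded, $\tau_{V,W}(v\otimes w)=(-1)^{|v||w|}w\otimes v$, and morphisms of super vector spaces are the even linear maps. Let $\mathfrak h$ be a finite-dimensional purely odd abelian Lie superalgebra with a non-degenerate supersymmetric (hence skew-symmetric) pairing $(-,-)$, and put $N=\tfrac12\dim\mathfrak h$. Let $\{\alpha^i\}$, $\{\beta^i\}$ be bases of $\mathfrak h$ with $(\alpha^i,\beta^j)=\delta_{i,j}$ and $\Omega=\sum_i\beta^i\otimes\alpha^i$. Let $U(\mathfrak h)$ be the universal enveloping algebra (as an algebra the exterior algebra of $\mathfrak h$), with product $\mu$, coproduct $\Delta(a)=a\otimes1+1\otimes a$ and antipode $S(a)=-a$ for $a\in\mathfrak h$. Write $\rho^R:U(\mathfrak h)\otimes R\to R$ for the action on a representation $R$, $\Omega^{(11)}=\sum_i\beta^i\alpha^i\in U(\mathfrak h)$, and $\Omega^{(13)}=\sum_i(\beta^i)^{(1)}(\alpha^i)^{(3)}$, where $(x)^{(k)}$ acts on the $k$-th tensor factor with the usual parity signs. There is exactly one linear form $\lambda:U(\mathfrak h)\to\mathbb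 C$ which vanishes outside the top degree $2N$ and satisfies $\lambda\big((i\pi\,\Omega^{(11)})^N\big)=(-1)^N\,N!\,(2i)^N$. With it, define $$\phi=\big(\mathrm{id}\otimes(\lambda\circ\mu)\big)\circ\big(\exp(-\pi i\,\Omega)\otimes\mathrm{id}\big):U(\mathfrak h)\to U(\mathfrak h).$$ Let $\mathcal C=\mathcal C_0+\mathcal C_1$ with $\mathcal C_0=\mathrm{Rep}(\mathfrak h)$ and $\mathcal C_1=\mathrm{SVect}$: an object is an object of $\mathcal C_0$ or of $\mathcal C_1$, and there are only zero morphisms between objects of different components. Define a tensor product by $$A\ast B=\begin{cases}A\otimes B\in\mathcal C_0 & A,B\in\mathcal C_0,\\ A\otimes B\in\mathcal C_1 & \text{exactly one of }A,B\text{ in }\mathcal C_1,\\ U(\mathfrak h)\otimes A\otimes B\in\mathcal C_0 & A,B\in\mathcal C_1,\end{cases}$$ where in the second case the $\mathfrak h$-action is forgotten, and in the third case $\mathfrak h$ acts by left multiplication on $U(\mathfrak h)$; on morphisms, $f\ast g$ is $f\otimes g$, respectively $\mathrm{id}_{U(\mathfrak h)}\otimes f\otimes g$. Suppressing the associator of super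 vector spaces, define $\alpha_{A,B,C}:A\ast(B\ast C)\to(A\ast B)\ast C$ according to the components containing $A,B,C$: - $000$, $001$, $100$: $\mathrm{id}_{A\otimes B\otimes C}$; - $010$: $\exp(i\pi\,\Omega^{(13)})$ on $A\otimes B\otimes C$; - $101$: $\exp(i\pi\,\Omega^{(13)})$ on $U(\mathfrak h)\otimes A\otimes B\otimes C$; - $011$: $\big[\{\mathrm{id}_{U(\mathfrak h)}\otimes(\rho^A\circ(S^{-1}\otimes\mathrm{id}_A))\}\circ\{(\tau_{U(\mathfrak h),U(\mathfrak h)}\circ\Delta)\otimes\mathrm{id}_A\}\circ\tau_{A,U(\mathfrak h)}\big]\otimes\mathrm{id}_{B\otimes C}$; - $110$: $\{\mathrm{id}_{U(\mathfrak h)\otimes A\otimes B}\otimes\rho^C\}\circ\{\mathrm{id}_{U(\mathfrak h)}\otimes\tau_{U(\mathfrak h),A\otimes B}\otimes\mathrm{id}_C\}\circ\{\Delta\otimes\mathrm{id}_{A\otimes B\otimes C}\}$; - $111$: $\{\phi\otimes\mathrm{id}_{A\otimes B\otimes C}\}\circ\{\tau_{A,U(\mathfrak h)}\otimes\mathrm{id}_{B\otimes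 C}\}$. Then the $\alpha_{A,B,C}$ are natural isomorphisms in $\mathcal C$ and satisfy the pentagon axiom, and $\mathcal C$ with tensor product $\ast$, associator $\alpha$, unit object the trivial representation $\mathbb C^{1|0}\in\mathcal C_0$ and the unit isomorphisms of super vector spaces is a monoidal category. -/

import Mathlib

universe u

noncomputable section

namespace SymplecticFermions

open CategoryTheory Module
open scoped TensorProduct Nat

/-! ## Super vector spaces -/

/-- A super vector space over the complex numbers: `V = V₀ ⊕ V₁`. -/
structure SuperVect : Type (u + 1) where
  /-- the underlying vector space -/
  carrier : Type u
  [grp : AddCommGroup carrier]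
  [mod : Module ℂ carrier]
  /-- the even part `V₀` -/
  even : Submodule ℂ carrier
  /-- the odd part `V₁` -/
  odd : Submodule ℂ carrier
  isCompl : IsCompl even odd

attribute [instance] SuperVect.grp SuperVect.mod

namespace SuperVect

/-- Projection to the even part. -/
def projEven (V : SuperVect.{u}) : V.carrier →ₗ[ℂ] V.carrier :=
  V.even.projection V.odd V.isCompl

/-- Projection to the odd part. -/
def projOdd (V : SuperVect.{u}) : V.carrier →ₗ[ℂ] V.carrier :=
  V.odd.projection V.even V.isCompl.symm

/-- The parity involution `v ↦ (-1)^{|v|} v`. -/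
def par (V : SuperVect.{u}) : V.carrier →ₗ[ℂ] V.carrier :=
  V.projEven - V.projOdd

theorem projEven_add_projOdd (V : SuperVect.{u}) (v : V.carrier) :
    V.projEven v + V.projOdd v = v :=
  Submodule.projection_add_projection_eq_self V.isCompl v

theorem projEven_mem (V : SuperVect.{u}) (v : V.carrier) : V.projEven v ∈ V.even :=
  Submodule.projection_apply_mem _ _

theorem projOdd_mem (V : SuperVect.{u}) (v : V.carrier) : V.projOdd v ∈ V.odd :=
  Submodule.projection_apply_mem _ _

theorem par_of_even (V : SuperVect.{u}) {v : V.carrier} (hv : v ∈ V.even) : V.par v = v := by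
  have h1 : V.projEven v = v := Submodule.projection_apply_of_mem_left V.isCompl hv
  have h2 : V.projOdd v = 0 := (Submodule.projection_apply_eq_zero_iff V.isCompl.symm).2 hv
  simp [par, h1, h2]

theorem par_of_odd (V : SuperVect.{u}) {v : V.carrier} (hv : v ∈ V.odd) : V.par v = -v := by
  have h1 : V.projOdd v = v := Submodule.projection_apply_of_mem_left V.isCompl.symm hv
  have h2 : V.projEven v = 0 := (Submodule.projection_apply_eq_zero_iff V.isCompl).2 hv
  simp [par, h1, h2]

theorem par_par (V : SuperVect.{u}) (v : V.carrier) : V.par (V.par v) = v := by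
  conv_rhs => rw [← V.projEven_add_projOdd v]
  conv_lhs => rw [← V.projEven_add_projOdd v]
  rw [map_add, map_add, V.par_of_even (V.projEven_mem v), V.par_of_odd (V.projOdd_mem v),
    map_neg, V.par_of_even (V.projEven_mem v), V.par_of_odd (V.projOdd_mem v), neg_neg]

/-- The even part of a tensor product, `V₀ ⊗ W₀ + V₁ ⊗ W₁`. -/
def tensorEven (V W : SuperVect.{u}) : Submodule ℂ (V.carrier ⊗[ℂ] W.carrier) :=
  Submodule.map₂ (TensorProduct.mk ℂ _ _) V.even W.even ⊔
    Submodule.map₂ (TensorProduct.mk ℂ _ _) V.odd W.odd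

/-- The odd part of a tensor product, `V₀ ⊗ W₁ + V₁ ⊗ W₀`. -/
def tensorOdd (V W : SuperVect.{u}) : Submodule ℂ (V.carrier ⊗[ℂ] W.carrier) :=
  Submodule.map₂ (TensorProduct.mk ℂ _ _) V.even W.odd ⊔
    Submodule.map₂ (TensorProduct.mk ℂ _ _) V.odd W.even

theorem par_tmul_of_tensorEven (V W : SuperVect.{u}) :
    tensorEven V W ≤ LinearMap.ker (TensorProduct.map V.par W.par - LinearMap.id) := by
  refine sup_le (Submodule.map₂_le.2 fun v hv w hw => ?_)
    (Submodule.map₂_le.2 fun v hv w hw => ?_)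
  · simp [V.par_of_even hv, W.par_of_even hw]
  · simp [V.par_of_odd hv, W.par_of_odd hw, TensorProduct.neg_tmul, TensorProduct.tmul_neg]

theorem par_tmul_of_tensorOdd (V W : SuperVect.{u}) :
    tensorOdd V W ≤ LinearMap.ker (TensorProduct.map V.par W.par + LinearMap.id) := by
  refine sup_le (Submodule.map₂_le.2 fun v hv w hw => ?_)
    (Submodule.map₂_le.2 fun v hv w hw => ?_)
  · simp [V.par_of_even hv, W.par_of_odd hw, TensorProduct.tmul_neg]
  · simp [V.par_of_odd hv, W.par_of_even hw, TensorProduct.neg_tmul]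

theorem tensor_isCompl (V W : SuperVect.{u}) : IsCompl (tensorEven V W) (tensorOdd V W) := by
  constructor
  · rw [Submodule.disjoint_def]
    intro x hx hy
    have h1 := par_tmul_of_tensorEven V W hx
    have h2 := par_tmul_of_tensorOdd V W hy
    rw [LinearMap.mem_ker, LinearMap.sub_apply, sub_eq_zero] at h1
    rw [LinearMap.mem_ker, LinearMap.add_apply, h1, LinearMap.id_apply, ← two_smul ℂ] at h2
    simpa using h2
  · rw [codisjoint_iff, eq_top_iff]
    intro x _
    induction x with
    | zero => exact zero_mem _
    | add x y hx hy => exact add_mem (hx trivial) (hy trivial)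
    | tmul v w =>
      rw [← V.projEven_add_projOdd v, ← W.projEven_add_projOdd w, TensorProduct.add_tmul,
        TensorProduct.tmul_add, TensorProduct.tmul_add]
      have hA {p : Submodule ℂ V.carrier} {q : Submodule ℂ W.carrier} {a : V.carrier}
          {b : W.carrier} (ha : a ∈ p) (hb : b ∈ q) :
          a ⊗ₜ[ℂ] b ∈ Submodule.map₂ (TensorProduct.mk ℂ _ _) p q :=
        Submodule.apply_mem_map₂ _ ha hb
      refine add_mem (add_mem ?_ ?_) (add_mem ?_ ?_)
      · exact Submodule.mem_sup_left (Submodule.mem_sup_left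
          (hA (V.projEven_mem v) (W.projEven_mem w)))
      · exact Submodule.mem_sup_right (Submodule.mem_sup_left
          (hA (V.projEven_mem v) (W.projOdd_mem w)))
      · exact Submodule.mem_sup_right (Submodule.mem_sup_right
          (hA (V.projOdd_mem v) (W.projEven_mem w)))
      · exact Submodule.mem_sup_left (Submodule.mem_sup_right
          (hA (V.projOdd_mem v) (W.projOdd_mem w)))

/-- The tensor product of super vector spaces. -/
abbrev tensor (V W : SuperVect.{u}) : SuperVect.{u} where
  carrier := V.carrier ⊗[ℂ] W.carrier
  even := tensorEven V W
  odd := tensorOdd V W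
  isCompl := tensor_isCompl V W

/-- The tensor unit `ℂ^{1|0}`. -/
abbrev unit : SuperVect.{u} where
  carrier := ULift.{u} ℂ
  even := ⊤
  odd := ⊥
  isCompl := isCompl_top_bot

/-- The symmetry `τ(v ⊗ w) = (-1)^{|v||w|} w ⊗ v`; with `v = v₀ + v₁` the decomposition of `v`,
this is `v ⊗ w ↦ w ⊗ v₀ + par(w) ⊗ v₁`. -/
def braid (V W : SuperVect.{u}) : V.carrier ⊗[ℂ] W.carrier →ₗ[ℂ] W.carrier ⊗[ℂ] V.carrier :=
  (TensorProduct.comm ℂ V.carrier W.carrier).toLinearMap ∘ₗ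
    (TensorProduct.map V.projEven LinearMap.id + TensorProduct.map V.projOdd W.par)

/-- A linear map between super vector spaces is even if it preserves the parity. -/
def IsEven {V W : SuperVect.{u}} (f : V.carrier →ₗ[ℂ] W.carrier) : Prop :=
  (∀ v ∈ V.even, f v ∈ W.even) ∧ (∀ v ∈ V.odd, f v ∈ W.odd)

/-- A linear map between super vector spaces is odd if it reverses the parity. -/
def IsOdd {V W : SuperVect.{u}} (f : V.carrier →ₗ[ℂ] W.carrier) : Prop :=
  (∀ v ∈ V.even, f v ∈ W.odd) ∧ (∀ v ∈ V.odd, f v ∈ W.even)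

theorem isEven_tensor_map {V V' W W' : SuperVect.{u}} {f : V.carrier →ₗ[ℂ] V'.carrier}
    {g : W.carrier →ₗ[ℂ] W'.carrier} (hf : IsEven f) (hg : IsEven g) :
    IsEven (V := V.tensor W) (W := V'.tensor W') (TensorProduct.map f g) := by
  have hA {p : Submodule ℂ V.carrier} {q : Submodule ℂ W.carrier} {p' : Submodule ℂ V'.carrier}
      {q' : Submodule ℂ W'.carrier} (hp : ∀ v ∈ p, f v ∈ p') (hq : ∀ v ∈ q, g v ∈ q') :
      Submodule.map₂ (TensorProduct.mk ℂ _ _) p q ≤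
        (Submodule.map₂ (TensorProduct.mk ℂ _ _) p' q').comap (TensorProduct.map f g) :=
    Submodule.map₂_le.2 fun v hv w hw => by
      simpa using Submodule.apply_mem_map₂ (TensorProduct.mk ℂ _ _) (hp v hv) (hq w hw)
  constructor
  · intro x hx
    exact (sup_le ((hA hf.1 hg.1).trans (Submodule.comap_mono le_sup_left))
      ((hA hf.2 hg.2).trans (Submodule.comap_mono le_sup_right)) : tensorEven V W ≤
        (tensorEven V' W').comap (TensorProduct.map f g)) hx
  · intro x hx
    exact (sup_le ((hA hf.1 hg.2).trans (Submodule.comap_mono le_sup_left))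
      ((hA hf.2 hg.1).trans (Submodule.comap_mono le_sup_right)) : tensorOdd V W ≤
        (tensorOdd V' W').comap (TensorProduct.map f g)) hx

theorem isOdd_tensor_map {V V' W W' : SuperVect.{u}} {f : V.carrier →ₗ[ℂ] V'.carrier}
    {g : W.carrier →ₗ[ℂ] W'.carrier} (hfg : IsOdd f ∧ IsEven g ∨ IsEven f ∧ IsOdd g) :
    IsOdd (V := V.tensor W) (W := V'.tensor W') (TensorProduct.map f g) := by
  have hA {p : Submodule ℂ V.carrier} {q : Submodule ℂ W.carrier} {p' : Submodule ℂ V'.carrier}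
      {q' : Submodule ℂ W'.carrier} (hp : ∀ v ∈ p, f v ∈ p') (hq : ∀ v ∈ q, g v ∈ q') :
      Submodule.map₂ (TensorProduct.mk ℂ _ _) p q ≤
        (Submodule.map₂ (TensorProduct.mk ℂ _ _) p' q').comap (TensorProduct.map f g) :=
    Submodule.map₂_le.2 fun v hv w hw => by
      simpa using Submodule.apply_mem_map₂ (TensorProduct.mk ℂ _ _) (hp v hv) (hq w hw)
  rcases hfg with ⟨hf, hg⟩ | ⟨hf, hg⟩
  · constructor
    · intro x hx
      exact (sup_le ((hA hf.1 hg.1).trans (Submodule.comap_mono le_sup_right))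
        ((hA hf.2 hg.2).trans (Submodule.comap_mono le_sup_left)) : tensorEven V W ≤
          (tensorOdd V' W').comap (TensorProduct.map f g)) hx
    · intro x hx
      exact (sup_le ((hA hf.1 hg.2).trans (Submodule.comap_mono le_sup_right))
        ((hA hf.2 hg.1).trans (Submodule.comap_mono le_sup_left)) : tensorOdd V W ≤
          (tensorEven V' W').comap (TensorProduct.map f g)) hx
  · constructor
    · intro x hx
      exact (sup_le ((hA hf.1 hg.1).trans (Submodule.comap_mono le_sup_left))
        ((hA hf.2 hg.2).trans (Submodule.comap_mono le_sup_right)) : tensorEven V W ≤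
          (tensorOdd V' W').comap (TensorProduct.map f g)) hx
    · intro x hx
      exact (sup_le ((hA hf.1 hg.2).trans (Submodule.comap_mono le_sup_left))
        ((hA hf.2 hg.1).trans (Submodule.comap_mono le_sup_right)) : tensorOdd V W ≤
          (tensorEven V' W').comap (TensorProduct.map f g)) hx

theorem isEven_id (V : SuperVect.{u}) : IsEven (V := V) (W := V) LinearMap.id :=
  ⟨fun _ h => h, fun _ h => h⟩

theorem isEven_zero (V W : SuperVect.{u}) :
    IsEven (V := V) (W := W) (0 : V.carrier →ₗ[ℂ] W.carrier) :=
  ⟨fun _ _ => zero_mem _, fun _ _ => zero_mem _⟩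

theorem isEven_par (V : SuperVect.{u}) : IsEven (V := V) (W := V) V.par :=
  ⟨fun v hv => by rwa [V.par_of_even hv], fun v hv => by
    rw [V.par_of_odd hv]; exact neg_mem hv⟩

end SuperVect

/-! ## The enveloping algebra and its representations

From here on `h` is a complex vector space, regarded as a purely odd super vector space and as an
abelian Lie superalgebra. -/

variable (h : Type u) [AddCommGroup h] [Module ℂ h]

/-- The universal enveloping algebra of the purely odd abelian Lie superalgebra `h`: the algebra
generated by `h` with relations `ab + ba = [a,b] = 0`, i.e. the exterior algebra of the
vector space `h`. -/
abbrev U : Type u := ExteriorAlgebra ℂ h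

/-- The `ℤ/2`-grading of `U(h)` in which the elements of `h` are odd. -/
abbrev grading : ZMod 2 → Submodule ℂ (U h) :=
  CliffordAlgebra.evenOdd (0 : QuadraticForm ℂ h)

/-- `U(h)` as a super vector space. -/
abbrev USuper : SuperVect.{u} where
  carrier := U h
  even := grading h 0
  odd := grading h 1
  isCompl := CliffordAlgebra.evenOdd_isCompl _

/-- A representation of the purely odd abelian Lie superalgebra `h`: a super vector space with an
even linear map from `h` to its endomorphisms (so elements of `h`, being odd, act by odd maps)
which takes the vanishing bracket of `h` to the supercommutator. -/
structure SuperRep : Type (u + 1) where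
  /-- the underlying super vector space -/
  space : SuperVect.{u}
  /-- the action map -/
  act : h →ₗ[ℂ] Module.End ℂ space.carrier
  act_odd : ∀ a, SuperVect.IsOdd (V := space) (W := space) (act a)
  act_anticomm : ∀ a b, act a * act b + act b * act a = 0

variable {h}

namespace SuperRep

theorem act_sq (R : SuperRep h) (a : h) : R.act a * R.act a = 0 := by
  have := R.act_anticomm a a
  rw [← two_smul ℂ] at this
  simpa using this

/-- The action of `U(h)` on a representation, as an algebra homomorphism. -/
def actU (R : SuperRep h) : U h →ₐ[ℂ] Module.End ℂ R.space.carrier :=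
  ExteriorAlgebra.lift ℂ ⟨R.act, R.act_sq⟩

/-- The action map `ρ : U(h) ⊗ R → R`. -/
def rho (R : SuperRep h) : U h ⊗[ℂ] R.space.carrier →ₗ[ℂ] R.space.carrier :=
  TensorProduct.lift R.actU.toLinearMap

theorem act_par (R : SuperRep h) (a : h) (v : R.space.carrier) :
    R.act a (R.space.par v) = -R.space.par (R.act a v) := by
  conv_lhs => rw [← R.space.projEven_add_projOdd v]
  conv_rhs => rw [← R.space.projEven_add_projOdd v]
  have h0 := R.space.projEven_mem v
  have h1 := R.space.projOdd_mem v
  simp only [map_add]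
  rw [R.space.par_of_even h0, R.space.par_of_odd h1,
    R.space.par_of_odd ((R.act_odd a).1 _ h0), R.space.par_of_even ((R.act_odd a).2 _ h1)]
  simp only [map_neg, neg_add, neg_neg]

/-- The action of `h` on a tensor product: `a (v ⊗ w) = a v ⊗ w + (-1)^{|v|} v ⊗ a w`. -/
def tensorAct (R S : SuperRep h) :
    h →ₗ[ℂ] Module.End ℂ (R.space.carrier ⊗[ℂ] S.space.carrier) where
  toFun a := TensorProduct.map (R.act a) LinearMap.id + TensorProduct.map R.space.par (S.act a)
  map_add' a b := by
    rw [map_add, map_add, TensorProduct.map_add_left, TensorProduct.map_add_right]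
    abel
  map_smul' c a := by
    rw [map_smul, map_smul, TensorProduct.map_smul_left, TensorProduct.map_smul_right,
      RingHom.id_apply, smul_add]

theorem tensorAct_tmul (R S : SuperRep h) (a : h) (v : R.space.carrier) (w : S.space.carrier) :
    tensorAct R S a (v ⊗ₜ[ℂ] w) = R.act a v ⊗ₜ[ℂ] w + R.space.par v ⊗ₜ[ℂ] S.act a w :=
  rfl

/-- The tensor product of representations. -/
abbrev tensor (R S : SuperRep h) : SuperRep h where
  space := R.space.tensor S.space
  act := tensorAct R S
  act_odd a := by
    have h1 := SuperVect.isOdd_tensor_map (Or.inl ⟨R.act_odd a, SuperVect.isEven_id S.space⟩)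
    have h2 := SuperVect.isOdd_tensor_map (Or.inr ⟨SuperVect.isEven_par R.space, S.act_odd a⟩)
    exact ⟨fun x hx => add_mem (h1.1 x hx) (h2.1 x hx),
      fun x hx => add_mem (h1.2 x hx) (h2.2 x hx)⟩
  act_anticomm a b := by
    have hR (v : R.space.carrier) : R.act a (R.act b v) = -R.act b (R.act a v) :=
      eq_neg_of_add_eq_zero_left (LinearMap.congr_fun (R.act_anticomm a b) v)
    have hS (v : S.space.carrier) : S.act a (S.act b v) = -S.act b (S.act a v) :=
      eq_neg_of_add_eq_zero_left (LinearMap.congr_fun (S.act_anticomm a b) v)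
    refine TensorProduct.ext' fun v w => ?_
    simp only [LinearMap.add_apply, Module.End.mul_apply, tensorAct_tmul, map_add, act_par,
      SuperVect.par_par, hR, hS, TensorProduct.neg_tmul, TensorProduct.tmul_neg,
      LinearMap.zero_apply]
    abel

/-- The action of `h` on `U(h) ⊗ V` by left multiplication on `U(h)`. -/
def freeAct (V : SuperVect.{u}) : h →ₗ[ℂ] Module.End ℂ (U h ⊗[ℂ] V.carrier) where
  toFun a := TensorProduct.map (LinearMap.mulLeft ℂ (ExteriorAlgebra.ι ℂ a)) LinearMap.id
  map_add' a b := TensorProduct.ext' fun v w => by simp [add_mul, TensorProduct.add_tmul]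
  map_smul' c a := TensorProduct.ext' fun v w => by simp [TensorProduct.smul_tmul']

theorem freeAct_tmul (V : SuperVect.{u}) (a : h) (x : U h) (v : V.carrier) :
    freeAct V a (x ⊗ₜ[ℂ] v) = (ExteriorAlgebra.ι ℂ a * x) ⊗ₜ[ℂ] v :=
  rfl

/-- The representation on `U(h) ⊗ V` with `h` acting by left multiplication on `U(h)`. -/
abbrev free (V : SuperVect.{u}) : SuperRep h where
  space := (USuper h).tensor V
  act := freeAct V
  act_odd a := by
    refine SuperVect.isOdd_tensor_map (V := USuper h) (V' := USuper h)
      (f := LinearMap.mulLeft ℂ (ExteriorAlgebra.ι ℂ a : U h))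
      (Or.inl ⟨⟨fun x hx => ?_, fun x hx => ?_⟩, SuperVect.isEven_id V⟩)
    · exact SetLike.mul_mem_graded (A := grading h) (i := 1) (j := 0)
        (CliffordAlgebra.ι_mem_evenOdd_one (0 : QuadraticForm ℂ h) a) hx
    · exact SetLike.mul_mem_graded (A := grading h) (i := 1) (j := 1)
        (CliffordAlgebra.ι_mem_evenOdd_one (0 : QuadraticForm ℂ h) a) hx
  act_anticomm a b := by
    refine TensorProduct.ext' fun v w => ?_
    have := ExteriorAlgebra.ι_add_mul_swap (R := ℂ) a b
    rw [LinearMap.add_apply, Module.End.mul_apply, Module.End.mul_apply, freeAct_tmul,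
      freeAct_tmul, freeAct_tmul, freeAct_tmul, ← TensorProduct.add_tmul, ← mul_assoc,
      ← mul_assoc, ← add_mul, this, zero_mul, TensorProduct.zero_tmul, LinearMap.zero_apply]

/-- The trivial representation on `ℂ^{1|0}`. -/
abbrev trivial : SuperRep h where
  space := SuperVect.unit
  act := 0
  act_odd _ := ⟨fun _ _ => zero_mem _, fun _ _ => zero_mem _⟩
  act_anticomm _ _ := by simp

end SuperRep

/-! ## The category `𝒞 = Rep(h) + SVect` -/

variable (h) in
/-- Objects of `𝒞 = 𝒞₀ + 𝒞₁`: an object of `𝒞₀ = Rep(h)` or an object of `𝒞₁ = SVect`. -/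
inductive Obj : Type (u + 1) where
  /-- objects of the component `𝒞₀ = Rep(h)` -/
  | untw (R : SuperRep h) : Obj
  /-- objects of the component `𝒞₁ = SVect` -/
  | tw (X : SuperVect.{u}) : Obj

namespace Obj

/-- The underlying super vector space of an object of `𝒞`. -/
abbrev und : Obj h → SuperVect.{u}
  | untw R => R.space
  | tw X => X

/-- Which even linear maps are morphisms of `𝒞`: the `h`-intertwiners inside `𝒞₀`, all even maps
inside `𝒞₁`, and only the zero map between objects of different components. -/
def Compat : (A B : Obj h) → (A.und.carrier →ₗ[ℂ] B.und.carrier) → Prop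
  | untw R, untw S, f => ∀ (a : h) (v : R.space.carrier), f (R.act a v) = S.act a (f v)
  | tw _, tw _, _ => True
  | untw _, tw _, f => f = 0
  | tw _, untw _, f => f = 0

/-- Morphisms of `𝒞`. -/
@[ext]
structure Hom (A B : Obj h) where
  /-- the underlying linear map -/
  lin : A.und.carrier →ₗ[ℂ] B.und.carrier
  isEven : SuperVect.IsEven (V := A.und) (W := B.und) lin
  compat : Compat A B lin

theorem compat_id : (A : Obj h) → Compat A A LinearMap.id
  | untw _ => fun _ _ => rfl
  | tw _ => True.intro

theorem compat_comp : {A B C : Obj h} → {f : A.und.carrier →ₗ[ℂ] B.und.carrier} →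
    {g : B.und.carrier →ₗ[ℂ] C.und.carrier} → Compat A B f → Compat B C g → Compat A C (g ∘ₗ f)
  | untw _, untw _, untw _, f, g, hf, hg => fun a v =>
      (congrArg g (hf a v)).trans (hg a (f v))
  | untw _, tw _, untw T, _, g, hf, _ => by
      simp only [Compat] at hf
      subst hf
      intro a v
      exact (map_zero g).trans ((congrArg (T.act a) (map_zero g)).trans (map_zero (T.act a))).symm
  | tw _, untw _, tw _, _, _, _, _ => True.intro
  | tw _, tw _, tw _, _, _, _, _ => True.intro
  | untw _, untw _, tw _, _, _, _, hg => by
      simp only [Compat] at hg ⊢; subst hg; exact LinearMap.zero_comp _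
  | untw _, tw _, tw _, _, _, hf, _ => by
      simp only [Compat] at hf ⊢; subst hf; exact LinearMap.comp_zero _
  | tw _, untw _, untw _, _, _, hf, _ => by
      simp only [Compat] at hf ⊢; subst hf; exact LinearMap.comp_zero _
  | tw _, tw _, untw _, _, _, _, hg => by
      simp only [Compat] at hg ⊢; subst hg; exact LinearMap.zero_comp _

instance : Category (Obj h) where
  Hom := Hom
  id A := ⟨LinearMap.id, SuperVect.isEven_id _, compat_id A⟩
  comp f g := ⟨g.lin ∘ₗ f.lin,
    ⟨fun v hv => g.isEven.1 _ (f.isEven.1 v hv), fun v hv => g.isEven.2 _ (f.isEven.2 v hv)⟩,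
    compat_comp f.compat g.compat⟩

/-- The underlying linear map of a morphism of `𝒞`. -/
def toLin {A B : Obj h} (f : A ⟶ B) : A.und.carrier →ₗ[ℂ] B.und.carrier := Hom.lin f

/-! ## The tensor product functor -/

/-- The tensor product `A ∗ B` on objects: the tensor product of representations on `𝒞₀ × 𝒞₀`, the
tensor product of underlying super vector spaces on `𝒞₀ × 𝒞₁` and `𝒞₁ × 𝒞₀`, and the
representation `U(h) ⊗ A ⊗ B` on `𝒞₁ × 𝒞₁`. -/
abbrev star : Obj h → Obj h → Obj h
  | untw R, untw S => untw (R.tensor S)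
  | untw R, tw Y => tw (R.space.tensor Y)
  | tw X, untw S => tw (X.tensor S.space)
  | tw X, tw Y => untw (SuperRep.free (X.tensor Y))

/-- The tensor product `f ∗ g` on underlying linear maps: `f ⊗ g` or `id_{U(h)} ⊗ f ⊗ g`. It is
zero if one of the maps goes between different components. -/
def starLin : {A A' B B' : Obj h} → (A.und.carrier →ₗ[ℂ] A'.und.carrier) →
    (B.und.carrier →ₗ[ℂ] B'.und.carrier) →
    ((star A B).und.carrier →ₗ[ℂ] (star A' B').und.carrier)
  | untw _, untw _, untw _, untw _, f, g => TensorProduct.map f g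
  | untw _, untw _, tw _, tw _, f, g => TensorProduct.map f g
  | tw _, tw _, untw _, untw _, f, g => TensorProduct.map f g
  | tw _, tw _, tw _, tw _, f, g =>
      TensorProduct.map (LinearMap.id : U h →ₗ[ℂ] U h) (TensorProduct.map f g)
  | untw _, tw _, _, _, _, _ => 0
  | tw _, untw _, _, _, _, _ => 0
  | untw _, untw _, untw _, tw _, _, _ => 0
  | untw _, untw _, tw _, untw _, _, _ => 0
  | tw _, tw _, untw _, tw _, _, _ => 0
  | tw _, tw _, tw _, untw _, _, _ => 0

theorem compat_zero : (A B : Obj h) → Compat A B 0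
  | untw _, untw S => fun a _ => (map_zero (S.act a)).symm
  | tw _, tw _ => True.intro
  | untw _, tw _ => rfl
  | tw _, untw _ => rfl

theorem lin_par {V W : SuperVect.{u}} {f : V.carrier →ₗ[ℂ] W.carrier}
    (hf : SuperVect.IsEven (V := V) (W := W) f) (v : V.carrier) :
    f (V.par v) = W.par (f v) := by
  rw [← V.projEven_add_projOdd v]
  simp only [map_add]
  rw [V.par_of_even (V.projEven_mem v), V.par_of_odd (V.projOdd_mem v),
    W.par_of_even (hf.1 _ (V.projEven_mem v)), W.par_of_odd (hf.2 _ (V.projOdd_mem v)), map_neg]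

theorem starLin_spec : {A A' B B' : Obj h} → (f : Hom A A') → (g : Hom B B') →
    SuperVect.IsEven (V := (star A B).und) (W := (star A' B').und) (starLin f.lin g.lin) ∧
      Compat (star A B) (star A' B') (starLin f.lin g.lin)
  | untw R, untw R', untw S, untw S', f, g => by
      refine ⟨SuperVect.isEven_tensor_map f.isEven g.isEven, fun a => LinearMap.congr_fun
        (f := TensorProduct.map f.lin g.lin ∘ₗ (R.tensor S).act a)
        (g := (R'.tensor S').act a ∘ₗ TensorProduct.map f.lin g.lin) ?_⟩
      refine TensorProduct.ext' fun (v : R.space.carrier) (w : S.space.carrier) => ?_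
      have h1 : f.lin (R.act a v) = R'.act a (f.lin v) := f.compat a v
      have h2 : g.lin (S.act a w) = S'.act a (g.lin w) := g.compat a w
      have h3 : f.lin (R.space.par v) = R'.space.par (f.lin v) := lin_par f.isEven v
      change TensorProduct.map f.lin g.lin
          (R.act a v ⊗ₜ[ℂ] w + R.space.par v ⊗ₜ[ℂ] S.act a w) =
        (R'.tensorAct S' a) ((f.lin v : R'.space.carrier) ⊗ₜ[ℂ] (g.lin w : S'.space.carrier))
      rw [map_add, TensorProduct.map_tmul, TensorProduct.map_tmul, h1, h2, h3]
      rfl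
  | untw _, untw _, tw _, tw _, f, g =>
      ⟨SuperVect.isEven_tensor_map f.isEven g.isEven, True.intro⟩
  | tw _, tw _, untw _, untw _, f, g =>
      ⟨SuperVect.isEven_tensor_map f.isEven g.isEven, True.intro⟩
  | tw X, tw X', tw Y, tw Y', f, g => by
      refine ⟨SuperVect.isEven_tensor_map (V := USuper h) (V' := USuper h)
        (SuperVect.isEven_id _) (SuperVect.isEven_tensor_map f.isEven g.isEven),
        fun a => LinearMap.congr_fun
        (f := TensorProduct.map (LinearMap.id : U h →ₗ[ℂ] U h) (TensorProduct.map f.lin g.lin) ∘ₗ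
          (SuperRep.free (X.tensor Y)).act a)
        (g := (SuperRep.free (X'.tensor Y')).act a ∘ₗ
          TensorProduct.map (LinearMap.id : U h →ₗ[ℂ] U h) (TensorProduct.map f.lin g.lin)) ?_⟩
      exact TensorProduct.ext' fun v w => rfl
  | untw _, tw _, _, _, _, _ => ⟨SuperVect.isEven_zero _ _, compat_zero _ _⟩
  | tw _, untw _, _, _, _, _ => ⟨SuperVect.isEven_zero _ _, compat_zero _ _⟩
  | untw _, untw _, untw _, tw _, _, _ => ⟨SuperVect.isEven_zero _ _, compat_zero _ _⟩
  | untw _, untw _, tw _, untw _, _, _ => ⟨SuperVect.isEven_zero _ _, compat_zero _ _⟩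
  | tw _, tw _, untw _, tw _, _, _ => ⟨SuperVect.isEven_zero _ _, compat_zero _ _⟩
  | tw _, tw _, tw _, untw _, _, _ => ⟨SuperVect.isEven_zero _ _, compat_zero _ _⟩

/-- The tensor product `f ∗ g` of morphisms. -/
def starHom {A A' B B' : Obj h} (f : A ⟶ A') (g : B ⟶ B') : star A B ⟶ star A' B' :=
  (⟨starLin (toLin f) (toLin g), (starLin_spec f g).1, (starLin_spec f g).2⟩ :
    Hom (star A B) (star A' B'))

/-- The tensor unit: the trivial representation on `ℂ^{1|0}`, an object of `𝒞₀`. -/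
abbrev one : Obj h := untw SuperRep.trivial

/-- The left unitor `1 ∗ A → A`, `z ⊗ v ↦ z v`. -/
def leftUnitLin : (A : Obj h) → ((star one A).und.carrier →ₗ[ℂ] A.und.carrier)
  | untw R => (TensorProduct.lid ℂ R.space.carrier).toLinearMap ∘ₗ
      TensorProduct.map ULift.moduleEquiv.toLinearMap LinearMap.id
  | tw X => (TensorProduct.lid ℂ X.carrier).toLinearMap ∘ₗ
      TensorProduct.map ULift.moduleEquiv.toLinearMap LinearMap.id

/-- The right unitor `A ∗ 1 → A`, `v ⊗ z ↦ z v`. -/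
def rightUnitLin : (A : Obj h) → ((star A one).und.carrier →ₗ[ℂ] A.und.carrier)
  | untw R => (TensorProduct.rid ℂ R.space.carrier).toLinearMap ∘ₗ
      TensorProduct.map LinearMap.id ULift.moduleEquiv.toLinearMap
  | tw X => (TensorProduct.rid ℂ X.carrier).toLinearMap ∘ₗ
      TensorProduct.map LinearMap.id ULift.moduleEquiv.toLinearMap

/-- The data of a monoidal category on `𝒞` with tensor product `∗`, tensor unit the trivial
representation, and given associator `A ∗ (B ∗ C) ≅ (A ∗ B) ∗ C` and unitors. -/
abbrev starStruct (assoc : ∀ A B C : Obj h, star A (star B C) ≅ star (star A B) C)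
    (lu : ∀ A : Obj h, star one A ≅ A) (ru : ∀ A : Obj h, star A one ≅ A) :
    MonoidalCategoryStruct (Obj h) where
  tensorObj := star
  whiskerLeft A _ _ g := starHom (𝟙 A) g
  whiskerRight f B := starHom f (𝟙 B)
  tensorHom := starHom
  tensorUnit := one
  associator A B C := (assoc A B C).symm
  leftUnitor := lu
  rightUnitor := ru

end Obj

/-! ## Hopf algebra structure on `U(h)` and the copairing -/

/-- The exponential series of a nilpotent element of a complex algebra (a finite sum). -/
def nilExp {A : Type*} [Ring A] [Algebra ℂ A] (x : A) : A :=
  ∑ k ∈ Finset.range (nilpotencyClass x), ((k ! : ℂ)⁻¹) • x ^ k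

open scoped GradedTensorProduct in
/-- The super algebra `U(h) ⊗ U(h)`, with product
`(a ⊗ b)(c ⊗ d) = (-1)^{|b||c|} ac ⊗ bd`. -/
abbrev UU (h : Type u) [AddCommGroup h] [Module ℂ h] : Type u :=
  GradedTensorProduct ℂ (grading h) (grading h)

/-- The canonical identification of the super algebra `U(h) ⊗ U(h)` with the tensor product of
vector spaces. -/
def fromUU : UU h →ₗ[ℂ] U h ⊗[ℂ] U h :=
  (GradedTensorProduct.of ℂ (grading h) (grading h)).symm.toLinearMap

/-- The coproduct on generators, `a ↦ a ⊗ 1 + 1 ⊗ a`. -/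
def coprodGen : h →ₗ[ℂ] UU h :=
  (GradedTensorProduct.includeLeft (grading h) (grading h)).toLinearMap ∘ₗ ExteriorAlgebra.ι ℂ +
    (GradedTensorProduct.includeRight (grading h) (grading h)).toLinearMap ∘ₗ ExteriorAlgebra.ι ℂ

theorem coprodGen_sq (a : h) : coprodGen a * coprodGen a = 0 := by
  have ha : (ExteriorAlgebra.ι ℂ a : U h) ∈ grading h 1 :=
    CliffordAlgebra.ι_mem_evenOdd_one (0 : QuadraticForm ℂ h) a
  have h1 := GradedTensorProduct.tmul_coe_mul_coe_tmul (R := ℂ) (grading h) (grading h)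
    (1 : U h) ⟨_, ha⟩ ⟨_, ha⟩ (1 : U h)
  have h2 := GradedTensorProduct.tmul_one_mul_one_tmul (R := ℂ) (grading h) (grading h)
    (ExteriorAlgebra.ι ℂ a) (ExteriorAlgebra.ι ℂ a)
  simp only [one_mul, mul_one] at h1
  have h3 : (GradedTensorProduct.includeLeft (grading h) (grading h)) (ExteriorAlgebra.ι ℂ a) *
      (GradedTensorProduct.includeLeft (grading h) (grading h)) (ExteriorAlgebra.ι ℂ a) = 0 := by
    rw [← map_mul, ExteriorAlgebra.ι_sq_zero, map_zero]
  have h4 : (GradedTensorProduct.includeRight (grading h) (grading h)) (ExteriorAlgebra.ι ℂ a) *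
      (GradedTensorProduct.includeRight (grading h) (grading h)) (ExteriorAlgebra.ι ℂ a) = 0 := by
    rw [← map_mul, ExteriorAlgebra.ι_sq_zero, map_zero]
  change (GradedTensorProduct.includeLeft (grading h) (grading h) (ExteriorAlgebra.ι ℂ a) +
      GradedTensorProduct.includeRight (grading h) (grading h) (ExteriorAlgebra.ι ℂ a)) *
    (GradedTensorProduct.includeLeft (grading h) (grading h) (ExteriorAlgebra.ι ℂ a) +
      GradedTensorProduct.includeRight (grading h) (grading h) (ExteriorAlgebra.ι ℂ a)) = 0
  rw [add_mul, mul_add, mul_add, h3, h4, zero_add, add_zero]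
  change GradedTensorProduct.tmul ℂ _ _ * GradedTensorProduct.tmul ℂ _ _ +
    GradedTensorProduct.tmul ℂ _ _ * GradedTensorProduct.tmul ℂ _ _ = 0
  rw [h2, h1]
  simp

/-- The coproduct `Δ : U(h) → U(h) ⊗ U(h)`, the algebra homomorphism with
`Δ(a) = a ⊗ 1 + 1 ⊗ a` for `a` in `h`. -/
def coprodAlg : U h →ₐ[ℂ] UU h :=
  ExteriorAlgebra.lift ℂ ⟨coprodGen, coprodGen_sq⟩

/-- The coproduct as a linear map. -/
def coprod : U h →ₗ[ℂ] U h ⊗[ℂ] U h := fromUU ∘ₗ coprodAlg.toLinearMap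

/-- The antipode `S`, given by `a ↦ -a` for `a` in `h`. As `U(h)` is supercommutative, the
extension as a super anti-automorphism is the extension as an automorphism, namely
`(-1)^n` on the degree `n` part of `U(h)`. -/
def antipode : U h ≃ₗ[ℂ] U h :=
  (CliffordAlgebra.involuteEquiv (Q := (0 : QuadraticForm ℂ h))).toLinearEquiv

variable {ι : Type*} [Fintype ι] (α β : ι → h)

/-- The copairing `Ω = ∑ᵢ βⁱ ⊗ αⁱ` as an element of the super algebra `U(h) ⊗ U(h)`. -/
def copairing : UU h :=
  ∑ i, GradedTensorProduct.tmul ℂ (ExteriorAlgebra.ι ℂ (β i)) (ExteriorAlgebra.ι ℂ (α i))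

/-- `Ω⁽¹¹⁾ = ∑ᵢ βⁱ αⁱ` as an element of `U(h)`. -/
def copairing11 : U h := ∑ i, ExteriorAlgebra.ι ℂ (β i) * ExteriorAlgebra.ι ℂ (α i)

/-- `Ω⁽¹³⁾ = ∑ᵢ (βⁱ)⁽¹⁾ (αⁱ)⁽³⁾` on `R ⊗ X ⊗ S`, for representations `R`, `S` and a super vector
space `X`. The action of the odd element `αⁱ` on the third factor produces the sign
`(-1)^{|r| + |x|}`. -/
def Omega13 (R : SuperRep h) (X : SuperVect.{u}) (S : SuperRep h) :
    Module.End ℂ (R.space.carrier ⊗[ℂ] (X.carrier ⊗[ℂ] S.space.carrier)) :=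
  ∑ i, TensorProduct.map (R.act (β i)) LinearMap.id ∘ₗ
    TensorProduct.map R.space.par (TensorProduct.map X.par (S.act (α i)))

/-- `Ω⁽¹³⁾` on `U(h) ⊗ X ⊗ S ⊗ Y`, for a representation `S` and super vector spaces `X`, `Y`; the
first leg acts by left multiplication on `U(h)`. -/
def Omega13U (X : SuperVect.{u}) (S : SuperRep h) (Y : SuperVect.{u}) :
    Module.End ℂ (U h ⊗[ℂ] (X.carrier ⊗[ℂ] (S.space.carrier ⊗[ℂ] Y.carrier))) :=
  ∑ i, TensorProduct.map (LinearMap.mulLeft ℂ (ExteriorAlgebra.ι ℂ (β i))) LinearMap.id ∘ₗ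
    TensorProduct.map (USuper h).par
      (TensorProduct.map X.par (TensorProduct.map (S.act (α i)) LinearMap.id))

/-- The number `N = -sdim(h)/2 = dim(h)/2`. -/
def numPairs (h : Type u) [AddCommGroup h] [Module ℂ h] : ℕ := finrank ℂ h / 2

/-- `lam` is the normalised top form on `U(h)`: it vanishes outside the top degree `dim h` and
satisfies `lam ((iπ Ω⁽¹¹⁾)^N) = (-1)^N N! (2i)^N`. -/
def IsTopForm (lam : U h →ₗ[ℂ] ℂ) : Prop :=
  (∀ n, n ≠ finrank ℂ h → ∀ x ∈ ⋀[ℂ]^n h, lam x = 0) ∧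
    lam (((Complex.I * (Real.pi : ℂ)) • copairing11 α β) ^ numPairs h) =
      (-1) ^ numPairs h * ((numPairs h)! : ℂ) * (2 * Complex.I) ^ numPairs h

/-- The map `φ = (id ⊗ (lam ∘ μ)) ∘ (exp(-πi Ω) ⊗ id) : U(h) → U(h)`. -/
def phi (lam : U h →ₗ[ℂ] ℂ) : U h →ₗ[ℂ] U h :=
  (TensorProduct.rid ℂ (U h)).toLinearMap ∘ₗ
    TensorProduct.map LinearMap.id (lam ∘ₗ LinearMap.mul' ℂ (U h)) ∘ₗ
    (TensorProduct.assoc ℂ (U h) (U h) (U h)).toLinearMap ∘ₗ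
    TensorProduct.mk ℂ (U h ⊗[ℂ] U h) (U h)
      (fromUU (nilExp ((-((Real.pi : ℂ) * Complex.I)) • copairing α β)))

/-! ## The associators -/

/-- The reassociation `X ⊗ (Y ⊗ Z) → (X ⊗ Y) ⊗ Z`. -/
abbrev reassoc (X Y Z : Type u) [AddCommGroup X] [Module ℂ X] [AddCommGroup Y] [Module ℂ Y]
    [AddCommGroup Z] [Module ℂ Z] : X ⊗[ℂ] (Y ⊗[ℂ] Z) →ₗ[ℂ] (X ⊗[ℂ] Y) ⊗[ℂ] Z :=
  (TensorProduct.assoc ℂ X Y Z).symm.toLinearMap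

/-- The reassociation `(X ⊗ Y) ⊗ Z → X ⊗ (Y ⊗ Z)`. -/
abbrev unassoc (X Y Z : Type u) [AddCommGroup X] [Module ℂ X] [AddCommGroup Y] [Module ℂ Y]
    [AddCommGroup Z] [Module ℂ Z] : (X ⊗[ℂ] Y) ⊗[ℂ] Z →ₗ[ℂ] X ⊗[ℂ] (Y ⊗[ℂ] Z) :=
  (TensorProduct.assoc ℂ X Y Z).toLinearMap

/-- The endomorphism `exp(iπ Ω⁽¹³⁾)` of `A ⊗ B ⊗ C` in the associator for `𝒞₀ × 𝒞₁ × 𝒞₀`. -/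
def twist010 (R : SuperRep h) (X : SuperVect.{u}) (S : SuperRep h) :
    Module.End ℂ (R.space.carrier ⊗[ℂ] (X.carrier ⊗[ℂ] S.space.carrier)) :=
  nilExp ((Complex.I * (Real.pi : ℂ)) • Omega13 α β R X S)

/-- The endomorphism `exp(iπ Ω⁽¹³⁾)` of `U(h) ⊗ A ⊗ B ⊗ C` in the associator for
`𝒞₁ × 𝒞₀ × 𝒞₁`. -/
def twist101 (X : SuperVect.{u}) (S : SuperRep h) (Y : SuperVect.{u}) :
    Module.End ℂ (U h ⊗[ℂ] (X.carrier ⊗[ℂ] (S.space.carrier ⊗[ℂ] Y.carrier))) :=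
  nilExp ((Complex.I * (Real.pi : ℂ)) • Omega13U α β X S Y)

/-- The map `A ⊗ U(h) → U(h) ⊗ A` in the associator for `𝒞₀ × 𝒞₁ × 𝒞₁`:
`{id ⊗ (ρ ∘ (S⁻¹ ⊗ id))} ∘ {(τ ∘ Δ) ⊗ id} ∘ τ`. -/
def twist011 (R : SuperRep h) : R.space.carrier ⊗[ℂ] U h →ₗ[ℂ] U h ⊗[ℂ] R.space.carrier :=
  TensorProduct.map LinearMap.id
      (R.rho ∘ₗ TensorProduct.map antipode.symm.toLinearMap LinearMap.id) ∘ₗ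
    unassoc (U h) (U h) R.space.carrier ∘ₗ
    TensorProduct.map (SuperVect.braid (USuper h) (USuper h) ∘ₗ coprod) LinearMap.id ∘ₗ
    SuperVect.braid R.space (USuper h)

/-- The map `U(h) ⊗ X ⊗ C → U(h) ⊗ X ⊗ C` in the associator for `𝒞₁ × 𝒞₁ × 𝒞₀`, with `X = A ⊗ B`:
`{id ⊗ ρ} ∘ {id ⊗ τ ⊗ id} ∘ {Δ ⊗ id}`. -/
def twist110 (X : SuperVect.{u}) (R : SuperRep h) :
    U h ⊗[ℂ] (X.carrier ⊗[ℂ] R.space.carrier) →ₗ[ℂ]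
      U h ⊗[ℂ] (X.carrier ⊗[ℂ] R.space.carrier) :=
  TensorProduct.map LinearMap.id
      (TensorProduct.map LinearMap.id R.rho ∘ₗ
        unassoc X.carrier (U h) R.space.carrier ∘ₗ
        TensorProduct.map (SuperVect.braid (USuper h) X) LinearMap.id ∘ₗ
        reassoc (U h) X.carrier R.space.carrier) ∘ₗ
    unassoc (U h) (U h) (X.carrier ⊗[ℂ] R.space.carrier) ∘ₗ
    TensorProduct.map coprod LinearMap.id

/-- The underlying linear maps of the associators `A ∗ (B ∗ C) → (A ∗ B) ∗ C`, in the eight cases.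
The reassociation of tensor products of vector spaces is written out. -/
def assocLin (lam : U h →ₗ[ℂ] ℂ) : (A B C : Obj h) →
    ((A.star (B.star C)).und.carrier →ₗ[ℂ] ((A.star B).star C).und.carrier)
  | .untw A, .untw B, .untw C => reassoc A.space.carrier B.space.carrier C.space.carrier
  | .untw A, .untw B, .tw C => reassoc A.space.carrier B.space.carrier C.carrier
  | .untw A, .tw B, .untw C =>
      reassoc A.space.carrier B.carrier C.space.carrier ∘ₗ
        twist010 α β A B C
  | .tw A, .untw B, .untw C => reassoc A.carrier B.space.carrier C.space.carrier
  | .untw A, .tw B, .tw C =>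
      TensorProduct.map (LinearMap.id : U h →ₗ[ℂ] U h)
          (reassoc A.space.carrier B.carrier C.carrier) ∘ₗ
        unassoc (U h) A.space.carrier (B.carrier ⊗[ℂ] C.carrier) ∘ₗ
        TensorProduct.map (twist011 A) LinearMap.id ∘ₗ
        reassoc A.space.carrier (U h) (B.carrier ⊗[ℂ] C.carrier)
  | .tw A, .untw B, .tw C =>
      TensorProduct.map (LinearMap.id : U h →ₗ[ℂ] U h)
          (reassoc A.carrier B.space.carrier C.carrier) ∘ₗ
        twist101 α β A B C
  | .tw A, .tw B, .untw C =>
      reassoc (U h) (A.carrier ⊗[ℂ] B.carrier) C.space.carrier ∘ₗ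
        twist110 (A.tensor B) C ∘ₗ
        TensorProduct.map (LinearMap.id : U h →ₗ[ℂ] U h)
          (reassoc A.carrier B.carrier C.space.carrier)
  | .tw A, .tw B, .tw C =>
      reassoc (U h) (A.carrier ⊗[ℂ] B.carrier) C.carrier ∘ₗ
        TensorProduct.map (LinearMap.id : U h →ₗ[ℂ] U h)
          (reassoc A.carrier B.carrier C.carrier) ∘ₗ
        unassoc (U h) A.carrier (B.carrier ⊗[ℂ] C.carrier) ∘ₗ
        TensorProduct.map (TensorProduct.map (phi α β lam) LinearMap.id) LinearMap.id ∘ₗ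
        TensorProduct.map (SuperVect.braid A (USuper h)) LinearMap.id ∘ₗ
        reassoc A.carrier (U h) (B.carrier ⊗[ℂ] C.carrier)

end SymplecticFermions

end

/-!
The theorem is proved by writing every associator as a reassociation, possibly a signed exchange of
tensor factors, and an exponential `expOm α β c P Q` of the operator `c ∑ᵢ P(βⁱ) Q(αⁱ)`, where `P`
and `Q` are two actions of `h` by anticommuting odd operators. For the cases `010` and `101` this is
the definition. For `011` and `110` the coproduct of `U(h)` enters; since `α` and `β` are dual
bases, `Δ` is multiplication by `exp(Ω)` with one leg of `Ω` acting by contraction `DU ω` on `U(h)`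
(`IsDualPair.twist110_apply`, `IsDualPair.twist011_apply`). For `111` the map `φ` is a Fourier
transform of the exterior algebra: it intertwines multiplication by `a ∈ h` with the contraction
with `a`, up to the scalars `±iπ` (`IsDualPair.DU_phi`, `IsDualPair.phi_DU`).

All pentagon identities then follow from three kinds of rules. Exponentials move through linear maps
which intertwine the legs (`map_expOm`); they are additive in each leg (`expOm_add_left`,
`expOm_add_right`); and two exponentials, one of which has a leg acting by contraction and the other
by multiplication, commute up to a third exponential by the Heisenberg relation between the two
(`IsDualPair.expOm_exchange`). The identity with four objects of `𝒞₁` needs in addition that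
`φ ∘ φ` is the parity (`IsDualPair.phi_phi`), and an identity for the exchange of two copies of
`U(h)` (`IsDualPair.swapMid_expOm_expOm`). The square of `φ` commutes up to sign with all
multiplications, so it is the parity up to a scalar. The scalar is computed on the Gaussian
`exp(π/2 Ω⁽¹¹⁾)`, which solves a first order differential equation preserved by `φ` and hence is an
eigenvector of `φ` with eigenvalue its integral `(-1)^N` (`IsDualPair.phi_gauss`,
`IsTopForm.apply_gauss`).

The calculations are made on vector spaces with a parity given by a type class, with an arbitrary
space `E` in place of `U(h)`, and are transported to the objects of `𝒞` at the end.
-/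

noncomputable section

namespace SymplecticFermions

open CategoryTheory Module
open scoped TensorProduct Nat

/-! ### Truncated exponentials -/

section TruncExp

variable {A : Type*} [Ring A] [Algebra ℂ A]

/-- The exponential series cut off at degree `n`. For `x ^ n = 0` it is the exponential of `x`, and
unlike `nilExp` it satisfies intertwining relations without any nilpotency hypothesis. -/
def truncExp (n : ℕ) (x : A) : A := ∑ k ∈ Finset.range n, ((k ! : ℂ)⁻¹) • x ^ k

theorem nilExp_eq_truncExp {n : ℕ} {x : A} (hx : x ^ n = 0) : nilExp x = truncExp n x := by
  have hn : nilpotencyClass x ≤ n := csInf_le' hx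
  rw [nilExp, truncExp, ← Finset.sum_range_add_sum_Ico _ hn, left_eq_add]
  refine Finset.sum_eq_zero fun k hk => ?_
  rw [pow_eq_zero_of_le (Finset.mem_Ico.1 hk).1 (pow_nilpotencyClass ⟨n, hx⟩), smul_zero]

theorem nilExp_add {x y : A} (hxy : Commute x y) (hx : IsNilpotent x) (hy : IsNilpotent y) :
    nilExp (x + y) = nilExp x * nilExp y := by
  let _ : Module ℚ A := Module.compHom A (algebraMap ℚ ℂ)
  have key (z : A) : nilExp z = IsNilpotent.exp z := by
    refine Finset.sum_congr rfl fun k _ => ?_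
    change _ = (algebraMap ℚ ℂ ((k ! : ℚ)⁻¹)) • z ^ k
    simp
  rw [key, key, key, IsNilpotent.exp_add_of_commute hxy hx hy]

theorem truncExp_zero (n : ℕ) : truncExp (n + 1) (0 : A) = 1 := by
  rw [truncExp, Finset.sum_range_succ', Finset.sum_eq_zero fun k _ => by
    rw [zero_pow (by simp), smul_zero]]
  simp

theorem truncExp_add {n : ℕ} {x y : A} (hxy : Commute x y) (hx : x ^ n = 0) (hy : y ^ n = 0)
    (h : (x + y) ^ n = 0) : truncExp n (x + y) = truncExp n x * truncExp n y := by
  rw [← nilExp_eq_truncExp hx, ← nilExp_eq_truncExp hy, ← nilExp_eq_truncExp h,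
    nilExp_add hxy ⟨n, hx⟩ ⟨n, hy⟩]

/-- If `[X, Y] = Z` commutes with `Y` then `X exp(Y) = exp(Y) (X + Z)`. -/
theorem mul_truncExp {n : ℕ} {X Y Z : A} (h : X * Y = Y * X + Z) (hZ : Commute Z Y)
    (hY : Y ^ n = 0) : X * truncExp (n + 1) Y = truncExp (n + 1) Y * (X + Z) := by
  have hk (k : ℕ) : X * Y ^ (k + 1) = Y ^ (k + 1) * X + (k + 1 : ℂ) • (Y ^ k * Z) := by
    induction k with
    | zero => simpa using h
    | succ k ih =>
      rw [pow_succ Y (k + 1), ← mul_assoc, ih, add_mul, mul_assoc, h, smul_mul_assoc, mul_assoc,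
        hZ.eq, mul_add, ← mul_assoc, ← mul_assoc, ← pow_succ, ← pow_succ]
      push_cast
      module
  rw [mul_add]
  conv_lhs => rw [truncExp, Finset.sum_range_succ']
  conv_rhs =>
    enter [1]
    rw [truncExp, Finset.sum_range_succ']
  rw [truncExp, Finset.sum_range_succ, hY, smul_zero, add_zero, mul_add, add_mul, Finset.mul_sum,
    Finset.sum_mul, Finset.sum_mul]
  simp only [mul_smul_comm, smul_mul_assoc, hk, smul_add, Finset.sum_add_distrib, pow_zero,
    mul_one, one_mul]
  have : ∀ k : ℕ,
      (((k + 1) ! : ℂ)⁻¹) • ((k + 1 : ℂ) • (Y ^ k * Z)) = ((k ! : ℂ)⁻¹) • (Y ^ k * Z) := by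
    intro k
    rw [smul_smul]
    congr 1
    rw [Nat.factorial_succ]
    push_cast
    have : (k + 1 : ℂ) ≠ 0 := by exact_mod_cast Nat.succ_ne_zero k
    field_simp
  simp only [this]
  abel

/-- A sum of commuting elements of square zero is nilpotent. -/
theorem sum_pow_card_eq_zero {A : Type*} [Ring A] {ι : Type*} (s : Finset ι) (x : ι → A)
    (hc : ∀ i j, Commute (x i) (x j)) (hx : ∀ i, x i ^ 2 = 0) :
    (∑ i ∈ s, x i) ^ (s.card + 1) = 0 := by
  classical
  induction s using Finset.induction_on with
  | empty => simp
  | insert i s hi ih =>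
    rw [Finset.sum_insert hi, Finset.card_insert_of_notMem hi]
    exact Commute.add_pow_eq_zero_of_add_le_succ_of_pow_eq_zero
      (Commute.sum_right _ _ _ fun j _ => hc i j) (hx i) ih (by omega)

end TruncExp

theorem truncExp_apply_comm {V W : Type*} [AddCommGroup V] [Module ℂ V] [AddCommGroup W]
    [Module ℂ W] (F : V →ₗ[ℂ] W) {X : Module.End ℂ V} {Y : Module.End ℂ W}
    (h : ∀ v, F (X v) = Y (F v)) (n : ℕ) (v : V) :
    F (truncExp n X v) = truncExp n Y (F v) := by
  have hk (k : ℕ) : F ((X ^ k) v) = (Y ^ k) (F v) := by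
    induction k generalizing v with
    | zero => rfl
    | succ k ih => rw [pow_succ, pow_succ, Module.End.mul_apply, ih, h, Module.End.mul_apply]
  simp [truncExp, LinearMap.sum_apply, hk]

/-! ### Odd operators on tensor products -/

section Sites

/-- A vector space with a parity involution `v ↦ (-1)^{|v|} v`. This encodes a super vector space
by a type class, so that the parity of an iterated tensor product is found by unification. -/
class Parity (V : Type*) [AddCommGroup V] [Module ℂ V] where
  /-- the parity involution -/
  par : V →ₗ[ℂ] V
  par_par : ∀ v, par (par v) = v

open Parity (par par_par)

instance superParity (V : SuperVect.{u}) : Parity V.carrier := ⟨V.par, V.par_par⟩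

instance {V W : Type*} [AddCommGroup V] [Module ℂ V] [AddCommGroup W] [Module ℂ W] [Parity V]
    [Parity W] : Parity (V ⊗[ℂ] W) where
  par := TensorProduct.map par par
  par_par x := by
    induction x with
    | zero => simp
    | add x y hx hy => simp only [map_add, hx, hy]
    | tmul v w => simp [par_par]

variable {h : Type u} [AddCommGroup h] [Module ℂ h]

instance : Parity (U h) where
  par := CliffordAlgebra.involute.toLinearMap
  par_par := CliffordAlgebra.involute_involute

section Defs

variable {V W : Type*} [AddCommGroup V] [Module ℂ V] [AddCommGroup W] [Module ℂ W]

@[simp]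
theorem par_tmul [Parity V] [Parity W] (v : V) (w : W) :
    par (v ⊗ₜ[ℂ] w) = par v ⊗ₜ[ℂ] par w := rfl

/-- A family of operators on a super vector space, all of which anticommute with the parity. -/
class OddOp [Parity V] (P : h →ₗ[ℂ] Module.End ℂ V) : Prop where
  apply_par : ∀ a v, P a (par v) = -par (P a v)

/-- Two families of operators which anticommute with each other. -/
class Anti (P Q : h →ₗ[ℂ] Module.End ℂ V) : Prop where
  apply_comm : ∀ a b v, P a (Q b v) = -Q b (P a v)

/-- The action of a family of operators on the first factor of a tensor product. -/
def inl (P : h →ₗ[ℂ] Module.End ℂ V) : h →ₗ[ℂ] Module.End ℂ (V ⊗[ℂ] W) :=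
  LinearMap.rTensorHom W ∘ₗ P

/-- The action of a family of odd operators on the second factor of a tensor product, with the
sign `(-1)^{|v|}` from the first factor. -/
def inr [Parity V] (P : h →ₗ[ℂ] Module.End ℂ W) : h →ₗ[ℂ] Module.End ℂ (V ⊗[ℂ] W) :=
  LinearMap.mk₂ ℂ (fun a x => TensorProduct.map par (P a) x)
    (fun a b x => by rw [map_add, TensorProduct.map_add_right, LinearMap.add_apply])
    (fun c a x => by rw [map_smul, TensorProduct.map_smul_right, LinearMap.smul_apply])
    (fun a x y => map_add _ x y) (fun c a x => map_smul _ c x)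

@[simp]
theorem inl_tmul (P : h →ₗ[ℂ] Module.End ℂ V) (a : h) (v : V) (w : W) :
    inl P a (v ⊗ₜ[ℂ] w) = P a v ⊗ₜ[ℂ] w := rfl

@[simp]
theorem inr_tmul [Parity V] (P : h →ₗ[ℂ] Module.End ℂ W) (a : h) (v : V) (w : W) :
    inr P a (v ⊗ₜ[ℂ] w) = par v ⊗ₜ[ℂ] P a w := rfl

end Defs

variable (h) in
/-- Left multiplication by the generators of `U(h)`. -/
def LU : h →ₗ[ℂ] Module.End ℂ (U h) :=
  LinearMap.mul ℂ (U h) ∘ₗ ExteriorAlgebra.ι ℂ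

@[simp]
theorem LU_apply (a : h) (x : U h) : LU h a x = ExteriorAlgebra.ι ℂ a * x := rfl

section Instances

variable {V W : Type*} [AddCommGroup V] [Module ℂ V] [AddCommGroup W] [Module ℂ W]
  (P P' : h →ₗ[ℂ] Module.End ℂ V) (Q Q' : h →ₗ[ℂ] Module.End ℂ W)

instance [Parity V] [Parity W] [OddOp P] : OddOp (inl (W := W) P) where
  apply_par a v := by
    induction v with
    | zero => simp
    | add x y hx hy => simp only [map_add, hx, hy, neg_add]
    | tmul v w => simp [OddOp.apply_par, TensorProduct.neg_tmul]

instance [Parity V] [Parity W] [OddOp Q] : OddOp (inr (V := V) Q) where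
  apply_par a v := by
    induction v with
    | zero => simp
    | add x y hx hy => simp only [map_add, hx, hy, neg_add]
    | tmul v w => simp [OddOp.apply_par, TensorProduct.tmul_neg]

instance [Parity V] [OddOp P] : Anti (inl (W := W) P) (inr (V := V) Q) where
  apply_comm a b v := by
    induction v with
    | zero => simp
    | add x y hx hy => simp only [map_add, hx, hy, neg_add]
    | tmul v w => simp [OddOp.apply_par, TensorProduct.neg_tmul]

instance [Parity V] [OddOp P] : Anti (inr (V := V) Q) (inl (W := W) P) where
  apply_comm a b v := by
    rw [Anti.apply_comm (P := inl (W := W) P) (Q := inr (V := V) Q), neg_neg]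

instance [Anti P P'] : Anti (inl (W := W) P) (inl (W := W) P') where
  apply_comm a b v := by
    induction v with
    | zero => simp
    | add x y hx hy => simp only [map_add, hx, hy, neg_add]
    | tmul v w =>
      simp only [inl_tmul]
      rw [Anti.apply_comm, TensorProduct.neg_tmul]

instance [Parity V] [Anti Q Q'] : Anti (inr (V := V) Q) (inr (V := V) Q') where
  apply_comm a b v := by
    induction v with
    | zero => simp
    | add x y hx hy => simp only [map_add, hx, hy, neg_add]
    | tmul v w =>
      simp only [inr_tmul]
      rw [Anti.apply_comm, TensorProduct.tmul_neg]

instance (R : SuperRep h) : OddOp R.act := ⟨R.act_par⟩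

instance (R : SuperRep h) : Anti R.act R.act :=
  ⟨fun a b v => eq_neg_of_add_eq_zero_left (LinearMap.congr_fun (R.act_anticomm a b) v)⟩

instance : OddOp (LU h) where
  apply_par a x := by
    change ExteriorAlgebra.ι ℂ a * CliffordAlgebra.involute x =
      -CliffordAlgebra.involute (CliffordAlgebra.ι (0 : QuadraticForm ℂ h) a * x)
    rw [map_mul, CliffordAlgebra.involute_ι, neg_mul, neg_neg]

instance : Anti (LU h) (LU h) where
  apply_comm a b x := by
    simp only [LU_apply, ← mul_assoc]
    rw [eq_neg_of_add_eq_zero_left (ExteriorAlgebra.ι_add_mul_swap (R := ℂ) a b), neg_mul]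

end Instances

section AntiModule

variable {V : Type*} [AddCommGroup V] [Module ℂ V] (P P' Q : h →ₗ[ℂ] Module.End ℂ V)

instance [Anti P Q] [Anti P' Q] : Anti (P + P') Q where
  apply_comm a b v := by
    simp only [LinearMap.add_apply, Anti.apply_comm (Q := Q), map_add, neg_add]

instance [Anti Q P] [Anti Q P'] : Anti Q (P + P') where
  apply_comm a b v := by
    simp only [LinearMap.add_apply, Anti.apply_comm (P := Q), map_add, neg_add]

instance (c : ℂ) [Anti P Q] : Anti (c • P) Q where
  apply_comm a b v := by
    simp only [LinearMap.smul_apply, Anti.apply_comm (Q := Q), map_smul, smul_neg]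

instance (c : ℂ) [Anti Q P] : Anti Q (c • P) where
  apply_comm a b v := by
    simp only [LinearMap.smul_apply, Anti.apply_comm (P := Q), map_smul, smul_neg]

end AntiModule

end Sites

/-! ### Exponentials of bilinears in odd operators -/

section Bilinears

variable {h : Type u} [AddCommGroup h] [Module ℂ h] {ι : Type*} [Fintype ι] (α β : ι → h)
variable {V : Type*} [AddCommGroup V] [Module ℂ V]

/-- The operator `∑ᵢ P(βⁱ) Q(αⁱ)`: the copairing `Ω` with its first leg acting through `P` and its
second leg acting through `Q`. -/
def Om (P Q : h →ₗ[ℂ] Module.End ℂ V) : Module.End ℂ V := ∑ i, P (β i) * Q (α i)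

/-- The exponential `exp(c Ω)` with the two legs of `Ω` acting through `P` and `Q`. The cut-off of
the exponential series is harmless as the powers of `Ω` above `dim h` vanish. -/
def expOm (c : ℂ) (P Q : h →ₗ[ℂ] Module.End ℂ V) : Module.End ℂ V :=
  truncExp (Fintype.card ι + 2) (c • Om α β P Q)

theorem Om_apply (P Q : h →ₗ[ℂ] Module.End ℂ V) (v : V) :
    Om α β P Q v = ∑ i, P (β i) (Q (α i) v) := by
  simp [Om, LinearMap.sum_apply]

theorem Om_add_right (P Q Q' : h →ₗ[ℂ] Module.End ℂ V) :
    Om α β P (Q + Q') = Om α β P Q + Om α β P Q' := by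
  simp [Om, mul_add, Finset.sum_add_distrib]

theorem Om_add_left (P P' Q : h →ₗ[ℂ] Module.End ℂ V) :
    Om α β (P + P') Q = Om α β P Q + Om α β P' Q := by
  simp [Om, add_mul, Finset.sum_add_distrib]

theorem expOm_smul_right (c s : ℂ) (P Q : h →ₗ[ℂ] Module.End ℂ V) :
    expOm α β c P (s • Q) = expOm α β (c * s) P Q := by
  simp [expOm, Om, Finset.smul_sum, mul_smul]

theorem expOm_smul_left (c s : ℂ) (P Q : h →ₗ[ℂ] Module.End ℂ V) :
    expOm α β c (s • P) Q = expOm α β (c * s) P Q := by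
  simp [expOm, Om, Finset.smul_sum, mul_smul]

theorem Om_commute (P Q P' Q' : h →ₗ[ℂ] Module.End ℂ V) [Anti P P'] [Anti P Q'] [Anti Q P']
    [Anti Q Q'] : Commute (Om α β P Q) (Om α β P' Q') := by
  refine Commute.sum_left _ _ _ fun i _ => Commute.sum_right _ _ _ fun j _ => ?_
  ext v
  simp only [Module.End.mul_apply]
  rw [Anti.apply_comm (P := Q) (Q := P'), map_neg, Anti.apply_comm (P := Q) (Q := Q'), map_neg,
    map_neg, Anti.apply_comm (P := P) (Q := P'), Anti.apply_comm (P := P) (Q := Q'), map_neg]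
  simp

theorem Om_pow (P Q : h →ₗ[ℂ] Module.End ℂ V) [Anti P P] [Anti P Q] [Anti Q P] [Anti Q Q] :
    Om α β P Q ^ (Fintype.card ι + 1) = 0 := by
  refine sum_pow_card_eq_zero Finset.univ _ (fun i j => ?_) fun i => ?_
  · ext v
    simp only [Module.End.mul_apply]
    rw [Anti.apply_comm (P := Q) (Q := P), map_neg, Anti.apply_comm (P := Q) (Q := Q), map_neg,
      map_neg, Anti.apply_comm (P := P) (Q := P), Anti.apply_comm (P := P) (Q := Q), map_neg]
    simp
  · have hP (v : V) : P (β i) (P (β i) v) = 0 := by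
      have := eq_neg_iff_add_eq_zero.1 (Anti.apply_comm (P := P) (Q := P) (β i) (β i) v)
      rw [← two_smul ℂ] at this
      simpa using this
    ext v
    rw [sq]
    simp only [Module.End.mul_apply]
    rw [Anti.apply_comm (P := Q) (Q := P), map_neg, hP]
    simp

theorem smul_Om_pow (c : ℂ) (P Q : h →ₗ[ℂ] Module.End ℂ V) [Anti P P] [Anti P Q] [Anti Q P]
    [Anti Q Q] : (c • Om α β P Q) ^ (Fintype.card ι + 1) = 0 := by
  rw [smul_pow, Om_pow, smul_zero]

theorem smul_Om_pow' (c : ℂ) (P Q : h →ₗ[ℂ] Module.End ℂ V) [Anti P P] [Anti P Q] [Anti Q P]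
    [Anti Q Q] : (c • Om α β P Q) ^ (Fintype.card ι + 2) = 0 := by
  rw [pow_succ, smul_Om_pow, zero_mul]

theorem nilExp_eq_expOm (c : ℂ) (P Q : h →ₗ[ℂ] Module.End ℂ V) [Anti P P] [Anti P Q] [Anti Q P]
    [Anti Q Q] : nilExp (c • Om α β P Q) = expOm α β c P Q :=
  nilExp_eq_truncExp (smul_Om_pow' α β c P Q)

theorem expOm_zero (P Q : h →ₗ[ℂ] Module.End ℂ V) : expOm α β 0 P Q = 1 := by
  rw [expOm, zero_smul, truncExp_zero]

theorem expOm_add (c d : ℂ) (P Q : h →ₗ[ℂ] Module.End ℂ V) [Anti P P] [Anti P Q] [Anti Q P]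
    [Anti Q Q] : expOm α β (c + d) P Q = expOm α β c P Q * expOm α β d P Q := by
  rw [expOm, add_smul, truncExp_add _ (smul_Om_pow' α β c P Q) (smul_Om_pow' α β d P Q)]
  · rfl
  · rw [← add_smul]
    exact smul_Om_pow' α β _ P Q
  · exact ((Commute.refl _).smul_left _).smul_right _

theorem expOm_cancel (c d : ℂ) (hcd : c + d = 0) (P Q : h →ₗ[ℂ] Module.End ℂ V) [Anti P P]
    [Anti P Q] [Anti Q P] [Anti Q Q] (v : V) : expOm α β c P Q (expOm α β d P Q v) = v := by
  rw [← Module.End.mul_apply, ← expOm_add, hcd, expOm_zero, Module.End.one_apply]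

theorem expOm_add_right (c : ℂ) (P Q Q' : h →ₗ[ℂ] Module.End ℂ V) [Anti P P] [Anti P Q] [Anti Q P]
    [Anti Q Q] [Anti P Q'] [Anti Q' P] [Anti Q' Q'] [Anti Q Q'] [Anti Q' Q] :
    expOm α β c P (Q + Q') = expOm α β c P Q * expOm α β c P Q' := by
  rw [expOm, Om_add_right, smul_add, truncExp_add _ (smul_Om_pow' α β c P Q)
    (smul_Om_pow' α β c P Q')]
  · rfl
  · rw [← smul_add, ← Om_add_right]
    exact smul_Om_pow' α β c P (Q + Q')
  · exact ((Om_commute α β P Q P Q').smul_left _).smul_right _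

theorem expOm_add_left (c : ℂ) (P P' Q : h →ₗ[ℂ] Module.End ℂ V) [Anti P P] [Anti P Q] [Anti Q P]
    [Anti Q Q] [Anti P P'] [Anti P' P] [Anti P' P'] [Anti Q P'] [Anti P' Q] :
    expOm α β c (P + P') Q = expOm α β c P Q * expOm α β c P' Q := by
  rw [expOm, Om_add_left, smul_add, truncExp_add _ (smul_Om_pow' α β c P Q)
    (smul_Om_pow' α β c P' Q)]
  · rfl
  · rw [← smul_add, ← Om_add_left]
    exact smul_Om_pow' α β c (P + P') Q
  · exact ((Om_commute α β P Q P' Q).smul_left _).smul_right _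

/-- A map intertwines two exponentials as soon as it intertwines their legs. -/
theorem map_expOm {W : Type*} [AddCommGroup W] [Module ℂ W] (F : V →ₗ[ℂ] W) (c : ℂ)
    {P Q : h →ₗ[ℂ] Module.End ℂ V} {P' Q' : h →ₗ[ℂ] Module.End ℂ W}
    (hP : ∀ a v, F (P a v) = P' a (F v)) (hQ : ∀ a v, F (Q a v) = Q' a (F v)) (v : V) :
    F (expOm α β c P Q v) = expOm α β c P' Q' (F v) := by
  refine truncExp_apply_comm F (fun v => ?_) _ v
  simp only [LinearMap.smul_apply, Om_apply, map_smul, map_sum, hP, hQ]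

/-- An operator anticommuting with both legs commutes with the exponential. -/
theorem map_expOm_of_anti {W : Type*} [AddCommGroup W] [Module ℂ W] (F : V →ₗ[ℂ] W) (c : ℂ)
    {P Q : h →ₗ[ℂ] Module.End ℂ V} {P' Q' : h →ₗ[ℂ] Module.End ℂ W}
    (hP : ∀ a v, F (P a v) = -P' a (F v)) (hQ : ∀ a v, F (Q a v) = -Q' a (F v)) (v : V) :
    F (expOm α β c P Q v) = expOm α β c P' Q' (F v) := by
  refine truncExp_apply_comm F (fun v => ?_) _ v
  simp only [LinearMap.smul_apply, Om_apply, map_smul, map_sum, hP, hQ, map_neg, neg_neg]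

/-- Vectors killed by the second leg are fixed by the exponential. -/
theorem expOm_apply_of_eq_zero (c : ℂ) (P Q : h →ₗ[ℂ] Module.End ℂ V) {v : V}
    (hv : ∀ a, Q a v = 0) : expOm α β c P Q v = v := by
  rw [expOm, truncExp, Finset.sum_range_succ', LinearMap.add_apply, LinearMap.sum_apply,
    Finset.sum_eq_zero fun k _ => ?_]
  · simp
  · rw [pow_succ, LinearMap.smul_apply, Module.End.mul_apply, LinearMap.smul_apply, Om_apply,
      Finset.sum_eq_zero fun i _ => by rw [hv, map_zero]]
    simp

/-- If the commutator of `X` and `c Ω` is an operator `Z` commuting with `Ω`, then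
`X exp(c Ω) = exp(c Ω) (X + Z)`. -/
theorem apply_expOm (c : ℂ) (P Q : h →ₗ[ℂ] Module.End ℂ V) [Anti P P] [Anti P Q] [Anti Q P]
    [Anti Q Q] {X Z : Module.End ℂ V} (hX : ∀ v, X (c • Om α β P Q v) = c • Om α β P Q (X v) + Z v)
    (hZ : ∀ v, Z (Om α β P Q v) = Om α β P Q (Z v)) (v : V) :
    X (expOm α β c P Q v) = expOm α β c P Q (X v + Z v) := by
  have := mul_truncExp (n := Fintype.card ι + 1) (X := X) (Y := c • Om α β P Q) (Z := Z)
    (LinearMap.ext hX) (Commute.smul_right (LinearMap.ext hZ) c) (smul_Om_pow α β c P Q)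
  exact LinearMap.congr_fun this v

end Bilinears

open Parity (par par_par)

/-! ### Intertwining relations for the structure maps of tensor products -/

section Structure

variable {h : Type u} [AddCommGroup h] [Module ℂ h]
variable {X Y Z V W N : Type u} [AddCommGroup X] [Module ℂ X] [AddCommGroup Y] [Module ℂ Y]
  [AddCommGroup Z] [Module ℂ Z] [AddCommGroup V] [Module ℂ V] [AddCommGroup W] [Module ℂ W]
  [AddCommGroup N] [Module ℂ N]

theorem tensor_ext₃ {F G : X ⊗[ℂ] (Y ⊗[ℂ] Z) →ₗ[ℂ] N}
    (H : ∀ x y z, F (x ⊗ₜ (y ⊗ₜ z)) = G (x ⊗ₜ (y ⊗ₜ z))) (t) : F t = G t := by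
  refine LinearMap.congr_fun (TensorProduct.ext' fun x t => ?_) t
  exact LinearMap.congr_fun (f := F ∘ₗ TensorProduct.mk ℂ _ _ x)
    (g := G ∘ₗ TensorProduct.mk ℂ _ _ x) (TensorProduct.ext' fun y z => H x y z) t

theorem tensor_ext₃' {F G : (X ⊗[ℂ] Y) ⊗[ℂ] Z →ₗ[ℂ] N}
    (H : ∀ x y z, F ((x ⊗ₜ y) ⊗ₜ z) = G ((x ⊗ₜ y) ⊗ₜ z)) (t) : F t = G t :=
  LinearMap.congr_fun (TensorProduct.ext_threefold H) t

theorem tensor_ext₄ {F G : X ⊗[ℂ] (Y ⊗[ℂ] (Z ⊗[ℂ] V)) →ₗ[ℂ] N}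
    (H : ∀ x y z v, F (x ⊗ₜ (y ⊗ₜ (z ⊗ₜ v))) = G (x ⊗ₜ (y ⊗ₜ (z ⊗ₜ v)))) (t) : F t = G t := by
  refine LinearMap.congr_fun (TensorProduct.ext' fun x t => ?_) t
  exact tensor_ext₃ (F := F ∘ₗ TensorProduct.mk ℂ _ _ x) (G := G ∘ₗ TensorProduct.mk ℂ _ _ x)
    (fun y z v => H x y z v) t

theorem tensor_ext₅ {F G : X ⊗[ℂ] (Y ⊗[ℂ] (Z ⊗[ℂ] (V ⊗[ℂ] W))) →ₗ[ℂ] N}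
    (H : ∀ x y z v w, F (x ⊗ₜ (y ⊗ₜ (z ⊗ₜ (v ⊗ₜ w)))) = G (x ⊗ₜ (y ⊗ₜ (z ⊗ₜ (v ⊗ₜ w))))) (t) :
    F t = G t := by
  refine LinearMap.congr_fun (TensorProduct.ext' fun x t => ?_) t
  exact tensor_ext₄ (F := F ∘ₗ TensorProduct.mk ℂ _ _ x) (G := G ∘ₗ TensorProduct.mk ℂ _ _ x)
    (fun y z v w => H x y z v w) t

theorem reassoc_inl (P : h →ₗ[ℂ] Module.End ℂ X) (a : h) (t : X ⊗[ℂ] (Y ⊗[ℂ] Z)) :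
    reassoc X Y Z (inl P a t) = inl (inl P) a (reassoc X Y Z t) :=
  tensor_ext₃ (F := reassoc X Y Z ∘ₗ inl P a) (G := inl (inl P) a ∘ₗ reassoc X Y Z)
    (fun x y z => by simp) t

theorem reassoc_inr_inl [Parity X] (P : h →ₗ[ℂ] Module.End ℂ Y) (a : h)
    (t : X ⊗[ℂ] (Y ⊗[ℂ] Z)) :
    reassoc X Y Z (inr (inl P) a t) = inl (inr P) a (reassoc X Y Z t) :=
  tensor_ext₃ (F := reassoc X Y Z ∘ₗ inr (inl P) a) (G := inl (inr P) a ∘ₗ reassoc X Y Z)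
    (fun x y z => by simp) t

theorem reassoc_inr_inr [Parity X] [Parity Y] (P : h →ₗ[ℂ] Module.End ℂ Z) (a : h)
    (t : X ⊗[ℂ] (Y ⊗[ℂ] Z)) :
    reassoc X Y Z (inr (inr P) a t) = inr P a (reassoc X Y Z t) :=
  tensor_ext₃ (F := reassoc X Y Z ∘ₗ inr (inr P) a) (G := inr P a ∘ₗ reassoc X Y Z)
    (fun x y z => by simp) t

theorem unassoc_inl_inl (P : h →ₗ[ℂ] Module.End ℂ X) (a : h) (t : (X ⊗[ℂ] Y) ⊗[ℂ] Z) :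
    unassoc X Y Z (inl (inl P) a t) = inl P a (unassoc X Y Z t) :=
  tensor_ext₃' (F := unassoc X Y Z ∘ₗ inl (inl P) a) (G := inl P a ∘ₗ unassoc X Y Z)
    (fun x y z => by simp) t

theorem unassoc_inl_inr [Parity X] (P : h →ₗ[ℂ] Module.End ℂ Y) (a : h)
    (t : (X ⊗[ℂ] Y) ⊗[ℂ] Z) :
    unassoc X Y Z (inl (inr P) a t) = inr (inl P) a (unassoc X Y Z t) :=
  tensor_ext₃' (F := unassoc X Y Z ∘ₗ inl (inr P) a) (G := inr (inl P) a ∘ₗ unassoc X Y Z)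
    (fun x y z => by simp) t

theorem unassoc_inr [Parity X] [Parity Y] (P : h →ₗ[ℂ] Module.End ℂ Z) (a : h)
    (t : (X ⊗[ℂ] Y) ⊗[ℂ] Z) :
    unassoc X Y Z (inr P a t) = inr (inr P) a (unassoc X Y Z t) :=
  tensor_ext₃' (F := unassoc X Y Z ∘ₗ inr P a) (G := inr (inr P) a ∘ₗ unassoc X Y Z)
    (fun x y z => by simp) t

theorem map_id_inl (F : V →ₗ[ℂ] W) (P : h →ₗ[ℂ] Module.End ℂ X) (a : h) (t : X ⊗[ℂ] V) :
    TensorProduct.map LinearMap.id F (inl P a t) =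
      inl P a (TensorProduct.map LinearMap.id F t) :=
  LinearMap.congr_fun (f := TensorProduct.map LinearMap.id F ∘ₗ inl P a)
    (g := inl P a ∘ₗ TensorProduct.map LinearMap.id F) (TensorProduct.ext' fun x v => by simp) t

theorem map_id_inr [Parity X] {F : V →ₗ[ℂ] W} {P : h →ₗ[ℂ] Module.End ℂ V}
    {P' : h →ₗ[ℂ] Module.End ℂ W} (hF : ∀ a v, F (P a v) = P' a (F v)) (a : h)
    (t : X ⊗[ℂ] V) :
    TensorProduct.map LinearMap.id F (inr P a t) =
      inr P' a (TensorProduct.map LinearMap.id F t) :=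
  LinearMap.congr_fun (f := TensorProduct.map LinearMap.id F ∘ₗ inr P a)
    (g := inr P' a ∘ₗ TensorProduct.map LinearMap.id F)
    (TensorProduct.ext' fun x v => by simp [hF]) t

theorem map_inl_id {F : V →ₗ[ℂ] W} {P : h →ₗ[ℂ] Module.End ℂ V}
    {P' : h →ₗ[ℂ] Module.End ℂ W} (hF : ∀ a v, F (P a v) = P' a (F v)) (a : h)
    (t : V ⊗[ℂ] X) :
    TensorProduct.map F LinearMap.id (inl P a t) =
      inl P' a (TensorProduct.map F LinearMap.id t) :=
  LinearMap.congr_fun (f := TensorProduct.map F LinearMap.id ∘ₗ inl P a)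
    (g := inl P' a ∘ₗ TensorProduct.map F LinearMap.id)
    (TensorProduct.ext' fun x v => by simp [hF]) t

theorem map_inr_id [Parity V] [Parity W] {F : V →ₗ[ℂ] W} (hF : ∀ v, F (par v) = par (F v))
    (P : h →ₗ[ℂ] Module.End ℂ X) (a : h) (t : V ⊗[ℂ] X) :
    TensorProduct.map F LinearMap.id (inr P a t) =
      inr P a (TensorProduct.map F LinearMap.id t) :=
  LinearMap.congr_fun (f := TensorProduct.map F LinearMap.id ∘ₗ inr P a)
    (g := inr P a ∘ₗ TensorProduct.map F LinearMap.id)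
    (TensorProduct.ext' fun x v => by simp [hF]) t

theorem inl_add (P Q : h →ₗ[ℂ] Module.End ℂ V) :
    inl (W := W) (P + Q) = inl P + inl Q :=
  LinearMap.ext fun a => TensorProduct.ext' fun v w => by simp [TensorProduct.add_tmul]

theorem inr_add [Parity V] (P Q : h →ₗ[ℂ] Module.End ℂ W) :
    inr (V := V) (P + Q) = inr P + inr Q :=
  LinearMap.ext fun a => TensorProduct.ext' fun v w => by simp [TensorProduct.tmul_add]

theorem inl_smul (c : ℂ) (P : h →ₗ[ℂ] Module.End ℂ V) : inl (W := W) (c • P) = c • inl P :=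
  LinearMap.ext fun a => TensorProduct.ext' fun v w => by simp [TensorProduct.smul_tmul']

theorem inr_smul [Parity V] (c : ℂ) (P : h →ₗ[ℂ] Module.End ℂ W) :
    inr (V := V) (c • P) = c • inr P :=
  LinearMap.ext fun a => TensorProduct.ext' fun v w => by simp

/-! ### The signed exchange of tensor factors -/

/-- The symmetry `v ⊗ w ↦ (-1)^{|v||w|} w ⊗ v`, written as a polynomial in the parities, so that no
decomposition into homogeneous components is needed. -/
def swap (V W : Type u) [AddCommGroup V] [Module ℂ V] [AddCommGroup W] [Module ℂ W] [Parity V]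
    [Parity W] : V ⊗[ℂ] W →ₗ[ℂ] W ⊗[ℂ] V :=
  (TensorProduct.comm ℂ V W).toLinearMap ∘ₗ
    ((1 / 2 : ℂ) • (TensorProduct.map (LinearMap.id + par) LinearMap.id +
      TensorProduct.map (LinearMap.id - par) par))

theorem swap_tmul [Parity V] [Parity W] (v : V) (w : W) :
    swap V W (v ⊗ₜ w) = (1 / 2 : ℂ) •
      (w ⊗ₜ v + w ⊗ₜ par v + (par w ⊗ₜ v - par w ⊗ₜ par v)) := by
  simp [swap, TensorProduct.add_tmul, TensorProduct.sub_tmul]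

theorem swap_inl [Parity V] [Parity W] (P : h →ₗ[ℂ] Module.End ℂ V) [OddOp P] (a : h)
    (t : V ⊗[ℂ] W) : swap V W (inl P a t) = inr P a (swap V W t) := by
  induction t with
  | zero => simp
  | add x y hx hy => simp only [map_add, hx, hy]
  | tmul v w =>
    simp only [inl_tmul, swap_tmul, map_smul, map_add, map_sub, inr_tmul, par_par,
      OddOp.apply_par, TensorProduct.tmul_neg]
    have : par (P a v) = - P a (par v) := by rw [OddOp.apply_par, neg_neg]
    simp only [this, TensorProduct.tmul_neg]
    module

theorem swap_inr [Parity V] [Parity W] (P : h →ₗ[ℂ] Module.End ℂ W) [OddOp P] (a : h)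
    (t : V ⊗[ℂ] W) : swap V W (inr P a t) = inl P a (swap V W t) := by
  induction t with
  | zero => simp
  | add x y hx hy => simp only [map_add, hx, hy]
  | tmul v w =>
    simp only [inl_tmul, swap_tmul, map_smul, map_add, map_sub, inr_tmul, par_par]
    have : par (P a w) = - P a (par w) := by rw [OddOp.apply_par, neg_neg]
    simp only [this, TensorProduct.neg_tmul]
    module

theorem swap_swap [Parity V] [Parity W] (t : V ⊗[ℂ] W) : swap W V (swap V W t) = t := by
  induction t with
  | zero => simp
  | add x y hx hy => simp only [map_add, hx, hy]
  | tmul v w =>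
    simp only [swap_tmul, map_smul, map_add, map_sub, par_par]
    module

theorem swap_par [Parity V] [Parity W] (t : V ⊗[ℂ] W) :
    swap V W (par t) = par (swap V W t) := by
  induction t with
  | zero => simp
  | add x y hx hy => simp only [map_add, hx, hy]
  | tmul v w => simp only [swap_tmul, map_smul, map_add, map_sub, par_par, par_tmul]

theorem swap_tmul_of_left [Parity V] [Parity W] {v : V} (hv : par v = v) (w : W) :
    swap V W (v ⊗ₜ w) = w ⊗ₜ v := by
  rw [swap_tmul, hv]
  module

theorem swap_tmul_of_right [Parity V] [Parity W] (v : V) {w : W} (hw : par w = w) :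
    swap V W (v ⊗ₜ w) = w ⊗ₜ v := by
  rw [swap_tmul, hw]
  module

/-- The symmetry of super vector spaces agrees with `swap` as soon as the parities agree. -/
theorem braid_eq_swap (V W : SuperVect.{u}) [pV : Parity V.carrier] [pW : Parity W.carrier]
    (hV : ∀ v : V.carrier, par v = V.par v) (hW : ∀ w : W.carrier, par w = W.par w) :
    SuperVect.braid V W = swap V.carrier W.carrier := by
  refine TensorProduct.ext' fun v w => ?_
  rw [swap_tmul, hV, hW]
  have h1 : v = V.projEven v + V.projOdd v := (V.projEven_add_projOdd v).symm
  have h2 : V.par v = V.projEven v - V.projOdd v := rfl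
  change w ⊗ₜ V.projEven v + W.par w ⊗ₜ V.projOdd v = _
  rw [h2]
  conv_rhs => rw [h1]
  simp only [map_add, TensorProduct.tmul_add, TensorProduct.tmul_sub]
  have h3 : V.projEven (V.projEven v) = V.projEven v :=
    Submodule.projection_apply_of_mem_left V.isCompl (V.projEven_mem v)
  have h4 : V.projEven (V.projOdd v) = 0 :=
    (Submodule.projection_apply_eq_zero_iff V.isCompl).2 (V.projOdd_mem v)
  have h5 : V.projOdd (V.projEven v) = 0 :=
    (Submodule.projection_apply_eq_zero_iff V.isCompl.symm).2 (V.projEven_mem v)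
  have h6 : V.projOdd (V.projOdd v) = V.projOdd v :=
    Submodule.projection_apply_of_mem_left V.isCompl.symm (V.projOdd_mem v)
  simp only [h3, h4, h5, h6, TensorProduct.tmul_zero]
  module

end Structure

/-! ### Parities of super vector spaces -/

section SuperPar

theorem super_par_tmul (V W : SuperVect.{u}) (x : V.carrier ⊗[ℂ] W.carrier) :
    (V.tensor W).par x = TensorProduct.map V.par W.par x := by
  have h0 : ∀ x ∈ SuperVect.tensorEven V W,
      (V.tensor W).par x = TensorProduct.map V.par W.par x := fun x hx => by
    rw [(V.tensor W).par_of_even hx]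
    exact (sub_eq_zero.1 (SuperVect.par_tmul_of_tensorEven V W hx)).symm
  have h1 : ∀ x ∈ SuperVect.tensorOdd V W,
      (V.tensor W).par x = TensorProduct.map V.par W.par x := fun x hx => by
    rw [(V.tensor W).par_of_odd hx]
    exact (eq_neg_of_add_eq_zero_left (SuperVect.par_tmul_of_tensorOdd V W hx)).symm
  have hx := (V.tensor W).projEven_add_projOdd x
  rw [← hx, map_add, map_add, h0 _ ((V.tensor W).projEven_mem x),
    h1 _ ((V.tensor W).projOdd_mem x)]

theorem super_par_U {h : Type u} [AddCommGroup h] [Module ℂ h] (x : U h) :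
    (USuper h).par x = par x := by
  have h0 (y : U h) (hy : y ∈ grading h 0) : (USuper h).par y = par y := by
    rw [(USuper h).par_of_even hy]
    exact (CliffordAlgebra.involute_eq_of_mem_even hy).symm
  have h1 (y : U h) (hy : y ∈ grading h 1) : (USuper h).par y = par y := by
    rw [(USuper h).par_of_odd hy]
    exact (CliffordAlgebra.involute_eq_of_mem_odd hy).symm
  have hx : (USuper h).projEven x + (USuper h).projOdd x = x := (USuper h).projEven_add_projOdd x
  rw [← hx]
  exact (map_add _ _ _).trans ((congrArg₂ _ (h0 _ ((USuper h).projEven_mem x))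
    (h1 _ ((USuper h).projOdd_mem x))).trans (map_add _ _ _).symm)

theorem mem_even_of_par {V : SuperVect.{u}} {v : V.carrier} (hv : V.par v = v) : v ∈ V.even := by
  have h1 := V.projEven_add_projOdd v
  have h2 : V.projEven v - V.projOdd v = v := hv
  have h3 : (2 : ℂ) • V.projEven v = (2 : ℂ) • v := by
    calc _ = (V.projEven v + V.projOdd v) + (V.projEven v - V.projOdd v) := by module
      _ = _ := by rw [h1, h2, two_smul]
  rw [← smul_right_injective _ (two_ne_zero' ℂ) h3]
  exact V.projEven_mem v

theorem mem_odd_of_par {V : SuperVect.{u}} {v : V.carrier} (hv : V.par v = -v) : v ∈ V.odd := by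
  have h1 := V.projEven_add_projOdd v
  have h2 : V.projEven v - V.projOdd v = -v := hv
  have h3 : (2 : ℂ) • V.projOdd v = (2 : ℂ) • v := by
    calc _ = (V.projEven v + V.projOdd v) - (V.projEven v - V.projOdd v) := by module
      _ = _ := by rw [h1, h2, two_smul, sub_neg_eq_add]
  rw [← smul_right_injective _ (two_ne_zero' ℂ) h3]
  exact V.projOdd_mem v

/-- A linear map is even as soon as it commutes with the parity involutions. -/
theorem isEven_of_par {V W : SuperVect.{u}} {f : V.carrier →ₗ[ℂ] W.carrier}
    (hf : ∀ v, f (V.par v) = W.par (f v)) : SuperVect.IsEven (V := V) (W := W) f :=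
  ⟨fun v hv => mem_even_of_par (by rw [← hf, V.par_of_even hv]),
    fun v hv => mem_odd_of_par (by rw [← hf, V.par_of_odd hv, map_neg])⟩

end SuperPar

/-! ### Contractions and the Heisenberg relation -/

section Contraction

variable {h : Type u} [AddCommGroup h] [Module ℂ h] (ω : LinearMap.BilinForm ℂ h)

/-- The action of `h` on the exterior algebra `U(h)` by contractions, `a ↦ (x ↦ (a, -) ⌋ x)`. -/
def DU : h →ₗ[ℂ] Module.End ℂ (U h) :=
  CliffordAlgebra.contractLeft (Q := (0 : QuadraticForm ℂ h)) ∘ₗ ω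

theorem DU_ι_mul (a b : h) (x : U h) :
    DU ω a (ExteriorAlgebra.ι ℂ b * x) = ω a b • x - ExteriorAlgebra.ι ℂ b * DU ω a x :=
  CliffordAlgebra.contractLeft_ι_mul (ω a) b x

theorem DU_algebraMap (a : h) (c : ℂ) : DU ω a (algebraMap ℂ (U h) c) = 0 :=
  CliffordAlgebra.contractLeft_algebraMap (0 : QuadraticForm ℂ h) (ω a) c

theorem DU_one (a : h) : DU ω a (1 : U h) = 0 :=
  CliffordAlgebra.contractLeft_one (0 : QuadraticForm ℂ h) (ω a)

theorem par_ι_mul (a : h) (x : U h) :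
    par (ExteriorAlgebra.ι ℂ a * x : U h) = -(ExteriorAlgebra.ι ℂ a * par x) := by
  have := OddOp.apply_par (P := LU h) a x
  rw [LU_apply, LU_apply] at this
  rw [this, neg_neg]

theorem par_one : par (1 : U h) = 1 :=
  map_one (CliffordAlgebra.involute (Q := (0 : QuadraticForm ℂ h)))

theorem par_algebraMap (c : ℂ) : par (algebraMap ℂ (U h) c) = algebraMap ℂ (U h) c :=
  AlgHom.commutes (CliffordAlgebra.involute (Q := (0 : QuadraticForm ℂ h))) c

instance : OddOp (DU ω) where
  apply_par a x := by
    induction x using CliffordAlgebra.left_induction with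
    | algebraMap r => erw [par_algebraMap, DU_algebraMap, map_zero, neg_zero]
    | add x y hx hy => simp only [map_add, hx, hy, neg_add]
    | ι_mul x m hx =>
      erw [par_ι_mul, map_neg, DU_ι_mul, DU_ι_mul, map_sub, map_smul, par_ι_mul, hx]
      simp

instance : Anti (DU ω) (DU ω) where
  apply_comm a b x := CliffordAlgebra.contractLeft_comm (ω a) (ω b) x

/-- The Heisenberg (Clifford) relation `D(a) L(b) + L(b) D(a) = (a, b)`. -/
class Heis {V : Type*} [AddCommGroup V] [Module ℂ V] (D L : h →ₗ[ℂ] Module.End ℂ V) : Prop where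
  apply_comm : ∀ a b v, D a (L b v) = ω a b • v - L b (D a v)

instance : Heis ω (DU ω) (LU h) := ⟨fun a b x => DU_ι_mul ω a b x⟩

section HeisTensor

variable {V W : Type*} [AddCommGroup V] [Module ℂ V] [AddCommGroup W] [Module ℂ W]

instance (D L : h →ₗ[ℂ] Module.End ℂ V) [Heis ω D L] :
    Heis ω (inl (W := W) D) (inl (W := W) L) where
  apply_comm a b v := by
    induction v with
    | zero => simp
    | add x y hx hy =>
      simp only [map_add, hx, hy, smul_add]
      abel
    | tmul v w =>
      simp only [inl_tmul]
      rw [Heis.apply_comm (ω := ω), TensorProduct.sub_tmul, TensorProduct.smul_tmul']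

instance [Parity V] (D L : h →ₗ[ℂ] Module.End ℂ W) [Heis ω D L] :
    Heis ω (inr (V := V) D) (inr (V := V) L) where
  apply_comm a b v := by
    induction v with
    | zero => simp
    | add x y hx hy =>
      simp only [map_add, hx, hy, smul_add]
      abel
    | tmul v w =>
      simp only [inr_tmul]
      rw [Heis.apply_comm (ω := ω), TensorProduct.tmul_sub, TensorProduct.tmul_smul, par_par]

end HeisTensor

/-! ### Dual bases of the pairing -/

/-- The families `α` and `β` are dual to each other for the skew-symmetric pairing `ω`, in the form
of the two expansions of a vector. -/
structure IsDualPair {ι : Type*} [Fintype ι] (α β : ι → h) : Prop where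
  skew : ∀ a b, ω a b = -ω b a
  expand_left : ∀ a, ∑ i, ω a (β i) • α i = a
  expand_right : ∀ a, ∑ i, ω (α i) a • β i = a

theorem isDualPair_of_basis {ι : Type*} [Fintype ι] [DecidableEq ι]
    (hskew : ∀ a b, ω a b = -ω b a) (α β : Module.Basis ι ℂ h)
    (hαβ : ∀ i j, ω (α i) (β j) = if i = j then 1 else 0) : IsDualPair ω α β where
  skew := hskew
  expand_left a := by
    have : (∑ i, (LinearMap.toSpanSingleton ℂ h (α i)) ∘ₗ (ω.flip (β i))) = LinearMap.id :=
      α.ext fun j => by simp [LinearMap.sum_apply, hαβ]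
    simpa [LinearMap.sum_apply] using LinearMap.congr_fun this a
  expand_right a := by
    have : (∑ i, (LinearMap.toSpanSingleton ℂ h (β i)) ∘ₗ (ω (α i))) = LinearMap.id :=
      β.ext fun j => by simp [LinearMap.sum_apply, hαβ]
    simpa [LinearMap.sum_apply] using LinearMap.congr_fun this a

variable {ω} {ι : Type*} [Fintype ι] {α β : ι → h}
variable {V : Type*} [AddCommGroup V] [Module ℂ V]

theorem IsDualPair.sum_right (hd : IsDualPair ω α β) (P : h →ₗ[ℂ] Module.End ℂ V) (a : h) (v : V) :
    ∑ i, ω a (β i) • P (α i) v = P a v := by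
  conv_rhs => rw [← hd.expand_left a]
  simp [map_sum, LinearMap.sum_apply]

theorem IsDualPair.sum_left (hd : IsDualPair ω α β) (P : h →ₗ[ℂ] Module.End ℂ V) (a : h) (v : V) :
    ∑ i, ω (α i) a • P (β i) v = P a v := by
  conv_rhs => rw [← hd.expand_right a]
  simp [map_sum, LinearMap.sum_apply]

/-- The copairing is supersymmetric. -/
theorem IsDualPair.Om_symm (hd : IsDualPair ω α β) (P Q : h →ₗ[ℂ] Module.End ℂ V) [Anti P Q] :
    Om α β P Q = Om α β Q P := by
  ext v
  rw [Om_apply, Om_apply]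
  have h1 (i : ι) : P (β i) (Q (α i) v) = ∑ j, ω (β i) (β j) • P (α j) (Q (α i) v) :=
    (hd.sum_right P _ _).symm
  have h2 (j : ι) : Q (β j) (P (α j) v) = ∑ i, ω (β i) (β j) • P (α j) (Q (α i) v) := by
    rw [← hd.sum_right Q]
    refine Finset.sum_congr rfl fun i _ => ?_
    rw [hd.skew, Anti.apply_comm (P := P) (Q := Q), neg_smul, smul_neg]
  simp only [h1, h2]
  exact Finset.sum_comm

theorem IsDualPair.expOm_symm (hd : IsDualPair ω α β) (c : ℂ)
    (P Q : h →ₗ[ℂ] Module.End ℂ V) [Anti P Q] :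
    expOm α β c P Q = expOm α β c Q P := by
  rw [expOm, hd.Om_symm, expOm]

/-- `exp(c P D) L(a) = (L(a) + c P(a)) exp(c P D)` for a contraction `D`. -/
theorem IsDualPair.expOm_apply_left (hd : IsDualPair ω α β) (c : ℂ)
    (P D L : h →ₗ[ℂ] Module.End ℂ V) [Anti P P] [Anti P D]
    [Anti D P] [Anti D D] [Anti P L] [Heis ω D L] (a : h) (v : V) :
    expOm α β c P D (L a v) = L a (expOm α β c P D v) + c • P a (expOm α β c P D v) := by
  have hP (v : V) : P a (Om α β P D v) = Om α β P D (P a v) := by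
    rw [Om_apply, Om_apply, map_sum]
    refine Finset.sum_congr rfl fun i _ => ?_
    rw [Anti.apply_comm (P := P) (Q := P), Anti.apply_comm (P := P) (Q := D), map_neg, neg_neg]
  have hL (v : V) : L a (c • Om α β P D v) = c • Om α β P D (L a v) + (-c • P a) v := by
    rw [map_smul, LinearMap.smul_apply, neg_smul, ← smul_neg, ← smul_add]
    congr 1
    rw [Om_apply, Om_apply, map_sum, ← hd.sum_left P, ← sub_eq_add_neg, ← Finset.sum_sub_distrib]
    refine Finset.sum_congr rfl fun i _ => ?_
    rw [Heis.apply_comm (ω := ω) (D := D), map_sub, map_smul, sub_sub_cancel_left,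
      Anti.apply_comm (P := P) (Q := L), neg_neg]
  have h1 := apply_expOm α β c P D hL (fun v => by
    rw [LinearMap.smul_apply, LinearMap.smul_apply, hP, map_smul]) v
  have h2 := map_expOm_of_anti α β (P a) c (P := P) (Q := D) (P' := P) (Q' := D)
    (fun b v => Anti.apply_comm _ _ _) (fun b v => Anti.apply_comm _ _ _) v
  rw [h1, h2, map_add, LinearMap.smul_apply, map_smul]
  module

/-- `D(a) exp(c P L) = exp(c P L) (D(a) + c P(a))` for a contraction `D`. -/
theorem IsDualPair.contract_expOm (hd : IsDualPair ω α β) (c : ℂ)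
    (P D L : h →ₗ[ℂ] Module.End ℂ V) [Anti P P] [Anti P L]
    [Anti L P] [Anti L L] [Anti D P] [Heis ω D L] (a : h) (v : V) :
    D a (expOm α β c P L v) = expOm α β c P L (D a v + c • P a v) := by
  have hP (v : V) : P a (Om α β P L v) = Om α β P L (P a v) := by
    rw [Om_apply, Om_apply, map_sum]
    refine Finset.sum_congr rfl fun i _ => ?_
    rw [Anti.apply_comm (P := P) (Q := P), Anti.apply_comm (P := P) (Q := L), map_neg, neg_neg]
  refine apply_expOm α β c P L (X := D a) (Z := c • P a) (fun v => ?_) (fun v => ?_) v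
  · rw [map_smul, LinearMap.smul_apply, ← smul_add]
    congr 1
    rw [Om_apply, Om_apply, map_sum, ← hd.sum_left P, ← Finset.sum_add_distrib]
    refine Finset.sum_congr rfl fun i _ => ?_
    rw [Anti.apply_comm (P := D) (Q := P), Heis.apply_comm (ω := ω) (D := D), map_sub, map_smul,
      hd.skew (α i) a]
    module
  · rw [LinearMap.smul_apply, LinearMap.smul_apply, hP, map_smul]

end Contraction

/-! ### Induction on the enveloping algebra -/

section Induction

variable {h : Type u} [AddCommGroup h] [Module ℂ h]
variable {X M N : Type u} [AddCommGroup X] [Module ℂ X] [AddCommGroup M] [Module ℂ M]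
  [AddCommGroup N] [Module ℂ N]

/-- Two maps out of `U(h)` which intertwine left multiplication with the same operators are equal if
they agree at `1`. -/
theorem U_hom_ext {F G : U h →ₗ[ℂ] N} (T : h →ₗ[ℂ] Module.End ℂ N) (h1 : F 1 = G 1)
    (hF : ∀ a x, F (ExteriorAlgebra.ι ℂ a * x) = T a (F x))
    (hG : ∀ a x, G (ExteriorAlgebra.ι ℂ a * x) = T a (G x)) (x : U h) : F x = G x := by
  induction x using CliffordAlgebra.left_induction with
  | algebraMap r =>
    change F (algebraMap ℂ (U h) r) = G (algebraMap ℂ (U h) r)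
    rw [Algebra.algebraMap_eq_smul_one, map_smul, map_smul, h1]
  | add x y hx hy => rw [map_add, map_add, hx, hy]
  | ι_mul x m hx => exact (hF m x).trans ((congrArg _ hx).trans (hG m x).symm)

/-- The analogue of `U_hom_ext` for maps out of `U(h) ⊗ M`. -/
theorem U_tensor_hom_ext {F G : U h ⊗[ℂ] M →ₗ[ℂ] N} (T : h →ₗ[ℂ] Module.End ℂ N)
    (h1 : ∀ m, F (1 ⊗ₜ m) = G (1 ⊗ₜ m)) (hF : ∀ a t, F (inl (LU h) a t) = T a (F t))
    (hG : ∀ a t, G (inl (LU h) a t) = T a (G t)) (t : U h ⊗[ℂ] M) : F t = G t := by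
  refine LinearMap.congr_fun (TensorProduct.ext' fun x m => ?_) t
  exact U_hom_ext (F := F ∘ₗ (TensorProduct.mk ℂ _ _).flip m)
    (G := G ∘ₗ (TensorProduct.mk ℂ _ _).flip m) T (h1 m) (fun a x => hF a (x ⊗ₜ m))
    (fun a x => hG a (x ⊗ₜ m)) x

/-- The analogue of `U_hom_ext` for maps out of `X ⊗ U(h)`. -/
theorem tensor_U_hom_ext [Parity X] {F G : X ⊗[ℂ] U h →ₗ[ℂ] N}
    (T : h →ₗ[ℂ] Module.End ℂ N) (h1 : ∀ x, F (x ⊗ₜ 1) = G (x ⊗ₜ 1))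
    (hF : ∀ a t, F (inr (LU h) a t) = T a (F t))
    (hG : ∀ a t, G (inr (LU h) a t) = T a (G t)) (t : X ⊗[ℂ] U h) : F t = G t := by
  have key (u : U h) : ∀ x, F (x ⊗ₜ u) = G (x ⊗ₜ u) := by
    induction u using CliffordAlgebra.left_induction with
    | algebraMap r =>
      intro x
      change F (x ⊗ₜ algebraMap ℂ (U h) r) = G (x ⊗ₜ algebraMap ℂ (U h) r)
      rw [Algebra.algebraMap_eq_smul_one, TensorProduct.tmul_smul, map_smul, map_smul, h1]
    | add u v hu hv =>
      intro x
      exact (congrArg F (TensorProduct.tmul_add _ _ _)).trans (((map_add F _ _).trans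
        (congrArg₂ _ (hu x) (hv x))).trans ((map_add G _ _).symm.trans
        (congrArg G (TensorProduct.tmul_add _ _ _).symm)))
    | ι_mul u m hu =>
      intro x
      have e : x ⊗ₜ (ExteriorAlgebra.ι ℂ m * u : U h) = inr (LU h) m (par x ⊗ₜ[ℂ] (u : U h)) := by
        simp [par_par]
      exact (congrArg F e).trans ((hF m _).trans ((congrArg _ (hu (par x))).trans
        ((hG m _).symm.trans (congrArg G e.symm))))
  exact LinearMap.congr_fun (TensorProduct.ext' fun x u => key u x) t

end Induction

/-! ### Exponentials on a tensor factor -/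

section ExpTensor

variable {h : Type u} [AddCommGroup h] [Module ℂ h] {ι : Type*} [Fintype ι] (α β : ι → h)
variable {V W : Type u} [AddCommGroup V] [Module ℂ V] [AddCommGroup W] [Module ℂ W]

theorem tmul_expOm [Parity V] (c : ℂ) (P Q : h →ₗ[ℂ] Module.End ℂ W) (v : V) (w : W) :
    v ⊗ₜ expOm α β c P Q w = expOm α β c (inr P) (inr Q) (v ⊗ₜ w) := by
  refine truncExp_apply_comm (TensorProduct.mk ℂ V W v) (fun w => ?_) _ w
  simp only [LinearMap.smul_apply, Om_apply, map_smul, map_sum, TensorProduct.mk_apply, inr_tmul,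
    par_par]

theorem expOm_tmul (c : ℂ) (P Q : h →ₗ[ℂ] Module.End ℂ V) (v : V) (w : W) :
    expOm α β c P Q v ⊗ₜ w = expOm α β c (inl P) (inl Q) (v ⊗ₜ w) := by
  refine truncExp_apply_comm ((TensorProduct.mk ℂ V W).flip w) (fun w => ?_) _ v
  simp only [LinearMap.smul_apply, Om_apply, map_smul, map_sum, LinearMap.flip_apply,
    TensorProduct.mk_apply, inl_tmul]

theorem map_id_expOm [Parity V] (c : ℂ) (P Q : h →ₗ[ℂ] Module.End ℂ W) :
    TensorProduct.map (LinearMap.id : V →ₗ[ℂ] V) (expOm α β c P Q) =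
      expOm α β c (inr P) (inr Q) :=
  TensorProduct.ext' fun v w => tmul_expOm α β c P Q v w

theorem map_expOm_id (c : ℂ) (P Q : h →ₗ[ℂ] Module.End ℂ V) :
    TensorProduct.map (expOm α β c P Q) (LinearMap.id : W →ₗ[ℂ] W) =
      expOm α β c (inl P) (inl Q) :=
  TensorProduct.ext' fun v w => expOm_tmul α β c P Q v w

end ExpTensor

/-! ### The coproduct and the associator twists as exponentials -/

section Coproduct

variable {h : Type u} [AddCommGroup h] [Module ℂ h]

theorem UU_ext {N : Type*} [AddCommGroup N] [Module ℂ N] {F G : UU h →ₗ[ℂ] N}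
    (H0 : ∀ x ∈ grading h 0, ∀ y, F (GradedTensorProduct.tmul ℂ x y) =
      G (GradedTensorProduct.tmul ℂ x y))
    (H1 : ∀ x ∈ grading h 1, ∀ y, F (GradedTensorProduct.tmul ℂ x y) =
      G (GradedTensorProduct.tmul ℂ x y))
    (z : UU h) : F z = G z := by
  refine LinearMap.congr_fun (GradedTensorProduct.hom_ext _ _ (TensorProduct.ext' fun x y => ?_)) z
  have hx : (USuper h).projEven x + (USuper h).projOdd x = x := (USuper h).projEven_add_projOdd x
  rw [← hx, TensorProduct.add_tmul, map_add, map_add]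
  exact congrArg₂ _ (H0 _ ((USuper h).projEven_mem x) y) (H1 _ ((USuper h).projOdd_mem x) y)

theorem fromUU_tmul (x y : U h) :
    fromUU (GradedTensorProduct.tmul ℂ x y : UU h) = x ⊗ₜ[ℂ] y := rfl

theorem fromUU_includeLeft_mul (a : h) (z : UU h) :
    fromUU (GradedTensorProduct.includeLeft (grading h) (grading h) (ExteriorAlgebra.ι ℂ a) * z) =
      inl (LU h) a (fromUU z) := by
  refine UU_ext (F := fromUU ∘ₗ LinearMap.mulLeft ℂ (GradedTensorProduct.includeLeft (grading h)
    (grading h) (ExteriorAlgebra.ι ℂ a))) (G := inl (LU h) a ∘ₗ fromUU) ?_ ?_ z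
  · intro x hx y
    have := GradedTensorProduct.tmul_one_mul_coe_tmul (R := ℂ) (grading h) (grading h)
      (ExteriorAlgebra.ι ℂ a) ⟨x, hx⟩ y
    exact congrArg fromUU this
  · intro x hx y
    have := GradedTensorProduct.tmul_one_mul_coe_tmul (R := ℂ) (grading h) (grading h)
      (ExteriorAlgebra.ι ℂ a) ⟨x, hx⟩ y
    exact congrArg fromUU this

theorem fromUU_includeRight_mul (a : h) (z : UU h) :
    fromUU (GradedTensorProduct.includeRight (grading h) (grading h) (ExteriorAlgebra.ι ℂ a) * z) =
      inr (LU h) a (fromUU z) := by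
  have ha : (ExteriorAlgebra.ι ℂ a : U h) ∈ grading h 1 :=
    CliffordAlgebra.ι_mem_evenOdd_one (0 : QuadraticForm ℂ h) a
  refine UU_ext (F := fromUU ∘ₗ LinearMap.mulLeft ℂ (GradedTensorProduct.includeRight (grading h)
    (grading h) (ExteriorAlgebra.ι ℂ a))) (G := inr (LU h) a ∘ₗ fromUU) ?_ ?_ z
  · intro x hx y
    have := GradedTensorProduct.tmul_coe_mul_zero_coe_tmul (R := ℂ) (grading h) (grading h)
      (1 : U h) ⟨_, ha⟩ ⟨x, hx⟩ y
    refine (congrArg fromUU this).trans ?_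
    rw [fromUU_tmul, LinearMap.comp_apply, fromUU_tmul, inr_tmul, one_mul,
      show par x = x from CliffordAlgebra.involute_eq_of_mem_even hx]
    rfl
  · intro x hx y
    have := GradedTensorProduct.tmul_coe_mul_coe_tmul (R := ℂ) (grading h) (grading h)
      (1 : U h) ⟨_, ha⟩ ⟨x, hx⟩ y
    refine (congrArg fromUU this).trans ?_
    rw [LinearMap.comp_apply, fromUU_tmul, inr_tmul,
      show par x = -x from CliffordAlgebra.involute_eq_of_mem_odd hx, TensorProduct.neg_tmul]
    simp
    rfl

theorem coprod_one : coprod (1 : U h) = 1 ⊗ₜ 1 := by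
  change fromUU (coprodAlg 1) = _
  rw [map_one]
  rfl

theorem coprod_ι_mul (a : h) (x : U h) :
    coprod (ExteriorAlgebra.ι ℂ a * x) =
      (inl (LU h) + inr (LU h) : h →ₗ[ℂ] Module.End ℂ (U h ⊗[ℂ] U h)) a (coprod x) := by
  have h1 : coprodAlg (ExteriorAlgebra.ι ℂ a : U h) = coprodGen a :=
    ExteriorAlgebra.lift_ι_apply _ _ _ _
  change fromUU (coprodAlg (ExteriorAlgebra.ι ℂ a * x)) = _
  rw [map_mul, h1]
  change fromUU ((GradedTensorProduct.includeLeft (grading h) (grading h) (ExteriorAlgebra.ι ℂ a) +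
    GradedTensorProduct.includeRight (grading h) (grading h) (ExteriorAlgebra.ι ℂ a)) *
      coprodAlg x) = _
  rw [add_mul, map_add, fromUU_includeLeft_mul, fromUU_includeRight_mul]
  rfl

theorem rho_inl (R : SuperRep h) (a : h) (t : U h ⊗[ℂ] R.space.carrier) :
    R.rho (inl (LU h) a t) = R.act a (R.rho t) := by
  induction t with
  | zero => simp
  | add x y hx hy => simp only [map_add, hx, hy]
  | tmul u v =>
    have h1 : R.actU (ExteriorAlgebra.ι ℂ a) = R.act a := ExteriorAlgebra.lift_ι_apply _ _ _ _
    change R.actU (ExteriorAlgebra.ι ℂ a * u) v = R.act a (R.actU u v)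
    rw [map_mul, h1, Module.End.mul_apply]

theorem rho_one (R : SuperRep h) (v : R.space.carrier) : R.rho (1 ⊗ₜ v) = v := by
  change R.actU 1 v = v
  rw [map_one, Module.End.one_apply]

theorem antipode_symm_apply (x : U h) : antipode.symm x = par x := rfl

theorem braid_UU : SuperVect.braid (USuper h) (USuper h) = swap (U h) (U h) :=
  braid_eq_swap (USuper h) (USuper h) (pV := (inferInstance : Parity (U h)))
    (pW := (inferInstance : Parity (U h))) (fun v => (super_par_U v).symm)
    (fun v => (super_par_U v).symm)

end Coproduct

section Twists

variable {h : Type u} [AddCommGroup h] [Module ℂ h] {ω : LinearMap.BilinForm ℂ h}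
  {ι : Type*} [Fintype ι] {α β : ι → h}

theorem parity_ext {V : Type*} [AddCommGroup V] [Module ℂ V] {p q : Parity V}
    (hpq : p.par = q.par) : p = q := by
  cases p
  cases q
  cases hpq
  rfl

theorem twist010_eq (R S : SuperRep h) (X : SuperVect.{u}) (pR : Parity R.space.carrier)
    (pX : Parity X.carrier) (hR : pR.par = R.space.par) (hX : pX.par = X.par) [Anti R.act R.act] :
    twist010 α β R X S =
      expOm α β (Complex.I * (Real.pi : ℂ)) (inl R.act) (inr (inr S.act)) := by
  obtain rfl : pR = superParity R.space := parity_ext hR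
  obtain rfl : pX = superParity X := parity_ext hX
  rw [← nilExp_eq_expOm]
  rfl

theorem twist101_eq (X Y : SuperVect.{u}) (S : SuperRep h)
    (pX : Parity X.carrier) (hX : pX.par = X.par) :
    twist101 α β X S Y =
      expOm α β (Complex.I * (Real.pi : ℂ)) (inl (LU h)) (inr (inr (inl S.act))) := by
  obtain rfl : pX = superParity X := parity_ext hX
  rw [← nilExp_eq_expOm, twist101]
  congr 2
  have : (USuper h).par = par (V := U h) := LinearMap.ext super_par_U
  rw [Omega13U, this]
  rfl

/-- The coproduct in the associator produces the exponential `exp(Ω)`, with one leg of `Ω` acting on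
the representation and the other by contraction on `U(h)`. -/
theorem IsDualPair.twist110_apply (hd : IsDualPair ω α β) (X : SuperVect.{u}) (R : SuperRep h)
    (pX : Parity X.carrier) (hX : pX.par = X.par) (t : U h ⊗[ℂ] (X.carrier ⊗[ℂ] R.space.carrier)) :
    twist110 X R t = expOm α β 1 (inr (inr R.act)) (inl (DU ω)) t := by
  obtain rfl : pX = superParity X := parity_ext hX
  have hb : SuperVect.braid (USuper h) X = swap (U h) X.carrier :=
    braid_eq_swap (USuper h) X (pV := (inferInstance : Parity (U h)))
      (fun v => (super_par_U v).symm) (fun v => rfl)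
  refine U_tensor_hom_ext (inl (LU h) + inr (inr R.act)) ?_ ?_ ?_ t
  · refine fun t => TensorProduct.induction_on t (by simp) (fun x r => ?_) fun x y hx hy => by
      rw [TensorProduct.tmul_add, map_add, map_add, hx, hy]
    rw [expOm_apply_of_eq_zero]
    · simp only [twist110, hb, LinearMap.comp_apply, TensorProduct.map_tmul, coprod_one,
        LinearEquiv.coe_coe, TensorProduct.assoc_tmul, TensorProduct.assoc_symm_tmul,
        LinearMap.id_apply, swap_tmul_of_left (par_one (h := h)), rho_one]
    · intro a
      rw [inl_tmul, DU_one, TensorProduct.zero_tmul]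
  · intro a t
    have h1 (a : h) (t : U h ⊗[ℂ] (X.carrier ⊗[ℂ] R.space.carrier)) :
        TensorProduct.map LinearMap.id R.rho (unassoc X.carrier (U h) R.space.carrier
          (TensorProduct.map (swap (U h) X.carrier) LinearMap.id
            (reassoc (U h) X.carrier R.space.carrier (inl (LU h) a t)))) =
        inr R.act a (TensorProduct.map LinearMap.id R.rho (unassoc X.carrier (U h) R.space.carrier
          (TensorProduct.map (swap (U h) X.carrier) LinearMap.id
            (reassoc (U h) X.carrier R.space.carrier t)))) := by
      rw [reassoc_inl, map_inl_id (fun a v => swap_inl (LU h) a v), unassoc_inl_inr,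
        map_id_inr (fun a v => rho_inl R a v)]
    have h2 (a : h) (t : U h ⊗[ℂ] (X.carrier ⊗[ℂ] R.space.carrier)) :
        TensorProduct.map coprod LinearMap.id (inl (LU h) a t) =
        inl (inl (LU h) + inr (LU h)) a (TensorProduct.map coprod LinearMap.id t) :=
      map_inl_id (fun a v => coprod_ι_mul a v) a t
    simp only [twist110, hb, LinearMap.comp_apply, h2]
    rw [inl_add, LinearMap.add_apply, LinearMap.add_apply, map_add, map_add, unassoc_inl_inl,
      unassoc_inl_inr, map_id_inl, map_id_inr h1]
    rfl
  · intro a t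
    rw [hd.expOm_apply_left 1 _ _ (inl (LU h)), one_smul]
    rfl

/-- The analogue of `IsDualPair.twist110_apply` for an action from the left; the antipode produces the
sign in the exponent. -/
theorem IsDualPair.twist011_apply (hd : IsDualPair ω α β) (R : SuperRep h)
    (pR : Parity R.space.carrier) (hR : pR.par = R.space.par) (t : R.space.carrier ⊗[ℂ] U h) :
    twist011 R t =
      swap R.space.carrier (U h) (expOm α β (-1) (inl R.act) (inr (DU ω)) t) := by
  obtain rfl : pR = superParity R.space := parity_ext hR
  have hb : SuperVect.braid R.space (USuper h) = swap R.space.carrier (U h) :=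
    braid_eq_swap R.space (USuper h) (pW := (inferInstance : Parity (U h))) (fun v => rfl)
      (fun v => (super_par_U v).symm)
  refine tensor_U_hom_ext (F := twist011 R) (G := swap R.space.carrier (U h) ∘ₗ
    expOm α β (-1) (inl R.act) (inr (DU ω))) (inl (LU h) + (-1 : ℂ) • inr R.act) ?_ ?_ ?_ t
  · intro x
    have hx : swap R.space.carrier (U h) (x ⊗ₜ 1) = 1 ⊗ₜ x := swap_tmul_of_right x par_one
    have h11 : swap (U h) (U h) (1 ⊗ₜ 1) = 1 ⊗ₜ 1 := swap_tmul_of_right 1 par_one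
    rw [LinearMap.comp_apply, expOm_apply_of_eq_zero]
    · simp only [twist011, hb, braid_UU, LinearMap.comp_apply, TensorProduct.map_tmul, coprod_one,
        LinearEquiv.coe_coe, TensorProduct.assoc_tmul, antipode_symm_apply, par_one,
        LinearMap.id_apply, hx, h11, rho_one]
    · intro a
      rw [inr_tmul, DU_one, TensorProduct.tmul_zero]
  · intro a t
    have h2 (a : h) (x : U h) : (swap (U h) (U h) ∘ₗ coprod) (LU h a x) =
        (inl (LU h) + inr (LU h) : h →ₗ[ℂ] Module.End ℂ (U h ⊗[ℂ] U h)) a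
          ((swap (U h) (U h) ∘ₗ coprod) x) := by
      rw [LinearMap.comp_apply, LU_apply, coprod_ι_mul, LinearMap.add_apply, LinearMap.add_apply,
        map_add, swap_inl, swap_inr, add_comm]
      rfl
    have h4 (a : h) (t : U h ⊗[ℂ] R.space.carrier) :
        TensorProduct.map (swap (U h) (U h) ∘ₗ coprod) LinearMap.id (inl (LU h) a t) =
          inl (inl (LU h) + inr (LU h)) a
            (TensorProduct.map (swap (U h) (U h) ∘ₗ coprod) LinearMap.id t) :=
      map_inl_id h2 a t
    have h3 (a : h) (t : U h ⊗[ℂ] R.space.carrier) :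
        (R.rho ∘ₗ TensorProduct.map antipode.symm.toLinearMap LinearMap.id) (inl (LU h) a t) =
          ((-1 : ℂ) • R.act) a
            ((R.rho ∘ₗ TensorProduct.map antipode.symm.toLinearMap LinearMap.id) t) := by
      rw [LinearMap.comp_apply, map_inl_id (P' := (-1 : ℂ) • LU h), LinearMap.comp_apply]
      · rw [inl_smul, LinearMap.smul_apply, LinearMap.smul_apply, map_smul, rho_inl]
        rfl
      · intro a v
        rw [LinearMap.smul_apply, LinearMap.smul_apply, neg_one_smul]
        exact par_ι_mul a v
    simp only [twist011, hb, braid_UU, LinearMap.comp_apply]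
    rw [swap_inr, h4,
      inl_add, LinearMap.add_apply, LinearMap.add_apply, map_add, map_add, unassoc_inl_inl,
      unassoc_inl_inr, map_id_inl, map_id_inr h3]
    rw [inr_smul]
    rfl
  · intro a t
    rw [LinearMap.comp_apply, hd.expOm_apply_left (-1) _ _ (inr (LU h)), map_add, map_smul,
      swap_inl, swap_inr]
    rfl

end Twists

/-! ### Degrees in the exterior algebra -/

section Degree

variable {h : Type u} [AddCommGroup h] [Module ℂ h]

theorem U_hom_ext_degree {N : Type*} [AddCommGroup N] [Module ℂ N] {F G : U h →ₗ[ℂ] N}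
    (H : ∀ n, ∀ x ∈ ⋀[ℂ]^n h, F x = G x) (x : U h) : F x = G x := by
  have hx : x ∈ ⨆ i : ℕ, LinearMap.range (CliffordAlgebra.ι (0 : QuadraticForm ℂ h)) ^ i := by
    rw [CliffordAlgebra.iSup_ι_range_eq_top]
    trivial
  induction hx using Submodule.iSup_induction' with
  | mem i x hx => exact H i x hx
  | zero => rw [map_zero, map_zero]
  | add x y _ _ hx hy => rw [map_add, map_add, hx, hy]

/-- Induction on the degree of a homogeneous element of the exterior algebra. -/
theorem degree_induction {p : ℕ → U h → Prop} (h0 : ∀ c : ℂ, p 0 (algebraMap ℂ (U h) c))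
    (hadd : ∀ n x y, p n x → p n y → p n (x + y))
    (hmul : ∀ n, ∀ a, ∀ x ∈ ⋀[ℂ]^n h, p n x → p (n + 1) (ExteriorAlgebra.ι ℂ a * x))
    (n : ℕ) (x : U h) (hx : x ∈ ⋀[ℂ]^n h) : p n x := by
  induction n generalizing x with
  | zero =>
    obtain ⟨c, rfl⟩ := Submodule.mem_one.1 (by simpa using hx : x ∈ (1 : Submodule ℂ (U h)))
    exact h0 c
  | succ n ih =>
    have hx' : x ∈ LinearMap.range (ExteriorAlgebra.ι ℂ (M := h)) * ⋀[ℂ]^n h := by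
      rwa [ExteriorAlgebra.exteriorPower, ← pow_succ']
    induction hx' using Submodule.mul_induction_on' with
    | mem_mul_mem m hm y hy =>
      obtain ⟨a, rfl⟩ := hm
      exact hmul n a y hy (ih y hy)
    | add y hy z hz h1 h2 =>
      have e (w : U h) (hw : w ∈ LinearMap.range (ExteriorAlgebra.ι ℂ (M := h)) * ⋀[ℂ]^n h) :
          w ∈ ⋀[ℂ]^(n + 1) h := by rwa [ExteriorAlgebra.exteriorPower, pow_succ']
      exact hadd _ _ _ (h1 (e y hy)) (h2 (e z hz))

theorem ι_mul_mem_degree (a : h) {n : ℕ} {x : U h} (hx : x ∈ ⋀[ℂ]^n h) :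
    ExteriorAlgebra.ι ℂ a * x ∈ ⋀[ℂ]^(n + 1) h := by
  rw [ExteriorAlgebra.exteriorPower, pow_succ']
  exact Submodule.mul_mem_mul ⟨a, rfl⟩ hx

theorem par_of_degree {n : ℕ} {x : U h} (hx : x ∈ ⋀[ℂ]^n h) : par x = (-1 : ℂ) ^ n • x := by
  refine degree_induction (p := fun n x => par x = (-1 : ℂ) ^ n • x) (fun c => ?_)
    (fun n x y hx hy => by rw [map_add, hx, hy, smul_add]) (fun n a x _ hx => ?_) n x hx
  · rw [par_algebraMap, pow_zero, one_smul]
  · rw [par_ι_mul, hx, pow_succ, mul_smul_comm]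
    module

variable (ω : LinearMap.BilinForm ℂ h)

theorem DU_degree (a : h) {n : ℕ} {x : U h} (hx : x ∈ ⋀[ℂ]^n h) :
    DU ω a x = 0 ∧ n = 0 ∨ ∃ m, n = m + 1 ∧ DU ω a x ∈ ⋀[ℂ]^m h := by
  refine degree_induction (p := fun n x => DU ω a x = 0 ∧ n = 0 ∨ ∃ m, n = m + 1 ∧
    DU ω a x ∈ ⋀[ℂ]^m h) (fun c => Or.inl ⟨DU_algebraMap ω a c, rfl⟩) ?_ ?_ n x hx
  · rintro n x y (⟨h1, rfl⟩ | ⟨m, rfl, h1⟩) (⟨h2, h2'⟩ | ⟨k, hk, h2⟩)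
    · exact Or.inl ⟨by rw [map_add, h1, h2, add_zero], rfl⟩
    · omega
    · omega
    · obtain rfl : m = k := by omega
      exact Or.inr ⟨m, rfl, by rw [map_add]; exact add_mem h1 h2⟩
  · rintro n b x hx (⟨h1, rfl⟩ | ⟨m, rfl, h1⟩)
    · refine Or.inr ⟨0, rfl, ?_⟩
      rw [DU_ι_mul, h1, mul_zero, sub_zero]
      exact Submodule.smul_mem _ _ hx
    · refine Or.inr ⟨m + 1, rfl, ?_⟩
      rw [DU_ι_mul]
      exact sub_mem (Submodule.smul_mem _ _ hx) (ι_mul_mem_degree b h1)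

theorem degree_eq_zero [FiniteDimensional ℂ h] {n : ℕ} (hn : finrank ℂ h < n) {x : U h}
    (hx : x ∈ ⋀[ℂ]^n h) : x = 0 := by
  have h1 : finrank ℂ (⋀[ℂ]^n h) = 0 := by
    rw [exteriorPower.finrank_eq, Nat.choose_eq_zero_of_lt hn]
  have : Subsingleton (⋀[ℂ]^n h) := finrank_zero_iff.1 h1
  exact congrArg Subtype.val (Subsingleton.elim (⟨x, hx⟩ : ⋀[ℂ]^n h) 0)

variable {ω} {ι : Type*} [Fintype ι] {α β : ι → h}

/-- The Euler operator `∑ᵢ βⁱ ((αⁱ, -) ⌋ x)` multiplies by the degree. -/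
theorem IsDualPair.euler (hd : IsDualPair ω α β) {n : ℕ} {x : U h} (hx : x ∈ ⋀[ℂ]^n h) :
    ∑ i, ExteriorAlgebra.ι ℂ (β i) * DU ω (α i) x = (n : ℂ) • x := by
  refine degree_induction (p := fun n x =>
    ∑ i, ExteriorAlgebra.ι ℂ (β i) * DU ω (α i) x = (n : ℂ) • x) (fun c => ?_)
    (fun n x y hx hy => ?_) (fun n a x _ hx => ?_) n x hx
  · simp [DU_algebraMap]
  · simp only [map_add, mul_add, Finset.sum_add_distrib, hx, hy, smul_add]
  · have h1 (i : ι) : ExteriorAlgebra.ι ℂ (β i) * DU ω (α i) (ExteriorAlgebra.ι ℂ a * x) =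
        ω (α i) a • LU h (β i) x +
          ExteriorAlgebra.ι ℂ a * (ExteriorAlgebra.ι ℂ (β i) * DU ω (α i) x) := by
      rw [DU_ι_mul, mul_sub, mul_smul_comm, LU_apply, ← mul_assoc, ← mul_assoc,
        eq_neg_of_add_eq_zero_left (ExteriorAlgebra.ι_add_mul_swap (R := ℂ) (β i) a), neg_mul,
        sub_neg_eq_add]
    simp only [h1, Finset.sum_add_distrib, ← Finset.mul_sum, hx]
    rw [hd.sum_left (LU h), LU_apply, mul_smul_comm]
    push_cast
    module

end Degree

/-! ### The Fourier transform of the exterior algebra -/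

section Fourier

variable {h : Type u} [AddCommGroup h] [Module ℂ h] {ω : LinearMap.BilinForm ℂ h}
  {ι : Type*} [Fintype ι] {α β : ι → h}

theorem LU_expOm {c : ℂ} (a : h) (t : U h ⊗[ℂ] U h) :
    inl (LU h) a (expOm α β c (inl (LU h)) (inr (LU h)) t) =
      expOm α β c (inl (LU h)) (inr (LU h)) (inl (LU h) a t) :=
  map_expOm_of_anti α β (inl (LU h) a) c (fun _ _ => Anti.apply_comm _ _ _)
    (fun _ _ => Anti.apply_comm _ _ _) t

theorem fromUU_copairing_mul (z : UU h) :
    fromUU (copairing α β * z) = Om α β (inl (LU h)) (inr (LU h)) (fromUU z) := by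
  have h1 (i : ι) : (GradedTensorProduct.tmul ℂ (ExteriorAlgebra.ι ℂ (β i) : U h)
      (ExteriorAlgebra.ι ℂ (α i) : U h) : UU h) =
      GradedTensorProduct.includeLeft (grading h) (grading h) (ExteriorAlgebra.ι ℂ (β i)) *
        GradedTensorProduct.includeRight (grading h) (grading h) (ExteriorAlgebra.ι ℂ (α i)) :=
    (GradedTensorProduct.tmul_one_mul_one_tmul (R := ℂ) (grading h) (grading h) _ _).symm
  rw [copairing, Finset.sum_mul, map_sum, Om_apply]
  refine Finset.sum_congr rfl fun i _ => ?_
  rw [h1, mul_assoc, fromUU_includeLeft_mul, fromUU_includeRight_mul]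

theorem fromUU_copairing_pow (k : ℕ) :
    fromUU (copairing α β ^ k) = (Om α β (inl (LU h)) (inr (LU h)) ^ k) (1 ⊗ₜ 1) := by
  induction k with
  | zero => rfl
  | succ k ih => rw [pow_succ', fromUU_copairing_mul, ih, pow_succ', Module.End.mul_apply]

/-- The kernel `exp(c Ω)` of the Fourier transform, as an exponential of operators applied to `1 ⊗ 1`. -/
theorem fromUU_nilExp_copairing (c : ℂ) :
    fromUU (nilExp (c • copairing α β)) =
      expOm α β c (inl (LU h)) (inr (LU h)) (1 ⊗ₜ[ℂ] 1 : U h ⊗[ℂ] U h) := by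
  have h1 : copairing α β ^ (Fintype.card ι + 2) = 0 := by
    refine (GradedTensorProduct.of ℂ (grading h) (grading h)).symm.injective ?_
    change fromUU (copairing α β ^ (Fintype.card ι + 2)) = fromUU 0
    rw [fromUU_copairing_pow, pow_succ, Om_pow, zero_mul, map_zero, LinearMap.zero_apply]
  rw [nilExp_eq_truncExp (n := Fintype.card ι + 2) (by rw [smul_pow, h1, smul_zero]), truncExp,
    expOm, truncExp, map_sum, LinearMap.sum_apply]
  refine Finset.sum_congr rfl fun k _ => ?_
  rw [smul_pow, smul_pow, map_smul, map_smul, fromUU_copairing_pow]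
  rfl

variable (lam : U h →ₗ[ℂ] ℂ)

/-- The map `x ⊗ y ↦ lam(y u) x`, the kernel integral that defines `φ(u)`. -/
def integrate (u : U h) : U h ⊗[ℂ] U h →ₗ[ℂ] U h :=
  (TensorProduct.rid ℂ (U h)).toLinearMap ∘ₗ
    TensorProduct.map LinearMap.id (lam ∘ₗ LinearMap.mulRight ℂ u)

theorem integrate_tmul (u x y : U h) : integrate lam u (x ⊗ₜ y) = lam (y * u) • x := rfl

theorem phi_eq_integrate (u : U h) : phi α β lam u = integrate lam u
    (expOm α β (-((Real.pi : ℂ) * Complex.I)) (inl (LU h)) (inr (LU h)) (1 ⊗ₜ[ℂ] 1)) := by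
  rw [phi, LinearMap.comp_apply, LinearMap.comp_apply, LinearMap.comp_apply,
    TensorProduct.mk_apply, fromUU_nilExp_copairing]
  generalize expOm α β (-((Real.pi : ℂ) * Complex.I)) (inl (LU h)) (inr (LU h))
    (1 ⊗ₜ[ℂ] 1 : U h ⊗[ℂ] U h) = t
  induction t with
  | zero => simp
  | add x y hx hy => rw [TensorProduct.add_tmul, map_add, map_add, map_add, map_add, hx, hy]
  | tmul x y => rfl

theorem integrate_inl (u : U h) {P : h →ₗ[ℂ] Module.End ℂ (U h)} (a : h) (t : U h ⊗[ℂ] U h) :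
    integrate lam u (inl P a t) = P a (integrate lam u t) := by
  induction t with
  | zero => simp
  | add x y hx hy => simp only [map_add, hx, hy]
  | tmul x y => rw [inl_tmul, integrate_tmul, integrate_tmul, map_smul]

variable (ω) in
theorem DU_mul (a : h) (x y : U h) : DU ω a (x * y) = DU ω a x * y + par x * DU ω a y := by
  induction x using CliffordAlgebra.left_induction with
  | algebraMap r =>
    change DU ω a (algebraMap ℂ (U h) r * y) =
      DU ω a (algebraMap ℂ (U h) r) * y + par (algebraMap ℂ (U h) r) * DU ω a y
    rw [DU_algebraMap, par_algebraMap, zero_mul, zero_add, ← Algebra.smul_def, ← Algebra.smul_def,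
      map_smul]
  | add x z hx hz => simp only [map_add, add_mul, hx, hz]; abel
  | ι_mul x m hx =>
    change DU ω a (ExteriorAlgebra.ι ℂ m * x * y) =
      DU ω a (ExteriorAlgebra.ι ℂ m * x) * y + par (ExteriorAlgebra.ι ℂ m * x) * DU ω a y
    rw [mul_assoc, DU_ι_mul, hx, DU_ι_mul, par_ι_mul, sub_mul, mul_add, smul_mul_assoc, mul_assoc,
      neg_mul, mul_assoc]
    abel

/-- `D(a) φ(u) = -iπ φ(a u)`. -/
theorem IsDualPair.DU_phi (hd : IsDualPair ω α β) (a : h) (u : U h) :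
    DU ω a (phi α β lam u) =
      (-((Real.pi : ℂ) * Complex.I)) • phi α β lam (ExteriorAlgebra.ι ℂ a * u) := by
  have hR : TensorProduct.map LinearMap.id (LinearMap.mulRight ℂ (ExteriorAlgebra.ι ℂ a))
      (1 ⊗ₜ[ℂ] 1 : U h ⊗[ℂ] U h) = inr (LU h) a (1 ⊗ₜ[ℂ] 1 : U h ⊗[ℂ] U h) := by
    simp [par_one]
  have hi (t : U h ⊗[ℂ] U h) : integrate lam u
      (TensorProduct.map LinearMap.id (LinearMap.mulRight ℂ (ExteriorAlgebra.ι ℂ a)) t) =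
      integrate lam (ExteriorAlgebra.ι ℂ a * u) t := by
    induction t with
    | zero => simp
    | add x y hx hy => simp only [map_add, hx, hy]
    | tmul x y => simp [integrate_tmul, mul_assoc]
  rw [phi_eq_integrate, phi_eq_integrate, ← integrate_inl, hd.expOm_symm,
    hd.contract_expOm _ (inr (LU h)) (inl (DU ω)) (inl (LU h)), inl_tmul, DU_one,
    TensorProduct.zero_tmul, zero_add, map_smul, map_smul, ← hR, ← hi]
  congr 2
  symm
  refine map_expOm α β _ _ (fun b t => ?_) (fun b t => ?_) _
  · exact map_id_inr (fun b x => mul_assoc (ExteriorAlgebra.ι ℂ b) x (ExteriorAlgebra.ι ℂ a)) b t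
  · exact map_id_inl _ _ b t

theorem IsDualPair.phi_ι_mul (hd : IsDualPair ω α β) (a : h) (u : U h) :
    phi α β lam (ExteriorAlgebra.ι ℂ a * u) =
      (-((Real.pi : ℂ) * Complex.I))⁻¹ • DU ω a (phi α β lam u) := by
  have hπ : (Real.pi : ℂ) * Complex.I ≠ 0 :=
    mul_ne_zero (by exact_mod_cast Real.pi_ne_zero) Complex.I_ne_zero
  rw [hd.DU_phi, smul_smul, inv_mul_cancel₀ (neg_ne_zero.2 hπ), one_smul]

theorem par_expOm_one (c : ℂ) :
    par (expOm α β c (inl (LU h)) (inr (LU h)) (1 ⊗ₜ[ℂ] 1 : U h ⊗[ℂ] U h)) =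
      expOm α β c (inl (LU h)) (inr (LU h)) (1 ⊗ₜ[ℂ] 1) := by
  rw [map_expOm_of_anti α β par c (P' := inl (LU h)) (Q' := inr (LU h))]
  · rw [par_tmul, par_one]
  · intro a v
    rw [OddOp.apply_par, neg_neg]
  · intro a v
    rw [OddOp.apply_par, neg_neg]

/-- `φ(D(a) u) = iπ a φ(u)`, by integration by parts. -/
theorem IsDualPair.phi_DU (hd : IsDualPair ω α β) (hlam : ∀ a x, lam (DU ω a x) = 0) (a : h)
    (u : U h) : phi α β lam (DU ω a u) =
      ((Real.pi : ℂ) * Complex.I) • (ExteriorAlgebra.ι ℂ a * phi α β lam u) := by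
  have hi (t : U h ⊗[ℂ] U h) :
      integrate lam u (inr (DU ω) a t) = -integrate lam (DU ω a u) (par t) := by
    induction t with
    | zero => simp
    | add x y hx hy => simp only [map_add, hx, hy, neg_add]
    | tmul x y =>
      have := hlam a (y * u)
      rw [DU_mul, map_add] at this
      rw [inr_tmul, integrate_tmul, par_tmul, integrate_tmul, eq_neg_of_add_eq_zero_left this,
        neg_smul]
  have h1 := hd.contract_expOm (-((Real.pi : ℂ) * Complex.I)) (inl (LU h)) (inr (DU ω))
    (inr (LU h)) a (1 ⊗ₜ[ℂ] 1 : U h ⊗[ℂ] U h)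
  rw [inr_tmul, DU_one, TensorProduct.tmul_zero, zero_add, map_smul, ← LU_expOm] at h1
  have h2 := congrArg (integrate lam u) h1
  rw [hi, par_expOm_one, map_smul, integrate_inl, ← phi_eq_integrate, ← phi_eq_integrate,
    neg_smul, neg_inj] at h2
  exact h2

theorem phi_par (hlam : ∀ x, lam (par x) = lam x) (u : U h) :
    phi α β lam (par u) = par (phi α β lam u) := by
  have hi (t : U h ⊗[ℂ] U h) :
      par (integrate lam u t) = integrate lam (par u) (par t) := by
    induction t with
    | zero => simp
    | add x y hx hy => simp only [map_add, hx, hy]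
    | tmul x y =>
      rw [integrate_tmul, par_tmul, integrate_tmul, map_smul, ← hlam (y * u)]
      congr 2
      exact map_mul CliffordAlgebra.involute _ _
  rw [phi_eq_integrate, phi_eq_integrate, hi, par_expOm_one]

theorem counit_ι_mul (a : h) (x : U h) :
    ExteriorAlgebra.algebraMapInv (ExteriorAlgebra.ι ℂ a * x : U h) = (0 : ℂ) := by
  rw [map_mul, ExteriorAlgebra.algebraMapInv, ExteriorAlgebra.lift_ι_apply]
  simp

theorem counit_phi (u : U h) : ExteriorAlgebra.algebraMapInv (phi α β lam u) = lam u := by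
  rw [phi_eq_integrate]
  have := truncExp_apply_comm (F := (ExteriorAlgebra.algebraMapInv (R := ℂ) (M := h)).toLinearMap ∘ₗ
    integrate lam u) (X := (-((Real.pi : ℂ) * Complex.I)) • Om α β (inl (LU h)) (inr (LU h)))
    (Y := 0) (fun v => ?_) (Fintype.card ι + 2) (1 ⊗ₜ 1)
  · rw [truncExp_zero] at this
    refine Eq.trans this ?_
    rw [Module.End.one_apply, LinearMap.comp_apply, integrate_tmul, one_mul]
    simp
  · rw [LinearMap.smul_apply, Om_apply, map_smul, map_sum,
      Finset.sum_eq_zero fun i _ => ?_, smul_zero, LinearMap.zero_apply]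
    rw [LinearMap.comp_apply, integrate_inl]
    exact counit_ι_mul _ _

end Fourier

/-! ### The square of the Fourier transform -/

section Gauss

variable {h : Type u} [AddCommGroup h] [Module ℂ h] {ω : LinearMap.BilinForm ℂ h}
  {ι : Type*} [Fintype ι] {α β : ι → h}

theorem par_mul_ι (a : h) (x : U h) :
    par x * ExteriorAlgebra.ι ℂ a = ExteriorAlgebra.ι ℂ a * x := by
  induction x using CliffordAlgebra.left_induction with
  | algebraMap r =>
    change par (algebraMap ℂ (U h) r) * ExteriorAlgebra.ι ℂ a =
      ExteriorAlgebra.ι ℂ a * algebraMap ℂ (U h) r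
    rw [par_algebraMap, Algebra.commutes]
  | add x y hx hy => rw [map_add, add_mul, mul_add, hx, hy]
  | ι_mul x m hx =>
    change par (ExteriorAlgebra.ι ℂ m * x) * ExteriorAlgebra.ι ℂ a =
      ExteriorAlgebra.ι ℂ a * (ExteriorAlgebra.ι ℂ m * x)
    rw [par_ι_mul, neg_mul, mul_assoc, hx, ← mul_assoc, ← mul_assoc, ← neg_mul,
      eq_neg_of_add_eq_zero_left (ExteriorAlgebra.ι_add_mul_swap (R := ℂ) a m)]

/-- The antipode identity `∑ x' S(x'') = ε(x)`, with the coproduct written as an exponential. -/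
theorem IsDualPair.mul_expOm (hd : IsDualPair ω α β) (u : U h) :
    LinearMap.mul' ℂ (U h) (expOm α β (-1) (inl (LU h)) (inr (DU ω)) (1 ⊗ₜ u)) =
      algebraMap ℂ (U h) (ExteriorAlgebra.algebraMapInv u) := by
  refine U_hom_ext (F := LinearMap.mul' ℂ (U h) ∘ₗ expOm α β (-1) (inl (LU h)) (inr (DU ω)) ∘ₗ
    TensorProduct.mk ℂ (U h) (U h) 1) (G := (Algebra.linearMap ℂ (U h)) ∘ₗ
    (ExteriorAlgebra.algebraMapInv (R := ℂ) (M := h)).toLinearMap) 0 ?_ ?_ ?_ u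
  · rw [LinearMap.comp_apply, LinearMap.comp_apply, TensorProduct.mk_apply,
      expOm_apply_of_eq_zero]
    · simp
    · intro a
      rw [inr_tmul, DU_one, TensorProduct.tmul_zero]
  · intro a x
    have h1 : (1 : U h) ⊗ₜ[ℂ] (ExteriorAlgebra.ι ℂ a * x) = inr (LU h) a ((1 : U h) ⊗ₜ[ℂ] x) := by
      rw [inr_tmul, par_one, LU_apply]
    have h2 (t : U h ⊗[ℂ] U h) : LinearMap.mul' ℂ (U h) (inr (LU h) a t) =
        LinearMap.mul' ℂ (U h) (inl (LU h) a t) := by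
      induction t with
      | zero => simp
      | add x y hx hy => simp only [map_add, hx, hy]
      | tmul x y =>
        rw [inr_tmul, inl_tmul, LinearMap.mul'_apply, LinearMap.mul'_apply, LU_apply, LU_apply,
          ← mul_assoc, par_mul_ι]
    rw [LinearMap.comp_apply, LinearMap.comp_apply, TensorProduct.mk_apply, h1,
      hd.expOm_apply_left (-1) _ _ (inr (LU h)), map_add, h2, map_smul]
    simp
  · intro a x
    rw [LinearMap.comp_apply, AlgHom.toLinearMap_apply, counit_ι_mul, map_zero]
    simp

/-- An element killed by all contractions is a scalar. -/
theorem IsDualPair.eq_algebraMap_of_DU (hd : IsDualPair ω α β) {x : U h}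
    (hx : ∀ a, DU ω a x = 0) : x = algebraMap ℂ (U h) (ExteriorAlgebra.algebraMapInv x) := by
  rw [← hd.mul_expOm, expOm_apply_of_eq_zero]
  · simp
  · intro a
    rw [inr_tmul, hx, TensorProduct.tmul_zero]

theorem Om_LU_apply (x : U h) : Om α β (LU h) (LU h) x = copairing11 α β * x := by
  rw [Om_apply, copairing11, Finset.sum_mul]
  simp [mul_assoc]

theorem Om_LU_pow (k : ℕ) (x : U h) :
    (Om α β (LU h) (LU h) ^ k) x = copairing11 α β ^ k * x := by
  induction k with
  | zero => simp
  | succ k ih => rw [pow_succ', Module.End.mul_apply, ih, Om_LU_apply, pow_succ', mul_assoc]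

theorem copairing11_pow_mem (k : ℕ) : copairing11 α β ^ k ∈ ⋀[ℂ]^(2 * k) h := by
  induction k with
  | zero =>
    rw [pow_zero, mul_zero, ExteriorAlgebra.exteriorPower, pow_zero]
    exact Submodule.mem_one.2 ⟨1, map_one _⟩
  | succ k ih =>
    rw [pow_succ', copairing11, Finset.sum_mul]
    refine Submodule.sum_mem _ fun i _ => ?_
    rw [mul_assoc]
    exact ι_mul_mem_degree _ (ι_mul_mem_degree _ ih)

theorem IsDualPair.DU_Om (hd : IsDualPair ω α β) (a : h) (x : U h) :
    DU ω a (Om α β (LU h) (LU h) x) =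
      Om α β (LU h) (LU h) (DU ω a x) + (2 : ℂ) • LU h a x := by
  have h1 (i : ι) : DU ω a (LU h (β i) (LU h (α i) x)) =
      ω a (β i) • LU h (α i) x + ω (α i) a • LU h (β i) x +
        LU h (β i) (LU h (α i) (DU ω a x)) := by
    rw [Heis.apply_comm (ω := ω) (D := DU ω) (L := LU h),
      Heis.apply_comm (ω := ω) (D := DU ω) (L := LU h), hd.skew (α i) a, map_sub, map_smul]
    module
  rw [Om_apply, map_sum]
  simp only [h1, Finset.sum_add_distrib]
  rw [hd.sum_right (LU h), hd.sum_left (LU h), Om_apply]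
  module

theorem LU_Om (a : h) (x : U h) :
    LU h a (Om α β (LU h) (LU h) x) = Om α β (LU h) (LU h) (LU h a x) := by
  rw [Om_apply, Om_apply, map_sum]
  refine Finset.sum_congr rfl fun i _ => ?_
  rw [Anti.apply_comm (P := LU h), Anti.apply_comm (P := LU h) (Q := LU h) a, map_neg, neg_neg]

theorem IsDualPair.DU_expOm_LU (hd : IsDualPair ω α β) (t : ℂ) (a : h) (x : U h) :
    DU ω a (expOm α β t (LU h) (LU h) x) =
      expOm α β t (LU h) (LU h) (DU ω a x + (2 * t) • LU h a x) := by
  refine apply_expOm α β t (LU h) (LU h) (X := DU ω a) (Z := (2 * t) • LU h a) (fun x => ?_)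
    (fun x => ?_) x
  · rw [map_smul, hd.DU_Om, LinearMap.smul_apply]
    module
  · rw [LinearMap.smul_apply, LinearMap.smul_apply, LU_Om, map_smul]

theorem IsDualPair.DU_copairing11_pow (hd : IsDualPair ω α β) (a : h) (k : ℕ) :
    DU ω a (copairing11 α β ^ (k + 1)) =
      (2 * (k + 1) : ℂ) • (ExteriorAlgebra.ι ℂ a * copairing11 α β ^ k) := by
  induction k with
  | zero =>
    rw [zero_add, pow_one, ← mul_one (copairing11 α β), ← Om_LU_apply, hd.DU_Om, DU_one]
    simp
  | succ k ih =>
    rw [pow_succ', ← Om_LU_apply, hd.DU_Om, ih, map_smul, ← LU_apply, ← LU_Om, Om_LU_apply,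
      ← pow_succ', LU_apply]
    push_cast
    module

theorem counit_expOm (t : ℂ) (x : U h) :
    ExteriorAlgebra.algebraMapInv (expOm α β t (LU h) (LU h) x) =
      ExteriorAlgebra.algebraMapInv x := by
  have := truncExp_apply_comm (F := (ExteriorAlgebra.algebraMapInv (R := ℂ) (M := h)).toLinearMap)
    (X := t • Om α β (LU h) (LU h)) (Y := 0) (fun v => ?_) (Fintype.card ι + 2) x
  · rw [truncExp_zero] at this
    exact this
  · rw [LinearMap.smul_apply, Om_apply, map_smul, map_sum,
      Finset.sum_eq_zero fun i _ => ?_, smul_zero, LinearMap.zero_apply]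
    exact counit_ι_mul _ _

variable {lam : U h →ₗ[ℂ] ℂ}

/-- The Gaussian `exp(π/2 Ω⁽¹¹⁾)` is an eigenvector of the Fourier transform. -/
theorem IsDualPair.phi_gauss (hd : IsDualPair ω α β) (hlam : ∀ a x, lam (DU ω a x) = 0) :
    phi α β lam (expOm α β (Real.pi / 2) (LU h) (LU h) 1) =
      lam (expOm α β (Real.pi / 2) (LU h) (LU h) 1) • expOm α β (Real.pi / 2) (LU h) (LU h) 1 := by
  have hπ : (Real.pi : ℂ) ≠ 0 := by exact_mod_cast Real.pi_ne_zero
  set g : U h := expOm α β (Real.pi / 2) (LU h) (LU h) 1 with hg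
  have hLE (t : ℂ) (a : h) (x : U h) : LU h a (expOm α β t (LU h) (LU h) x) =
      expOm α β t (LU h) (LU h) (LU h a x) :=
    map_expOm_of_anti α β (LU h a) t (fun _ _ => Anti.apply_comm _ _ _)
      (fun _ _ => Anti.apply_comm _ _ _) x
  have h1 (a : h) : DU ω a g = (Real.pi : ℂ) • LU h a g := by
    rw [hg, hd.DU_expOm_LU, DU_one, zero_add, map_smul, hLE]
    congr 1
    ring
  have h2 (a : h) : DU ω a (phi α β lam g) = (Real.pi : ℂ) • LU h a (phi α β lam g) := by
    have : ExteriorAlgebra.ι ℂ a * g = (Real.pi : ℂ)⁻¹ • DU ω a g := by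
      rw [h1, LU_apply, smul_smul, inv_mul_cancel₀ hπ, one_smul]
    rw [hd.DU_phi, this, map_smul, hd.phi_DU lam hlam, LU_apply, smul_smul, smul_smul]
    congr 1
    field_simp
    rw [Complex.I_sq]
    ring
  set z : U h := expOm α β (-(Real.pi / 2)) (LU h) (LU h) (phi α β lam g) with hz
  -- `φ(g)` solves the differential equation of the Gaussian, so `exp(-π/2 Ω⁽¹¹⁾) φ(g)` is constant.
  have h3 (a : h) : DU ω a z = 0 := by
    rw [hz, hd.DU_expOm_LU, h2, ← add_smul,
      show (Real.pi : ℂ) + 2 * -(Real.pi / 2) = 0 by ring, zero_smul, map_zero]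
  have h4 : phi α β lam g = expOm α β (Real.pi / 2) (LU h) (LU h) z :=
    (expOm_cancel α β _ _ (by ring) _ _ _).symm
  rw [hd.eq_algebraMap_of_DU h3, Algebra.algebraMap_eq_smul_one, map_smul, ← hg] at h4
  have h5 : ExteriorAlgebra.algebraMapInv g = (1 : ℂ) := by rw [hg, counit_expOm, map_one]
  have h6 := congrArg ExteriorAlgebra.algebraMapInv h4
  rw [counit_phi, map_smul, h5, smul_eq_mul, mul_one] at h6
  rw [h6, ← h4]

/-- The square of the Fourier transform is the antipode, if the Gaussian has integral `±1`. -/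
theorem IsDualPair.phi_phi (hd : IsDualPair ω α β) (hlam : ∀ a x, lam (DU ω a x) = 0)
    (hg : lam (expOm α β (Real.pi / 2) (LU h) (LU h) 1) ^ 2 = 1) (u : U h) :
    phi α β lam (phi α β lam u) = par u := by
  have hπ : (Real.pi : ℂ) * Complex.I ≠ 0 :=
    mul_ne_zero (by exact_mod_cast Real.pi_ne_zero) Complex.I_ne_zero
  have h2 (a : h) (u : U h) : phi α β lam (phi α β lam (ExteriorAlgebra.ι ℂ a * u)) =
      -(ExteriorAlgebra.ι ℂ a * phi α β lam (phi α β lam u)) := by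
    rw [hd.phi_ι_mul, map_smul, hd.phi_DU lam hlam, smul_smul, inv_neg, neg_mul, inv_mul_cancel₀ hπ,
      neg_one_smul]
  have h3 (a : h) : DU ω a (phi α β lam (phi α β lam 1)) = 0 := by
    have h4 : ExteriorAlgebra.ι ℂ a * phi α β lam 1 = 0 := by
      have := hd.phi_DU lam hlam a 1
      rw [DU_one, map_zero] at this
      exact (smul_eq_zero.1 this.symm).resolve_left hπ
    rw [hd.DU_phi, h4, map_zero, smul_zero]
  obtain ⟨s, hs⟩ : ∃ s, phi α β lam (phi α β lam 1) = algebraMap ℂ (U h) s :=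
    ⟨_, hd.eq_algebraMap_of_DU h3⟩
  have h5 (u : U h) : phi α β lam (phi α β lam u) = s • par u := by
    refine U_hom_ext (F := phi α β lam ∘ₗ phi α β lam) (G := s • par) ((-1 : ℂ) • LU h) ?_ ?_ ?_ u
    · rw [LinearMap.comp_apply, hs, LinearMap.smul_apply, par_one, Algebra.algebraMap_eq_smul_one]
    · intro a x
      rw [LinearMap.comp_apply, h2, LinearMap.smul_apply, LinearMap.smul_apply, neg_one_smul]
      rfl
    · intro a x
      rw [LinearMap.smul_apply, par_ι_mul, LinearMap.smul_apply, LinearMap.smul_apply,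
        neg_one_smul, LU_apply, LinearMap.smul_apply, mul_smul_comm, smul_neg]
  -- The constant `s` is found on the Gaussian, an even eigenvector of `φ`.
  have h6 := h5 (expOm α β (Real.pi / 2) (LU h) (LU h) 1)
  have h7 : par (expOm α β (Real.pi / 2) (LU h) (LU h) (1 : U h)) =
      expOm α β (Real.pi / 2) (LU h) (LU h) 1 := by
    rw [map_expOm_of_anti α β par _ (P' := LU h) (Q' := LU h) (fun a v => ?_) (fun a v => ?_),
      par_one] <;> rw [OddOp.apply_par, neg_neg]
  rw [hd.phi_gauss hlam, map_smul, hd.phi_gauss hlam, h7, smul_smul, ← sq, hg, one_smul] at h6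
  have h8 := congrArg ExteriorAlgebra.algebraMapInv h6
  rw [map_smul, counit_expOm, map_one, smul_eq_mul, mul_one] at h8
  rw [h5, ← h8, one_smul]

end Gauss

/-! ### The normalised top form -/

section TopForm

variable {h : Type u} [AddCommGroup h] [Module ℂ h] {ω : LinearMap.BilinForm ℂ h} {ι : Type*}
  [Fintype ι] {α β : Module.Basis ι ℂ h}

/-- The dimension of a vector space with a non-degenerate skew-symmetric form is even. -/
theorem even_finrank [DecidableEq ι] (hskew : ∀ a b, ω a b = -ω b a) (hω : ω.Nondegenerate)
    (α : Module.Basis ι ℂ h) : Even (finrank ℂ h) := by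
  have h1 : (LinearMap.BilinForm.toMatrix α ω).det ≠ 0 :=
    (LinearMap.BilinForm.nondegenerate_iff_det_ne_zero α).1 hω
  have h2 : (LinearMap.BilinForm.toMatrix α ω).transpose = -LinearMap.BilinForm.toMatrix α ω := by
    ext i j
    simp only [Matrix.transpose_apply, Matrix.neg_apply, LinearMap.BilinForm.toMatrix_apply]
    exact hskew _ _
  have h3 := congrArg Matrix.det h2
  rw [Matrix.det_transpose, Matrix.det_neg, ← finrank_eq_card_basis α] at h3
  by_contra hodd
  rw [Nat.not_even_iff_odd] at hodd
  rw [hodd.neg_one_pow, neg_one_mul, self_eq_neg] at h3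
  exact h1 h3

/-- If `Ω⁽¹¹⁾^(k+1) = 0` then all `a ∈ h` annihilate `Ω⁽¹¹⁾^k`, which then has top degree by the Euler
operator. -/
theorem IsDualPair.copairing11_pow_ne_zero [DecidableEq ι] (hd : IsDualPair ω α β)
    (hαβ : ∀ i j, ω (α i) (β j) = if i = j then 1 else 0) {k : ℕ} (hk : 2 * k ≤ finrank ℂ h) :
    copairing11 α β ^ k ≠ 0 := by
  induction k with
  | zero => simp
  | succ k ih =>
    intro h0
    refine ih (by omega) ?_
    have h1 (a : h) : ExteriorAlgebra.ι ℂ a * copairing11 α β ^ k = 0 := by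
      have := hd.DU_copairing11_pow a k
      rw [h0, map_zero] at this
      refine (smul_eq_zero.1 this.symm).resolve_left (mul_ne_zero two_ne_zero ?_)
      exact_mod_cast Nat.succ_ne_zero k
    have h2 := hd.euler (copairing11_pow_mem (α := α) (β := β) k)
    have h3 (i : ι) : ExteriorAlgebra.ι ℂ (β i) * DU ω (α i) (copairing11 α β ^ k) =
        copairing11 α β ^ k := by
      have := DU_ι_mul ω (α i) (β i) (copairing11 α β ^ k)
      rw [h1, map_zero, hαβ, if_pos rfl, one_smul] at this
      exact (sub_eq_zero.1 this.symm).symm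
    simp only [h3, Finset.sum_const, Finset.card_univ] at h2
    rw [← Nat.cast_smul_eq_nsmul ℂ, ← finrank_eq_card_basis α, ← sub_eq_zero, ← sub_smul] at h2
    refine (smul_eq_zero.1 h2).resolve_left (sub_ne_zero.2 ?_)
    exact_mod_cast (by omega : finrank ℂ h ≠ 2 * k)

theorem IsDualPair.existsUnique_topForm [FiniteDimensional ℂ h] [DecidableEq ι]
    (hd : IsDualPair ω α β)
    (hαβ : ∀ i j, ω (α i) (β j) = if i = j then 1 else 0) (he : Even (finrank ℂ h)) :
    ∃! lam : U h →ₗ[ℂ] ℂ, IsTopForm α β lam := by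
  have hN : 2 * numPairs h = finrank ℂ h := Nat.two_mul_div_two_of_even he
  set ξ : U h := ((Complex.I * (Real.pi : ℂ)) • copairing11 α β) ^ numPairs h with hξ
  have hc : (Complex.I * (Real.pi : ℂ)) ≠ 0 :=
    mul_ne_zero Complex.I_ne_zero (by exact_mod_cast Real.pi_ne_zero)
  have hξ0 : ξ ≠ 0 := by
    rw [hξ, smul_pow]
    exact smul_ne_zero (pow_ne_zero _ hc) (hd.copairing11_pow_ne_zero hαβ hN.le)
  have hξd : ξ ∈ ⋀[ℂ]^(finrank ℂ h) h := by
    rw [hξ, smul_pow, ← hN]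
    exact Submodule.smul_mem _ _ (copairing11_pow_mem _)
  obtain ⟨f, hf⟩ : ∃ f : Module.Dual ℂ (U h), f ξ ≠ 0 := by
    by_contra! hcon
    exact hξ0 ((Module.forall_dual_apply_eq_zero_iff ℂ ξ).1 hcon)
  set v : ℂ := (-1) ^ numPairs h * ((numPairs h)! : ℂ) * (2 * Complex.I) ^ numPairs h with hv
  have huniq (l l' : U h →ₗ[ℂ] ℂ) (hl : IsTopForm α β l) (hl' : IsTopForm α β l') : l = l' := by
    refine LinearMap.ext fun x => U_hom_ext_degree (F := l) (G := l') (fun n x hx => ?_) x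
    by_cases hn : n = finrank ℂ h
    · subst hn
      have h1 : finrank ℂ (⋀[ℂ]^(finrank ℂ h) h) = 1 := by
        rw [exteriorPower.finrank_eq, Nat.choose_self]
      obtain ⟨c, hc⟩ := (finrank_eq_one_iff_of_nonzero' (⟨ξ, hξd⟩ : ⋀[ℂ]^(finrank ℂ h) h)
        fun h0 => hξ0 (congrArg Subtype.val h0)).1 h1 ⟨x, hx⟩
      have hc' : c • ξ = x := congrArg Subtype.val hc
      rw [← hc', map_smul, map_smul, hξ, hl.2, hl'.2]
    · rw [hl.1 n hn x hx, hl'.1 n hn x hx]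
  have hex : IsTopForm α β
      ((v / f ξ) • (f ∘ₗ GradedAlgebra.proj (fun i : ℕ => ⋀[ℂ]^i h) (finrank ℂ h))) := by
    refine ⟨fun n hn x hx => ?_, ?_⟩
    · rw [LinearMap.smul_apply, LinearMap.comp_apply, GradedAlgebra.proj_apply,
        DirectSum.decompose_of_mem_ne (fun i : ℕ => ⋀[ℂ]^i h) hx hn, map_zero, smul_zero]
    · rw [LinearMap.smul_apply, LinearMap.comp_apply, GradedAlgebra.proj_apply, ← hξ,
        DirectSum.decompose_of_mem_same (fun i : ℕ => ⋀[ℂ]^i h) hξd, smul_eq_mul,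
        div_mul_cancel₀ _ hf]
  exact ⟨_, hex, fun l hl => huniq _ _ hl hex⟩

/-- Top forms annihilate derivatives. -/
theorem IsTopForm.apply_DU [FiniteDimensional ℂ h] {lam : U h →ₗ[ℂ] ℂ}
    (hlam : IsTopForm α β lam) (a : h) (x : U h) : lam (DU ω a x) = 0 := by
  refine U_hom_ext_degree (F := lam ∘ₗ DU ω a) (G := 0) (fun n x hx => ?_) x
  rw [LinearMap.comp_apply, LinearMap.zero_apply]
  rcases DU_degree ω a hx with ⟨h0, -⟩ | ⟨m, rfl, hm⟩
  · rw [h0, map_zero]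
  · by_cases hmd : m = finrank ℂ h
    · rw [degree_eq_zero (by omega) hx, map_zero, map_zero]
    · exact hlam.1 m hmd _ hm

theorem IsTopForm.apply_par {lam : U h →ₗ[ℂ] ℂ} (hlam : IsTopForm α β lam)
    (he : Even (finrank ℂ h)) (x : U h) : lam (par x) = lam x := by
  refine U_hom_ext_degree (F := lam ∘ₗ par) (G := lam) (fun n x hx => ?_) x
  rw [LinearMap.comp_apply, par_of_degree hx, map_smul]
  by_cases hn : n = finrank ℂ h
  · rw [hn, he.neg_one_pow, one_smul]
  · rw [hlam.1 n hn x hx, smul_zero]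

/-- The integral of the Gaussian `exp(π/2 Ω⁽¹¹⁾)` is `(-1)^N`; the normalisation of the top form is
there for this. -/
theorem IsTopForm.apply_gauss {lam : U h →ₗ[ℂ] ℂ} (hlam : IsTopForm α β lam)
    (he : Even (finrank ℂ h)) :
    lam (expOm α β (Real.pi / 2) (LU h) (LU h) 1) ^ 2 = 1 := by
  have hN : 2 * numPairs h = finrank ℂ h := Nat.two_mul_div_two_of_even he
  have hπ : (Real.pi : ℂ) ≠ 0 := by exact_mod_cast Real.pi_ne_zero
  have hc : (Complex.I * (Real.pi : ℂ)) ≠ 0 := mul_ne_zero Complex.I_ne_zero hπ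
  have h1 : lam (expOm α β (Real.pi / 2) (LU h) (LU h) 1) = (((numPairs h)! : ℂ)⁻¹) *
      ((Real.pi / 2) ^ numPairs h * lam (copairing11 α β ^ numPairs h)) := by
    rw [expOm, truncExp, LinearMap.sum_apply, map_sum,
      Finset.sum_eq_single_of_mem (numPairs h)]
    · rw [smul_pow, LinearMap.smul_apply, LinearMap.smul_apply, Om_LU_pow, mul_one, map_smul,
        map_smul]
      rfl
    · rw [Finset.mem_range, ← finrank_eq_card_basis α]
      omega
    · intro k _ hk
      rw [smul_pow, LinearMap.smul_apply, LinearMap.smul_apply, Om_LU_pow, mul_one, map_smul,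
        map_smul, hlam.1 (2 * k) (by omega) _ (copairing11_pow_mem k)]
      simp
  have h2 := hlam.2
  rw [smul_pow, map_smul, smul_eq_mul] at h2
  have h3 : lam (copairing11 α β ^ numPairs h) = (-1) ^ numPairs h * ((numPairs h)! : ℂ) *
      (2 * Complex.I) ^ numPairs h / (Complex.I * (Real.pi : ℂ)) ^ numPairs h := by
    rw [← h2, mul_div_cancel_left₀ _ (pow_ne_zero _ hc)]
  have h4 : ((numPairs h)! : ℂ) ≠ 0 := by exact_mod_cast (numPairs h).factorial_ne_zero
  rw [h1, h3]
  have h5 : (((numPairs h)! : ℂ)⁻¹) * ((Real.pi / 2) ^ numPairs h * ((-1) ^ numPairs h *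
      ((numPairs h)! : ℂ) * (2 * Complex.I) ^ numPairs h /
        (Complex.I * (Real.pi : ℂ)) ^ numPairs h)) = (-1) ^ numPairs h := by
    calc _ = (((numPairs h)! : ℂ)⁻¹ * (numPairs h)!) * ((-1) ^ numPairs h *
          (Real.pi / 2 * (2 * Complex.I) / (Complex.I * Real.pi)) ^ numPairs h) := by
          rw [div_pow ((Real.pi : ℂ) / 2 * (2 * Complex.I)), mul_pow ((Real.pi : ℂ) / 2)]; ring
      _ = _ := by
          rw [inv_mul_cancel₀ h4, one_mul,
            show (Real.pi : ℂ) / 2 * (2 * Complex.I) / (Complex.I * Real.pi) = 1 by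
              field_simp, one_pow, mul_one]
  rw [h5, ← pow_mul, mul_comm, pow_mul, neg_one_sq, one_pow]

end TopForm

/-! ### The associators in terms of exponentials -/

section MapComp

variable {V W N X : Type*} [AddCommMonoid V] [Module ℂ V] [AddCommMonoid W] [Module ℂ W]
  [AddCommMonoid N] [Module ℂ N] [AddCommMonoid X] [Module ℂ X]

theorem map_id_comp (F : W →ₗ[ℂ] N) (G : V →ₗ[ℂ] W) :
    TensorProduct.map (LinearMap.id : X →ₗ[ℂ] X) (F ∘ₗ G) =
      TensorProduct.map LinearMap.id F ∘ₗ TensorProduct.map LinearMap.id G :=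
  LinearMap.lTensor_comp X F G

theorem map_comp_id (F : W →ₗ[ℂ] N) (G : V →ₗ[ℂ] W) :
    TensorProduct.map (F ∘ₗ G) (LinearMap.id : X →ₗ[ℂ] X) =
      TensorProduct.map F LinearMap.id ∘ₗ TensorProduct.map G LinearMap.id :=
  LinearMap.rTensor_comp X F G

theorem map_id_congr {F G : V →ₗ[ℂ] W} (H : ∀ v, F v = G v) (t : X ⊗[ℂ] V) :
    TensorProduct.map LinearMap.id F t = TensorProduct.map LinearMap.id G t := by
  rw [LinearMap.ext H]

end MapComp

section Associators

variable {h : Type u} [AddCommGroup h] [Module ℂ h]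
variable {A B C D V W N X Y : Type u} [AddCommGroup A] [Module ℂ A] [AddCommGroup B] [Module ℂ B]
  [AddCommGroup C] [Module ℂ C] [AddCommGroup D] [Module ℂ D] [AddCommGroup V] [Module ℂ V]
  [AddCommGroup W] [Module ℂ W] [AddCommGroup N] [Module ℂ N] [AddCommGroup X] [Module ℂ X]
  [AddCommGroup Y] [Module ℂ Y] {E : Type u} [AddCommGroup E] [Module ℂ E]

theorem map_left_map_right (F : V →ₗ[ℂ] W) (G : X →ₗ[ℂ] Y) (t : V ⊗[ℂ] X) :
    TensorProduct.map F LinearMap.id (TensorProduct.map LinearMap.id G t) =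
      TensorProduct.map LinearMap.id G (TensorProduct.map F LinearMap.id t) := by
  rw [← LinearMap.comp_apply, ← LinearMap.comp_apply, ← TensorProduct.map_comp,
    ← TensorProduct.map_comp]
  rfl

theorem reassoc_map_left (F : V →ₗ[ℂ] W) (t : V ⊗[ℂ] (X ⊗[ℂ] Y)) :
    reassoc W X Y (TensorProduct.map F LinearMap.id t) =
      TensorProduct.map (TensorProduct.map F LinearMap.id) LinearMap.id (reassoc V X Y t) :=
  tensor_ext₃ (N := (W ⊗[ℂ] X) ⊗[ℂ] Y) (F := reassoc W X Y ∘ₗ TensorProduct.map F LinearMap.id)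
    (G := TensorProduct.map (TensorProduct.map F LinearMap.id) LinearMap.id ∘ₗ reassoc V X Y)
    (fun _ _ _ => by rfl) t

theorem reassoc_map_mid (F : V →ₗ[ℂ] W) (t : X ⊗[ℂ] (V ⊗[ℂ] Y)) :
    reassoc X W Y (TensorProduct.map LinearMap.id (TensorProduct.map F LinearMap.id) t) =
      TensorProduct.map (TensorProduct.map LinearMap.id F) LinearMap.id (reassoc X V Y t) :=
  tensor_ext₃ (N := (X ⊗[ℂ] W) ⊗[ℂ] Y) (F := reassoc X W Y ∘ₗ
      TensorProduct.map LinearMap.id (TensorProduct.map F LinearMap.id))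
    (G := TensorProduct.map (TensorProduct.map LinearMap.id F) LinearMap.id ∘ₗ reassoc X V Y)
    (fun _ _ _ => by rfl) t

theorem reassoc_map_right (F : V →ₗ[ℂ] W) (t : X ⊗[ℂ] (Y ⊗[ℂ] V)) :
    reassoc X Y W (TensorProduct.map LinearMap.id (TensorProduct.map LinearMap.id F) t) =
      TensorProduct.map LinearMap.id F (reassoc X Y V t) :=
  tensor_ext₃ (N := (X ⊗[ℂ] Y) ⊗[ℂ] W) (F := reassoc X Y W ∘ₗ
      TensorProduct.map LinearMap.id (TensorProduct.map LinearMap.id F))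
    (G := TensorProduct.map LinearMap.id F ∘ₗ reassoc X Y V)
    (fun _ _ _ => by simp) t

/-- The exchange of `X` with the factor `E` of `E ⊗ Y`. -/
def swapMid (X E Y : Type u) [AddCommGroup X] [Module ℂ X] [AddCommGroup E] [Module ℂ E]
    [AddCommGroup Y] [Module ℂ Y] [Parity X] [Parity E] :
    X ⊗[ℂ] (E ⊗[ℂ] Y) →ₗ[ℂ] E ⊗[ℂ] (X ⊗[ℂ] Y) :=
  unassoc E X Y ∘ₗ TensorProduct.map (swap X E) LinearMap.id ∘ₗ reassoc X E Y

variable [Parity E]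

theorem swapMid_tmul [Parity X] (x : X) (u : E) (y : Y) :
    swapMid X E Y (x ⊗ₜ (u ⊗ₜ y)) = (1 / 2 : ℂ) • (u ⊗ₜ (x ⊗ₜ y) + u ⊗ₜ (par x ⊗ₜ y) +
      (par u ⊗ₜ (x ⊗ₜ y) - par u ⊗ₜ (par x ⊗ₜ y))) := by
  change unassoc E X Y (swap X E (x ⊗ₜ u) ⊗ₜ y) = _
  rw [swap_tmul]
  simp only [← TensorProduct.smul_tmul', TensorProduct.add_tmul, TensorProduct.sub_tmul, map_smul,
    map_add, map_sub, LinearEquiv.coe_coe, TensorProduct.assoc_tmul]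

theorem swapMid_inl [Parity X] (P : h →ₗ[ℂ] Module.End ℂ X) [OddOp P] (a : h)
    (t : X ⊗[ℂ] (E ⊗[ℂ] Y)) : swapMid X E Y (inl P a t) = inr (inl P) a (swapMid X E Y t) := by
  simp only [swapMid, LinearMap.comp_apply]
  rw [reassoc_inl, map_inl_id (fun a v => swap_inl P a v), unassoc_inl_inr]

theorem swapMid_inr_inl [Parity X] (L : h →ₗ[ℂ] Module.End ℂ E) [OddOp L] (a : h)
    (t : X ⊗[ℂ] (E ⊗[ℂ] Y)) : swapMid X E Y (inr (inl L) a t) = inl L a (swapMid X E Y t) := by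
  simp only [swapMid, LinearMap.comp_apply]
  rw [reassoc_inr_inl, map_inl_id (fun a v => swap_inr L a v), unassoc_inl_inl]

theorem swapMid_inr_inr [Parity X] (Q : h →ₗ[ℂ] Module.End ℂ Y) (a : h)
    (t : X ⊗[ℂ] (E ⊗[ℂ] Y)) :
    swapMid X E Y (inr (inr Q) a t) = inr (inr Q) a (swapMid X E Y t) := by
  simp only [swapMid, LinearMap.comp_apply]
  rw [reassoc_inr_inr, map_inr_id swap_par, unassoc_inr]

theorem swapMid_map [Parity X] (G : V →ₗ[ℂ] W) (t : X ⊗[ℂ] (E ⊗[ℂ] V)) :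
    swapMid X E W (TensorProduct.map LinearMap.id (TensorProduct.map LinearMap.id G) t) =
      TensorProduct.map LinearMap.id (TensorProduct.map LinearMap.id G) (swapMid X E V t) := by
  simp only [swapMid, LinearMap.comp_apply]
  rw [reassoc_map_right, map_left_map_right]
  exact tensor_ext₃' (N := E ⊗[ℂ] (X ⊗[ℂ] W)) (F := unassoc E X W ∘ₗ
      TensorProduct.map LinearMap.id G)
    (G := TensorProduct.map LinearMap.id (TensorProduct.map LinearMap.id G) ∘ₗ unassoc E X V)
    (fun _ _ _ => by simp) _

theorem swapMid_map_left [Parity X] {F : E →ₗ[ℂ] E} (hF : ∀ u, F (par u) = par (F u))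
    (t : X ⊗[ℂ] (E ⊗[ℂ] Y)) :
    swapMid X E Y (TensorProduct.map LinearMap.id (TensorProduct.map F LinearMap.id) t) =
      TensorProduct.map F LinearMap.id (swapMid X E Y t) := by
  refine tensor_ext₃ (N := E ⊗[ℂ] (X ⊗[ℂ] Y)) (F := swapMid X E Y ∘ₗ
    TensorProduct.map LinearMap.id (TensorProduct.map F LinearMap.id))
    (G := TensorProduct.map F LinearMap.id ∘ₗ swapMid X E Y) (fun x u y => ?_) t
  simp only [LinearMap.comp_apply, swapMid_tmul, TensorProduct.map_tmul, LinearMap.id_apply,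
    map_smul, map_add, map_sub, hF]

/-- The hexagon identity: exchanging `E` with `X ⊗ Y` in one step or in two. -/
theorem swapMid_tensor [Parity X] [Parity Y] (t : X ⊗[ℂ] (Y ⊗[ℂ] (E ⊗[ℂ] V))) :
    swapMid (X ⊗[ℂ] Y) E V (reassoc X Y (E ⊗[ℂ] V) t) =
      TensorProduct.map LinearMap.id (reassoc X Y V) (swapMid X E (Y ⊗[ℂ] V)
        (TensorProduct.map LinearMap.id (swapMid Y E V) t)) := by
  refine tensor_ext₄ (N := E ⊗[ℂ] ((X ⊗[ℂ] Y) ⊗[ℂ] V))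
    (F := swapMid (X ⊗[ℂ] Y) E V ∘ₗ reassoc X Y (E ⊗[ℂ] V))
    (G := TensorProduct.map LinearMap.id (reassoc X Y V) ∘ₗ swapMid X E (Y ⊗[ℂ] V) ∘ₗ
      TensorProduct.map LinearMap.id (swapMid Y E V)) (fun x y u v => ?_) t
  simp only [LinearMap.comp_apply, LinearEquiv.coe_coe, TensorProduct.assoc_symm_tmul,
    swapMid_tmul, TensorProduct.map_tmul, LinearMap.id_apply, map_smul, map_add, map_sub, par_tmul,
    TensorProduct.tmul_add, TensorProduct.tmul_sub, TensorProduct.tmul_smul, par_par]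
  module

theorem reassoc_swapMid [Parity X] (t : X ⊗[ℂ] (E ⊗[ℂ] (Y ⊗[ℂ] V))) :
    reassoc E (X ⊗[ℂ] Y) V (TensorProduct.map LinearMap.id (reassoc X Y V)
        (swapMid X E (Y ⊗[ℂ] V) t)) =
      TensorProduct.map (swapMid X E Y) LinearMap.id (reassoc X (E ⊗[ℂ] Y) V
        (TensorProduct.map LinearMap.id (reassoc E Y V) t)) := by
  refine tensor_ext₄ (N := (E ⊗[ℂ] (X ⊗[ℂ] Y)) ⊗[ℂ] V)
    (F := reassoc E (X ⊗[ℂ] Y) V ∘ₗ TensorProduct.map LinearMap.id (reassoc X Y V) ∘ₗ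
        swapMid X E (Y ⊗[ℂ] V))
    (G := TensorProduct.map (swapMid X E Y) LinearMap.id ∘ₗ reassoc X (E ⊗[ℂ] Y) V ∘ₗ
        TensorProduct.map LinearMap.id (reassoc E Y V)) (fun x u y v => ?_) t
  simp only [LinearMap.comp_apply, LinearEquiv.coe_coe, TensorProduct.assoc_symm_tmul,
    swapMid_tmul, TensorProduct.map_tmul, LinearMap.id_apply, map_smul, map_add, map_sub,
    TensorProduct.add_tmul, TensorProduct.sub_tmul, ← TensorProduct.smul_tmul']

variable {ι : Type*} [Fintype ι] (α β : ι → h)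

/-- The associator `A ∗ (B ∗ C) → (A ∗ B) ∗ C` for `B` in the twisted component. -/
def assoc010 [Parity A] [Parity B] (P : h →ₗ[ℂ] Module.End ℂ A) (R : h →ₗ[ℂ] Module.End ℂ C) :
    A ⊗[ℂ] (B ⊗[ℂ] C) →ₗ[ℂ] (A ⊗[ℂ] B) ⊗[ℂ] C :=
  reassoc A B C ∘ₗ expOm α β (Complex.I * (Real.pi : ℂ)) (inl P) (inr (inr R))

/-- The associator for `A` and `C` in the twisted component. -/
def assoc101 [Parity A] (L : h →ₗ[ℂ] Module.End ℂ E) (Q : h →ₗ[ℂ] Module.End ℂ B) :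
    E ⊗[ℂ] (A ⊗[ℂ] (B ⊗[ℂ] C)) →ₗ[ℂ] E ⊗[ℂ] ((A ⊗[ℂ] B) ⊗[ℂ] C) :=
  TensorProduct.map LinearMap.id (reassoc A B C) ∘ₗ
    expOm α β (Complex.I * (Real.pi : ℂ)) (inl L) (inr (inr (inl Q)))

/-- The associator for `B` and `C` in the twisted component. -/
def assoc011 [Parity A] (δ : h →ₗ[ℂ] Module.End ℂ E) (P : h →ₗ[ℂ] Module.End ℂ A) :
    A ⊗[ℂ] (E ⊗[ℂ] (B ⊗[ℂ] C)) →ₗ[ℂ] E ⊗[ℂ] ((A ⊗[ℂ] B) ⊗[ℂ] C) :=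
  TensorProduct.map LinearMap.id (reassoc A B C) ∘ₗ swapMid A E (B ⊗[ℂ] C) ∘ₗ
    expOm α β (-1) (inl P) (inr (inl δ))

/-- The associator for `A` and `B` in the twisted component. -/
def assoc110 [Parity A] [Parity B] (δ : h →ₗ[ℂ] Module.End ℂ E) (R : h →ₗ[ℂ] Module.End ℂ C) :
    E ⊗[ℂ] (A ⊗[ℂ] (B ⊗[ℂ] C)) →ₗ[ℂ] (E ⊗[ℂ] (A ⊗[ℂ] B)) ⊗[ℂ] C :=
  reassoc E (A ⊗[ℂ] B) C ∘ₗ TensorProduct.map LinearMap.id (reassoc A B C) ∘ₗ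
    expOm α β 1 (inr (inr (inr R))) (inl δ)

/-- The associator for `A`, `B` and `C` in the twisted component. -/
def assoc111 [Parity A] (F : E →ₗ[ℂ] E) :
    A ⊗[ℂ] (E ⊗[ℂ] (B ⊗[ℂ] C)) →ₗ[ℂ] (E ⊗[ℂ] (A ⊗[ℂ] B)) ⊗[ℂ] C :=
  reassoc E (A ⊗[ℂ] B) C ∘ₗ TensorProduct.map LinearMap.id (reassoc A B C) ∘ₗ
    swapMid A E (B ⊗[ℂ] C) ∘ₗ TensorProduct.map LinearMap.id (TensorProduct.map F LinearMap.id)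

end Associators

/-! ### The pentagon identities with at most one twisted object

The digits in the names of the associators and of the pentagon identities tell, in order, which
objects lie in the component `𝒞₀` and which in the component `𝒞₁`. -/

section Pentagon

variable {h : Type u} [AddCommGroup h] [Module ℂ h]
  {ι : Type*} [Fintype ι] {α β : ι → h}
variable {A B C D : Type u} [AddCommGroup A] [Module ℂ A] [AddCommGroup B] [Module ℂ B]
  [AddCommGroup C] [Module ℂ C] [AddCommGroup D] [Module ℂ D]

theorem pentagon_reassoc (t : A ⊗[ℂ] (B ⊗[ℂ] (C ⊗[ℂ] D))) :
    reassoc (A ⊗[ℂ] B) C D (reassoc A B (C ⊗[ℂ] D) t) =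
      TensorProduct.map (reassoc A B C) LinearMap.id (reassoc A (B ⊗[ℂ] C) D
        (TensorProduct.map LinearMap.id (reassoc B C D) t)) :=
  LinearMap.congr_fun (show reassoc (A ⊗[ℂ] B) C D ∘ₗ reassoc A B (C ⊗[ℂ] D) =
    TensorProduct.map (reassoc A B C) LinearMap.id ∘ₗ reassoc A (B ⊗[ℂ] C) D ∘ₗ
      TensorProduct.map LinearMap.id (reassoc B C D) from
    LinearMap.ext fun t => by
      refine tensor_ext₄ (X := A) (Y := B) (Z := C) (V := D) (N := ((A ⊗[ℂ] B) ⊗[ℂ] C) ⊗[ℂ] D)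
        (fun _ _ _ _ => ?_) t
      rfl) t


variable {E : Type u} [AddCommGroup E] [Module ℂ E]

theorem map_id_pentagon_reassoc (t : E ⊗[ℂ] (A ⊗[ℂ] (B ⊗[ℂ] (C ⊗[ℂ] D)))) :
    TensorProduct.map LinearMap.id (reassoc (A ⊗[ℂ] B) C D)
        (TensorProduct.map LinearMap.id (reassoc A B (C ⊗[ℂ] D)) t) =
      TensorProduct.map LinearMap.id (TensorProduct.map (reassoc A B C) LinearMap.id)
        (TensorProduct.map LinearMap.id (reassoc A (B ⊗[ℂ] C) D)
          (TensorProduct.map LinearMap.id (TensorProduct.map LinearMap.id (reassoc B C D)) t)) := by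
  refine LinearMap.congr_fun (show TensorProduct.map LinearMap.id (reassoc (A ⊗[ℂ] B) C D) ∘ₗ
        TensorProduct.map LinearMap.id (reassoc A B (C ⊗[ℂ] D)) =
      TensorProduct.map (LinearMap.id : E →ₗ[ℂ] E)
          (TensorProduct.map (reassoc A B C) LinearMap.id) ∘ₗ
        TensorProduct.map LinearMap.id (reassoc A (B ⊗[ℂ] C) D) ∘ₗ
          TensorProduct.map LinearMap.id (TensorProduct.map LinearMap.id (reassoc B C D)) from ?_) t
  exact LinearMap.ext (tensor_ext₅ fun e a b c d => by rfl)

theorem reassoc_map_id_pentagon_reassoc (t : E ⊗[ℂ] (A ⊗[ℂ] (B ⊗[ℂ] (C ⊗[ℂ] D)))) :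
    reassoc (E ⊗[ℂ] (A ⊗[ℂ] B)) C D (reassoc E (A ⊗[ℂ] B) (C ⊗[ℂ] D)
        (TensorProduct.map LinearMap.id (reassoc A B (C ⊗[ℂ] D)) t)) =
      TensorProduct.map (reassoc E (A ⊗[ℂ] B) C) LinearMap.id
        (TensorProduct.map (TensorProduct.map LinearMap.id (reassoc A B C)) LinearMap.id
          (reassoc E (A ⊗[ℂ] (B ⊗[ℂ] C)) D
            (TensorProduct.map LinearMap.id (reassoc A (B ⊗[ℂ] C) D)
              (TensorProduct.map LinearMap.id
                (TensorProduct.map LinearMap.id (reassoc B C D)) t)))) := by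
  refine LinearMap.congr_fun (show reassoc (E ⊗[ℂ] (A ⊗[ℂ] B)) C D ∘ₗ
        reassoc E (A ⊗[ℂ] B) (C ⊗[ℂ] D) ∘ₗ
        TensorProduct.map LinearMap.id (reassoc A B (C ⊗[ℂ] D)) =
      TensorProduct.map (reassoc E (A ⊗[ℂ] B) C) LinearMap.id ∘ₗ
        TensorProduct.map (TensorProduct.map LinearMap.id (reassoc A B C)) LinearMap.id ∘ₗ
          reassoc E (A ⊗[ℂ] (B ⊗[ℂ] C)) D ∘ₗ
            TensorProduct.map LinearMap.id (reassoc A (B ⊗[ℂ] C) D) ∘ₗ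
              TensorProduct.map LinearMap.id
                (TensorProduct.map LinearMap.id (reassoc B C D)) from ?_) t
  exact LinearMap.ext fun t => tensor_ext₅ (N := ((E ⊗[ℂ] (A ⊗[ℂ] B)) ⊗[ℂ] C) ⊗[ℂ] D)
    (fun e a b c d => by rfl) t

variable [Parity A] [Parity B] [Parity C]

theorem pentagon_0100 (P : h →ₗ[ℂ] Module.End ℂ A) (R : h →ₗ[ℂ] Module.End ℂ C)
    (S : h →ₗ[ℂ] Module.End ℂ D) [OddOp P] [Anti P P] [OddOp R] [Anti R R] [Anti S S]
    (t : A ⊗[ℂ] (B ⊗[ℂ] (C ⊗[ℂ] D))) :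
    reassoc (A ⊗[ℂ] B) C D (assoc010 α β P (inl R + inr S) t) =
      TensorProduct.map (assoc010 α β P R) LinearMap.id (assoc010 α β P S
        (TensorProduct.map LinearMap.id (reassoc B C D) t)) := by
  simp only [assoc010, LinearMap.comp_apply, map_comp_id]
  rw [inr_add, inr_add, expOm_add_right, Module.End.mul_apply, pentagon_reassoc, map_expOm_id,
    ← map_expOm α β (TensorProduct.map LinearMap.id (reassoc B C D)) _ (P := inl P)
      (Q := inr (inr (inr S))) (map_id_inl _ _)
      (map_id_inr fun a v => by rw [reassoc_inr_inr]),
    ← map_expOm α β (reassoc A (B ⊗[ℂ] C) D) _ (P := inl P) (Q := inr (inl (inr R)))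
      (reassoc_inl _) (reassoc_inr_inl _),
    ← map_expOm α β (TensorProduct.map LinearMap.id (reassoc B C D)) _ (P := inl P)
      (Q := inr (inr (inl R))) (map_id_inl _ _)
      (map_id_inr fun a v => by rw [reassoc_inr_inl])]

theorem pentagon_0010 (P : h →ₗ[ℂ] Module.End ℂ A) (Q : h →ₗ[ℂ] Module.End ℂ B)
    (S : h →ₗ[ℂ] Module.End ℂ D) [OddOp P] [Anti P P] [OddOp Q] [Anti Q Q] [Anti S S]
    (t : A ⊗[ℂ] (B ⊗[ℂ] (C ⊗[ℂ] D))) :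
    assoc010 α β (inl P + inr Q) S (reassoc A B (C ⊗[ℂ] D) t) =
      TensorProduct.map (reassoc A B C) LinearMap.id (assoc010 α β P S
        (TensorProduct.map LinearMap.id (assoc010 α β Q S) t)) := by
  simp only [assoc010, LinearMap.comp_apply, map_id_comp]
  rw [inl_add, expOm_add_left, Module.End.mul_apply, map_id_expOm,
    ← map_expOm α β (TensorProduct.map LinearMap.id (reassoc B C D)) _ (P := inl P)
      (Q := inr (inr (inr S))) (map_id_inl _ _)
      (map_id_inr fun a v => by rw [reassoc_inr_inr]),
    ← map_expOm α β (reassoc A B (C ⊗[ℂ] D)) _ (P := inr (inl Q)) (Q := inr (inr (inr S)))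
      (reassoc_inr_inl _) (reassoc_inr_inr _),
    ← map_expOm α β (reassoc A B (C ⊗[ℂ] D)) _ (P := inl P) (Q := inr (inr (inr S)))
      (reassoc_inl _) (reassoc_inr_inr _), pentagon_reassoc]

end Pentagon

/-! ### The pentagon identities involving the enveloping algebra -/

/-! ### The pentagon identities with several twisted objects

Here `E` stands for `U(h)`, `L` for left multiplication, `δ` for contraction and `F` for the
Fourier transform `φ`; only the relations between these operators matter. -/

section Pentagon

variable {h : Type u} [AddCommGroup h] [Module ℂ h] {ω : LinearMap.BilinForm ℂ h}
  {ι : Type*} [Fintype ι] {α β : ι → h}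

theorem expOm_comm {V : Type*} [AddCommGroup V] [Module ℂ V] (c d : ℂ)
    (P Q P' Q' : h →ₗ[ℂ] Module.End ℂ V) [Anti P P'] [Anti P Q'] [Anti Q P'] [Anti Q Q'] (v : V) :
    expOm α β c P Q (expOm α β d P' Q' v) = expOm α β d P' Q' (expOm α β c P Q v) := by
  refine truncExp_apply_comm (expOm α β c P Q) (fun v => ?_) _ v
  refine (truncExp_apply_comm (d • Om α β P' Q') (fun v => ?_) _ v).symm
  simp only [LinearMap.smul_apply, map_smul]
  rw [smul_comm, ← Module.End.mul_apply, ← (Om_commute α β P Q P' Q').eq, Module.End.mul_apply]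

/-- `exp(d S δ)` takes `L` to `L + d S`, hence `exp(c L Q)` to `exp(c L Q) exp(c d S Q)`. -/
theorem IsDualPair.expOm_exchange {V : Type*} [AddCommGroup V] [Module ℂ V]
    (hd : IsDualPair ω α β) (d c : ℂ) (S δ L Q : h →ₗ[ℂ] Module.End ℂ V) [Anti S S] [Anti S δ]
    [Anti δ S] [Anti δ δ] [Anti S L] [Heis ω δ L] [Anti L L] [Anti L S] [Anti L Q] [Anti Q L]
    [Anti Q Q] [Anti Q S] [Anti S Q] [Anti Q δ] (v : V) :
    expOm α β d S δ (expOm α β c L Q v) =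
      expOm α β c L Q (expOm α β (c * d) S Q (expOm α β d S δ v)) := by
  rw [map_expOm α β (expOm α β d S δ) c (P' := L + d • S) (Q' := Q)
    (fun a v => by rw [hd.expOm_apply_left]; rfl)
    (fun a v => (map_expOm_of_anti α β (Q a) d (fun b v => Anti.apply_comm a b v)
      (fun b v => Anti.apply_comm a b v) v).symm),
    expOm_add_left, Module.End.mul_apply, expOm_smul_left]

theorem I_mul_pi_mul_inv :
    Complex.I * (Real.pi : ℂ) * (-((Real.pi : ℂ) * Complex.I))⁻¹ = -1 := by
  have h1 : (Real.pi : ℂ) ≠ 0 := by exact_mod_cast Real.pi_ne_zero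
  have h2 := Complex.I_ne_zero
  field_simp

variable {A B C D : Type u} [AddCommGroup A] [Module ℂ A] [AddCommGroup B] [Module ℂ B]
  [AddCommGroup C] [Module ℂ C] [AddCommGroup D] [Module ℂ D]
  {E : Type u} [AddCommGroup E] [Module ℂ E] [Parity E]

theorem map_id_map_left_map_right {X V W Y Z : Type u} [AddCommGroup X] [Module ℂ X]
    [AddCommGroup V] [Module ℂ V] [AddCommGroup W] [Module ℂ W] [AddCommGroup Y] [Module ℂ Y]
    [AddCommGroup Z] [Module ℂ Z] (F : V →ₗ[ℂ] W) (G : Y →ₗ[ℂ] Z) (t : X ⊗[ℂ] (V ⊗[ℂ] Y)) :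
    TensorProduct.map LinearMap.id (TensorProduct.map F LinearMap.id)
        (TensorProduct.map LinearMap.id (TensorProduct.map LinearMap.id G) t) =
      TensorProduct.map LinearMap.id (TensorProduct.map LinearMap.id G)
        (TensorProduct.map LinearMap.id (TensorProduct.map F LinearMap.id) t) := by
  simp only [← LinearMap.comp_apply, ← map_id_comp]
  exact map_id_congr (map_left_map_right F G) t

theorem map_id_map_left_swapMid [Parity B] {F : E →ₗ[ℂ] E} (hF : ∀ u, F (par u) = par (F u))
    (t : A ⊗[ℂ] (B ⊗[ℂ] (E ⊗[ℂ] C))) :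
    TensorProduct.map LinearMap.id (TensorProduct.map F LinearMap.id)
        (TensorProduct.map LinearMap.id (swapMid B E C) t) =
      TensorProduct.map LinearMap.id (swapMid B E C) (TensorProduct.map LinearMap.id
        (TensorProduct.map LinearMap.id (TensorProduct.map F LinearMap.id)) t) := by
  simp only [← LinearMap.comp_apply, ← map_id_comp]
  exact map_id_congr (fun v => (swapMid_map_left hF v).symm) t

theorem map_id_map_left_reassoc [Parity A] [Parity B] {F : E →ₗ[ℂ] E}
    (hF : ∀ u, F (par u) = par (F u))
    (v : E ⊗[ℂ] (A ⊗[ℂ] (B ⊗[ℂ] (E ⊗[ℂ] (C ⊗[ℂ] D))))) :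
    TensorProduct.map LinearMap.id (TensorProduct.map (TensorProduct.map LinearMap.id
        (TensorProduct.map F LinearMap.id)) LinearMap.id)
      (TensorProduct.map LinearMap.id (reassoc A (E ⊗[ℂ] (B ⊗[ℂ] C)) D)
        (TensorProduct.map LinearMap.id (TensorProduct.map LinearMap.id (reassoc E (B ⊗[ℂ] C) D))
          (TensorProduct.map LinearMap.id (TensorProduct.map LinearMap.id
              (TensorProduct.map LinearMap.id (reassoc B C D)))
            (TensorProduct.map LinearMap.id
              (TensorProduct.map LinearMap.id (swapMid B E (C ⊗[ℂ] D))) v)))) =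
      TensorProduct.map LinearMap.id (reassoc A (E ⊗[ℂ] (B ⊗[ℂ] C)) D)
        (TensorProduct.map LinearMap.id (TensorProduct.map LinearMap.id (reassoc E (B ⊗[ℂ] C) D))
          (TensorProduct.map LinearMap.id (TensorProduct.map LinearMap.id
              (TensorProduct.map LinearMap.id (reassoc B C D)))
            (TensorProduct.map LinearMap.id
              (TensorProduct.map LinearMap.id (swapMid B E (C ⊗[ℂ] D)))
              (TensorProduct.map LinearMap.id (TensorProduct.map LinearMap.id
                (TensorProduct.map LinearMap.id (TensorProduct.map F LinearMap.id))) v)))) := by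
  have key : TensorProduct.map (TensorProduct.map LinearMap.id
          (TensorProduct.map F LinearMap.id)) LinearMap.id ∘ₗ
        reassoc A (E ⊗[ℂ] (B ⊗[ℂ] C)) D ∘ₗ
        TensorProduct.map LinearMap.id (reassoc E (B ⊗[ℂ] C) D) ∘ₗ
        TensorProduct.map LinearMap.id (TensorProduct.map LinearMap.id (reassoc B C D)) ∘ₗ
        TensorProduct.map LinearMap.id (swapMid B E (C ⊗[ℂ] D)) =
      reassoc A (E ⊗[ℂ] (B ⊗[ℂ] C)) D ∘ₗ
        TensorProduct.map LinearMap.id (reassoc E (B ⊗[ℂ] C) D) ∘ₗ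
        TensorProduct.map LinearMap.id (TensorProduct.map LinearMap.id (reassoc B C D)) ∘ₗ
        TensorProduct.map LinearMap.id (swapMid B E (C ⊗[ℂ] D)) ∘ₗ
        TensorProduct.map LinearMap.id (TensorProduct.map LinearMap.id
          (TensorProduct.map F LinearMap.id)) := by
    refine LinearMap.ext fun v => ?_
    simp only [LinearMap.comp_apply]
    rw [← reassoc_map_mid]
    congr 1
    simp only [← LinearMap.comp_apply, ← map_id_comp]
    refine map_id_congr (fun w => ?_) v
    simp only [LinearMap.comp_apply]
    rw [← reassoc_map_left, map_left_map_right, swapMid_map_left hF]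
  have := LinearMap.congr_fun (congrArg (TensorProduct.map (LinearMap.id : E →ₗ[ℂ] E)) key) v
  simpa only [map_id_comp, LinearMap.comp_apply] using this

/-- The pentagon of reassociations and the naturality of `swapMid`, tensored with `E`. -/
theorem map_id_reassoc_swapMid_swapMid [Parity A] [Parity B]
    (v : E ⊗[ℂ] (A ⊗[ℂ] (B ⊗[ℂ] (E ⊗[ℂ] (C ⊗[ℂ] D))))) :
    TensorProduct.map LinearMap.id (TensorProduct.map (reassoc E (A ⊗[ℂ] B) C) LinearMap.id)
      (TensorProduct.map LinearMap.id
          (TensorProduct.map (TensorProduct.map LinearMap.id (reassoc A B C)) LinearMap.id)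
        (TensorProduct.map LinearMap.id
            (TensorProduct.map (swapMid A E (B ⊗[ℂ] C)) LinearMap.id)
          (TensorProduct.map LinearMap.id (reassoc A (E ⊗[ℂ] (B ⊗[ℂ] C)) D)
            (TensorProduct.map LinearMap.id
                (TensorProduct.map LinearMap.id (reassoc E (B ⊗[ℂ] C) D))
              (TensorProduct.map LinearMap.id (TensorProduct.map LinearMap.id
                  (TensorProduct.map LinearMap.id (reassoc B C D)))
                (TensorProduct.map LinearMap.id
                  (TensorProduct.map LinearMap.id (swapMid B E (C ⊗[ℂ] D))) v)))))) =
      TensorProduct.map LinearMap.id (reassoc (E ⊗[ℂ] (A ⊗[ℂ] B)) C D)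
        (TensorProduct.map LinearMap.id (reassoc E (A ⊗[ℂ] B) (C ⊗[ℂ] D))
          (TensorProduct.map LinearMap.id
              (TensorProduct.map LinearMap.id (reassoc A B (C ⊗[ℂ] D)))
            (TensorProduct.map LinearMap.id (swapMid A E (B ⊗[ℂ] (C ⊗[ℂ] D)))
              (TensorProduct.map LinearMap.id
                (TensorProduct.map LinearMap.id (swapMid B E (C ⊗[ℂ] D))) v)))) := by
  have key : TensorProduct.map (reassoc E (A ⊗[ℂ] B) C) LinearMap.id ∘ₗ
        TensorProduct.map (TensorProduct.map LinearMap.id (reassoc A B C)) LinearMap.id ∘ₗ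
        TensorProduct.map (swapMid A E (B ⊗[ℂ] C)) LinearMap.id ∘ₗ
        reassoc A (E ⊗[ℂ] (B ⊗[ℂ] C)) D ∘ₗ
        TensorProduct.map LinearMap.id (reassoc E (B ⊗[ℂ] C) D) ∘ₗ
        TensorProduct.map LinearMap.id (TensorProduct.map LinearMap.id (reassoc B C D)) ∘ₗ
        TensorProduct.map LinearMap.id (swapMid B E (C ⊗[ℂ] D)) =
      reassoc (E ⊗[ℂ] (A ⊗[ℂ] B)) C D ∘ₗ reassoc E (A ⊗[ℂ] B) (C ⊗[ℂ] D) ∘ₗ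
        TensorProduct.map LinearMap.id (reassoc A B (C ⊗[ℂ] D)) ∘ₗ
        swapMid A E (B ⊗[ℂ] (C ⊗[ℂ] D)) ∘ₗ
        TensorProduct.map LinearMap.id (swapMid B E (C ⊗[ℂ] D)) := by
    refine LinearMap.ext fun v => ?_
    simp only [LinearMap.comp_apply]
    rw [pentagon_reassoc, map_id_pentagon_reassoc, reassoc_map_mid, ← swapMid_map,
      reassoc_swapMid]
  have := LinearMap.congr_fun (congrArg (TensorProduct.map (LinearMap.id : E →ₗ[ℂ] E)) key) v
  simpa only [map_id_comp, LinearMap.comp_apply] using this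

theorem map_id_swapMid_tensor [Parity A] [Parity B]
    (v : E ⊗[ℂ] (A ⊗[ℂ] (B ⊗[ℂ] (E ⊗[ℂ] (C ⊗[ℂ] D))))) :
    TensorProduct.map LinearMap.id (swapMid (A ⊗[ℂ] B) E (C ⊗[ℂ] D))
        (TensorProduct.map LinearMap.id (reassoc A B (E ⊗[ℂ] (C ⊗[ℂ] D))) v) =
      TensorProduct.map LinearMap.id (TensorProduct.map LinearMap.id (reassoc A B (C ⊗[ℂ] D)))
        (TensorProduct.map LinearMap.id (swapMid A E (B ⊗[ℂ] (C ⊗[ℂ] D)))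
          (TensorProduct.map LinearMap.id
            (TensorProduct.map LinearMap.id (swapMid B E (C ⊗[ℂ] D))) v)) := by
  have key : swapMid (A ⊗[ℂ] B) E (C ⊗[ℂ] D) ∘ₗ reassoc A B (E ⊗[ℂ] (C ⊗[ℂ] D)) =
      TensorProduct.map LinearMap.id (reassoc A B (C ⊗[ℂ] D)) ∘ₗ
        swapMid A E (B ⊗[ℂ] (C ⊗[ℂ] D)) ∘ₗ
        TensorProduct.map LinearMap.id (swapMid B E (C ⊗[ℂ] D)) := by
    exact LinearMap.ext swapMid_tensor
  have := LinearMap.congr_fun (congrArg (TensorProduct.map (LinearMap.id : E →ₗ[ℂ] E)) key) v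
  simpa only [map_id_comp, LinearMap.comp_apply] using this

theorem map_id_map_map_self {F : E →ₗ[ℂ] E} (hFF : ∀ u, F (F u) = par u)
    (v : E ⊗[ℂ] (A ⊗[ℂ] (B ⊗[ℂ] (E ⊗[ℂ] (C ⊗[ℂ] D))))) :
    TensorProduct.map LinearMap.id (TensorProduct.map LinearMap.id
        (TensorProduct.map LinearMap.id (TensorProduct.map F LinearMap.id)))
      (TensorProduct.map LinearMap.id (TensorProduct.map LinearMap.id
        (TensorProduct.map LinearMap.id (TensorProduct.map F LinearMap.id))) v) =
    TensorProduct.map LinearMap.id (TensorProduct.map LinearMap.id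
        (TensorProduct.map LinearMap.id (TensorProduct.map par LinearMap.id))) v := by
  simp only [← LinearMap.comp_apply, ← map_id_comp, ← map_comp_id]
  rw [show F ∘ₗ F = par from LinearMap.ext hFF]

theorem map_id_swapMid_swapMid_par [Parity A] [Parity B]
    (v : E ⊗[ℂ] (A ⊗[ℂ] (B ⊗[ℂ] (E ⊗[ℂ] (C ⊗[ℂ] D))))) :
    TensorProduct.map LinearMap.id (swapMid A E (B ⊗[ℂ] (C ⊗[ℂ] D)))
      (TensorProduct.map LinearMap.id
        (TensorProduct.map LinearMap.id (swapMid B E (C ⊗[ℂ] D)))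
          (TensorProduct.map LinearMap.id (TensorProduct.map LinearMap.id
            (TensorProduct.map LinearMap.id (TensorProduct.map par LinearMap.id))) v)) =
    TensorProduct.map LinearMap.id (TensorProduct.map par LinearMap.id)
      (TensorProduct.map LinearMap.id (swapMid A E (B ⊗[ℂ] (C ⊗[ℂ] D)))
        (TensorProduct.map LinearMap.id
          (TensorProduct.map LinearMap.id (swapMid B E (C ⊗[ℂ] D))) v)) := by
  simp only [← LinearMap.comp_apply, ← map_id_comp]
  refine map_id_congr (fun w => ?_) v
  simp only [LinearMap.comp_apply]
  simp only [map_id_comp, LinearMap.comp_apply]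
  rw [← map_id_map_left_swapMid (fun _ => rfl), swapMid_map_left (fun _ => rfl)]

variable [Parity A] [Parity B]

theorem pentagon_0011 (δ : h →ₗ[ℂ] Module.End ℂ E)
    [OddOp δ] [Anti δ δ] (P : h →ₗ[ℂ] Module.End ℂ A) (Q : h →ₗ[ℂ] Module.End ℂ B) [OddOp P]
    [Anti P P] [OddOp Q] [Anti Q Q] (t : A ⊗[ℂ] (B ⊗[ℂ] (E ⊗[ℂ] (C ⊗[ℂ] D)))) :
    assoc011 α β δ (inl P + inr Q) (reassoc A B (E ⊗[ℂ] (C ⊗[ℂ] D)) t) =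
      TensorProduct.map LinearMap.id (TensorProduct.map (reassoc A B C) LinearMap.id)
        (assoc011 α β δ P (TensorProduct.map LinearMap.id (assoc011 α β δ Q) t)) := by
  simp only [assoc011, LinearMap.comp_apply, map_id_comp]
  rw [inl_add, expOm_add_left, Module.End.mul_apply, map_id_expOm,
    ← map_expOm α β (TensorProduct.map LinearMap.id (TensorProduct.map LinearMap.id
        (reassoc B C D))) _ (P := inl P) (Q := inr (inl δ)) (map_id_inl _ _)
      (map_id_inr (map_id_inl _ _)),
    ← map_expOm α β (TensorProduct.map LinearMap.id (swapMid B E (C ⊗[ℂ] D))) _ (P := inl P)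
      (Q := inr (inr (inl δ))) (map_id_inl _ _) (map_id_inr (swapMid_inr_inl _)),
    ← map_expOm α β (reassoc A B (E ⊗[ℂ] (C ⊗[ℂ] D))) _ (P := inr (inl Q))
      (Q := inr (inr (inl δ))) (reassoc_inr_inl _) (reassoc_inr_inr _),
    ← map_expOm α β (reassoc A B (E ⊗[ℂ] (C ⊗[ℂ] D))) _ (P := inl P)
      (Q := inr (inr (inl δ))) (reassoc_inl _) (reassoc_inr_inr _), swapMid_tensor,
    map_id_pentagon_reassoc, swapMid_map]

theorem pentagon_0110 [Parity C] (δ : h →ₗ[ℂ] Module.End ℂ E)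
    [OddOp δ] [Anti δ δ] (P : h →ₗ[ℂ] Module.End ℂ A) (S : h →ₗ[ℂ] Module.End ℂ D) [OddOp P]
    [Anti P P] [Anti S S] (t : A ⊗[ℂ] (E ⊗[ℂ] (B ⊗[ℂ] (C ⊗[ℂ] D)))) :
    assoc110 α β δ S (assoc011 α β δ P t) =
      TensorProduct.map (assoc011 α β δ P) LinearMap.id (reassoc A (E ⊗[ℂ] (B ⊗[ℂ] C)) D
        (TensorProduct.map LinearMap.id (assoc110 α β δ S) t)) := by
  simp only [assoc011, assoc110, LinearMap.comp_apply, map_id_comp, map_comp_id]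
  rw [map_expOm_id, map_id_expOm,
    ← map_expOm α β (TensorProduct.map LinearMap.id (reassoc A B (C ⊗[ℂ] D))) _
      (P := inr (inr (inr (inr S)))) (Q := inl δ)
      (map_id_inr fun a v => by rw [reassoc_inr_inr]) (map_id_inl _ _),
    ← map_expOm α β (swapMid A E (B ⊗[ℂ] (C ⊗[ℂ] D))) _
      (P := inr (inr (inr (inr S)))) (Q := inr (inl δ))
      (swapMid_inr_inr _) (swapMid_inr_inl _),
    ← map_expOm α β (reassoc A (E ⊗[ℂ] (B ⊗[ℂ] C)) D) _ (P := inl P) (Q := inr (inl (inl δ)))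
      (reassoc_inl _) (reassoc_inr_inl _),
    ← map_expOm α β (TensorProduct.map LinearMap.id (reassoc E (B ⊗[ℂ] C) D)) _ (P := inl P)
      (Q := inr (inl δ)) (map_id_inl _ _) (map_id_inr (reassoc_inl _)),
    ← map_expOm α β (TensorProduct.map LinearMap.id (TensorProduct.map LinearMap.id
      (reassoc B C D))) _ (P := inl P)
      (Q := inr (inl δ)) (map_id_inl _ _) (map_id_inr (map_id_inl _ _)),
    expOm_comm, map_id_pentagon_reassoc, reassoc_map_mid, ← swapMid_map,
    reassoc_swapMid]

theorem pentagon_1001 (L : h →ₗ[ℂ] Module.End ℂ E)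
    [OddOp L] [Anti L L] (Q : h →ₗ[ℂ] Module.End ℂ B) (R : h →ₗ[ℂ] Module.End ℂ C) [OddOp Q]
    [Anti Q Q] [Anti R R] (t : E ⊗[ℂ] (A ⊗[ℂ] (B ⊗[ℂ] (C ⊗[ℂ] D)))) :
    assoc101 α β L R (assoc101 α β L Q t) =
      TensorProduct.map LinearMap.id (TensorProduct.map (reassoc A B C) LinearMap.id)
        (assoc101 α β L (inl Q + inr R)
          (TensorProduct.map LinearMap.id (TensorProduct.map LinearMap.id (reassoc B C D)) t)) := by
  simp only [assoc101, LinearMap.comp_apply]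
  rw [inl_add, inr_add, inr_add, expOm_add_right, Module.End.mul_apply,
    ← map_expOm α β (TensorProduct.map LinearMap.id (TensorProduct.map LinearMap.id
        (reassoc B C D))) _ (P := inl L) (Q := inr (inr (inr (inl R)))) (map_id_inl _ _)
      (map_id_inr (map_id_inr fun a v => by rw [reassoc_inr_inl])),
    ← map_expOm α β (TensorProduct.map LinearMap.id (TensorProduct.map LinearMap.id
        (reassoc B C D))) _ (P := inl L) (Q := inr (inr (inl Q))) (map_id_inl _ _)
      (map_id_inr (map_id_inr fun a v => by rw [reassoc_inl])),
    ← map_expOm α β (TensorProduct.map LinearMap.id (reassoc A B (C ⊗[ℂ] D))) _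
      (P := inl L) (Q := inr (inr (inr (inl R))))
      (map_id_inl _ _) (map_id_inr fun a v => by rw [reassoc_inr_inr]),
    expOm_comm, map_id_pentagon_reassoc]

theorem IsDualPair.pentagon_1010 (hd : IsDualPair ω α β) [Parity C] (L δ : h →ₗ[ℂ] Module.End ℂ E)
    [OddOp L] [OddOp δ] [Anti L L] [Anti δ δ] [Heis ω δ L] (Q : h →ₗ[ℂ] Module.End ℂ B)
    (S : h →ₗ[ℂ] Module.End ℂ D) [OddOp Q]
    [Anti Q Q] [Anti S S] (t : E ⊗[ℂ] (A ⊗[ℂ] (B ⊗[ℂ] (C ⊗[ℂ] D)))) :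
    assoc110 α β δ S (assoc101 α β L Q t) =
      TensorProduct.map (assoc101 α β L Q) LinearMap.id (assoc110 α β δ S
        (TensorProduct.map LinearMap.id
          (TensorProduct.map LinearMap.id (assoc010 α β Q S)) t)) := by
  simp only [assoc110, assoc101, assoc010, LinearMap.comp_apply, map_comp_id, map_id_comp]
  rw [map_id_expOm, map_id_expOm, map_expOm_id,
    ← map_expOm α β (TensorProduct.map LinearMap.id (TensorProduct.map LinearMap.id
        (reassoc B C D))) _ (P := inr (inr (inr (inr S)))) (Q := inl δ)
      (map_id_inr (map_id_inr fun a v => by rw [reassoc_inr_inr])) (map_id_inl _ _),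
    ← map_expOm α β (reassoc E (A ⊗[ℂ] (B ⊗[ℂ] C)) D) _
      (P := inl L) (Q := inr (inl (inr (inl Q)))) (reassoc_inl _) (reassoc_inr_inl _),
    ← map_expOm α β (TensorProduct.map LinearMap.id (reassoc A (B ⊗[ℂ] C) D)) _
      (P := inl L) (Q := inr (inr (inl (inl Q))))
      (map_id_inl _ _) (map_id_inr fun a v => by rw [reassoc_inr_inl]),
    ← map_expOm α β (TensorProduct.map LinearMap.id (TensorProduct.map LinearMap.id
        (reassoc B C D))) _ (P := inl L) (Q := inr (inr (inl Q)))
      (map_id_inl _ _) (map_id_inr (map_id_inr fun a v => by rw [reassoc_inl])),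
    ← map_expOm α β (TensorProduct.map LinearMap.id (reassoc A B (C ⊗[ℂ] D))) _
      (P := inr (inr (inr (inr S)))) (Q := inl δ)
      (map_id_inr fun a v => by rw [reassoc_inr_inr]) (map_id_inl _ _),
    map_id_pentagon_reassoc, reassoc_map_mid, hd.expOm_exchange, mul_one,
    hd.expOm_symm _ (inr (inr (inr (inr S)))),
    expOm_comm _ _ (inr (inr (inr (inr S)))) (inl δ) (inr (inr (inl Q)))]

theorem pentagon_1100 [Parity C] (δ : h →ₗ[ℂ] Module.End ℂ E)
    [OddOp δ] [Anti δ δ] (R : h →ₗ[ℂ] Module.End ℂ C) (S : h →ₗ[ℂ] Module.End ℂ D) [OddOp R]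
    [Anti R R] [Anti S S] (t : E ⊗[ℂ] (A ⊗[ℂ] (B ⊗[ℂ] (C ⊗[ℂ] D)))) :
    reassoc (E ⊗[ℂ] (A ⊗[ℂ] B)) C D (assoc110 α β δ (inl R + inr S) t) =
      TensorProduct.map (assoc110 α β δ R) LinearMap.id (assoc110 α β δ S
        (TensorProduct.map LinearMap.id
          (TensorProduct.map LinearMap.id (reassoc B C D)) t)) := by
  simp only [assoc110, LinearMap.comp_apply, map_comp_id]
  rw [inr_add, inr_add, inr_add, expOm_add_left, Module.End.mul_apply, map_expOm_id, expOm_comm,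
    ← map_expOm α β (TensorProduct.map LinearMap.id (TensorProduct.map LinearMap.id
        (reassoc B C D))) _ (P := inr (inr (inr (inr S)))) (Q := inl δ)
      (map_id_inr (map_id_inr fun a v => by rw [reassoc_inr_inr])) (map_id_inl _ _),
    ← map_expOm α β (reassoc E (A ⊗[ℂ] (B ⊗[ℂ] C)) D) _
      (P := inr (inl (inr (inr R)))) (Q := inl δ) (reassoc_inr_inl _) (reassoc_inl _),
    ← map_expOm α β (TensorProduct.map LinearMap.id (reassoc A (B ⊗[ℂ] C) D)) _
      (P := inr (inr (inl (inr R)))) (Q := inl δ)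
      (map_id_inr fun a v => by rw [reassoc_inr_inl]) (map_id_inl _ _),
    ← map_expOm α β (TensorProduct.map LinearMap.id (TensorProduct.map LinearMap.id
        (reassoc B C D))) _ (P := inr (inr (inr (inl R)))) (Q := inl δ)
      (map_id_inr (map_id_inr fun a v => by rw [reassoc_inr_inl])) (map_id_inl _ _),
    reassoc_map_id_pentagon_reassoc, expOm_comm]

theorem IsDualPair.pentagon_0101 (hd : IsDualPair ω α β) [Parity C] (L δ : h →ₗ[ℂ] Module.End ℂ E)
    [OddOp L] [OddOp δ] [Anti L L] [Anti δ δ] [Heis ω δ L] (P : h →ₗ[ℂ] Module.End ℂ A)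
    (R : h →ₗ[ℂ] Module.End ℂ C) [OddOp P]
    [Anti P P] [OddOp R] [Anti R R] (t : A ⊗[ℂ] (E ⊗[ℂ] (B ⊗[ℂ] (C ⊗[ℂ] D)))) :
    assoc101 α β L R (assoc011 α β δ P t) =
      TensorProduct.map LinearMap.id (TensorProduct.map (assoc010 α β P R) LinearMap.id)
        (assoc011 α β δ P (TensorProduct.map LinearMap.id (assoc101 α β L R) t)) := by
  simp only [assoc101, assoc011, assoc010, LinearMap.comp_apply, map_comp_id, map_id_comp]
  rw [map_id_expOm, map_expOm_id, map_id_expOm,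
    ← map_expOm α β (TensorProduct.map LinearMap.id (TensorProduct.map LinearMap.id
        (reassoc B C D))) _ (P := inl P) (Q := inr (inl δ)) (map_id_inl _ _)
      (map_id_inr (map_id_inl _ _)),
    ← map_expOm α β (TensorProduct.map LinearMap.id (reassoc A (B ⊗[ℂ] C) D)) _
      (P := inr (inl P)) (Q := inr (inr (inl (inr R))))
      (map_id_inr (reassoc_inl _)) (map_id_inr (reassoc_inr_inl _)),
    ← map_expOm α β (swapMid A E ((B ⊗[ℂ] C) ⊗[ℂ] D)) _ (P := inl P)
      (Q := inr (inr (inl (inr R)))) (swapMid_inl _) (swapMid_inr_inr _),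
    ← map_expOm α β (TensorProduct.map LinearMap.id (TensorProduct.map LinearMap.id
        (reassoc B C D))) _ (P := inl P) (Q := inr (inr (inr (inl R))))
      (map_id_inl _ _) (map_id_inr (map_id_inr (reassoc_inr_inl _))),
    ← map_expOm α β (TensorProduct.map LinearMap.id (reassoc A B (C ⊗[ℂ] D))) _
      (P := inl L) (Q := inr (inr (inr (inl R)))) (map_id_inl _ _)
      (map_id_inr (reassoc_inr_inr _)),
    ← map_expOm α β (swapMid A E (B ⊗[ℂ] (C ⊗[ℂ] D))) _ (P := inr (inl L))
      (Q := inr (inr (inr (inl R)))) (swapMid_inr_inl _) (swapMid_inr_inr _),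
    map_id_pentagon_reassoc, ← swapMid_map, hd.expOm_exchange (-1) _ (inl P) (inr (inl δ)),
    expOm_comm _ _ (inl P) (inr (inr (inr (inl R)))) (inr (inl L)),
    expOm_cancel _ _ _ _ (by ring)]

/-- With three twisted objects, the relation between `F`, `L` and `δ` turns the exponent `iπ` of one
associator into the exponent `-1` of the other. -/
theorem pentagon_0111 (L δ : h →ₗ[ℂ] Module.End ℂ E)
    [OddOp δ] {F : E →ₗ[ℂ] E}
    (hFL : ∀ a u, F (L a u) = ((-(Real.pi * Complex.I))⁻¹ • δ) a (F u))
    (P : h →ₗ[ℂ] Module.End ℂ A) [OddOp P] [Anti P P]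
    (t : A ⊗[ℂ] (B ⊗[ℂ] (E ⊗[ℂ] (C ⊗[ℂ] D)))) :
    assoc111 F (assoc010 α β P (inl L) t) =
      TensorProduct.map (assoc011 α β δ P) LinearMap.id (reassoc A (E ⊗[ℂ] (B ⊗[ℂ] C)) D
        (TensorProduct.map LinearMap.id (assoc111 F) t)) := by
  simp only [assoc111, assoc011, assoc010, LinearMap.comp_apply, map_comp_id, map_id_comp]
  rw [map_expOm_id, ← map_expOm α β (reassoc A (E ⊗[ℂ] (B ⊗[ℂ] C)) D) _ (P := inl P)
      (Q := inr (inl (inl δ))) (reassoc_inl _) (reassoc_inr_inl _),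
    ← map_expOm α β (TensorProduct.map LinearMap.id (reassoc E (B ⊗[ℂ] C) D)) _ (P := inl P)
      (Q := inr (inl δ)) (map_id_inl _ _) (map_id_inr (reassoc_inl _)),
    ← map_expOm α β (TensorProduct.map LinearMap.id (TensorProduct.map LinearMap.id
      (reassoc B C D))) _ (P := inl P)
      (Q := inr (inl δ)) (map_id_inl _ _) (map_id_inr (map_id_inl _ _)),
    ← map_expOm α β (TensorProduct.map LinearMap.id (swapMid B E (C ⊗[ℂ] D))) _ (P := inl P)
      (Q := inr (inr (inl δ))) (map_id_inl _ _) (map_id_inr (swapMid_inr_inl _)),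
    ← reassoc_map_right,
    map_expOm α β (TensorProduct.map LinearMap.id (TensorProduct.map LinearMap.id
      (TensorProduct.map F LinearMap.id))) _ (P := inl P) (Q := inr (inr (inl L)))
      (map_id_inl _ _) (map_id_inr (map_id_inr (map_inl_id hFL))), inl_smul, inr_smul, inr_smul,
    expOm_smul_right, I_mul_pi_mul_inv, swapMid_tensor, map_id_pentagon_reassoc, reassoc_map_mid,
    ← swapMid_map, reassoc_swapMid]

theorem IsDualPair.pentagon_1011 (hd : IsDualPair ω α β) (L δ : h →ₗ[ℂ] Module.End ℂ E)
    [OddOp L] [Anti L L] {F : E →ₗ[ℂ] E} (hF : ∀ u, F (par u) = par (F u))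
    (hFL : ∀ a u, F (δ a u) = ((Real.pi * Complex.I) • L) a (F u))
    (Q : h →ₗ[ℂ] Module.End ℂ B) [OddOp Q] [Anti Q Q]
    (t : A ⊗[ℂ] (B ⊗[ℂ] (E ⊗[ℂ] (C ⊗[ℂ] D)))) :
    assoc111 F (reassoc A B (E ⊗[ℂ] (C ⊗[ℂ] D)) t) =
      TensorProduct.map (assoc101 α β L Q) LinearMap.id (assoc111 F
        (TensorProduct.map LinearMap.id (assoc011 α β δ Q) t)) := by
  simp only [assoc111, assoc011, assoc101, LinearMap.comp_apply, map_comp_id, map_id_comp]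
  rw [map_expOm_id, map_id_expOm,
    ← map_expOm α β (reassoc E (A ⊗[ℂ] (B ⊗[ℂ] C)) D) _
      (P := inl L) (Q := inr (inl (inr (inl Q)))) (reassoc_inl _) (reassoc_inr_inl _),
    ← map_expOm α β (TensorProduct.map LinearMap.id (reassoc A (B ⊗[ℂ] C) D)) _
      (P := inl L) (Q := inr (inr (inl (inl Q))))
      (map_id_inl _ _) (map_id_inr fun a v => by rw [reassoc_inr_inl]),
    ← map_expOm α β (swapMid A E ((B ⊗[ℂ] C) ⊗[ℂ] D)) _ (P := inr (inl L))
      (Q := inr (inr (inl (inl Q)))) (swapMid_inr_inl _) (swapMid_inr_inr _),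
    map_id_map_left_map_right, map_id_map_left_swapMid hF,
    ← map_expOm α β (TensorProduct.map LinearMap.id (TensorProduct.map LinearMap.id
      (reassoc B C D))) _ (P := inr (inl L)) (Q := inr (inr (inl Q)))
      (map_id_inr (map_id_inl _ _)) (map_id_inr (map_id_inr (reassoc_inl _))),
    ← map_expOm α β (TensorProduct.map LinearMap.id (swapMid B E (C ⊗[ℂ] D))) _
      (P := inr (inr (inl L))) (Q := inr (inl Q))
      (map_id_inr (swapMid_inr_inl _)) (map_id_inr (swapMid_inl _)),
    map_expOm α β (TensorProduct.map LinearMap.id (TensorProduct.map LinearMap.id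
      (TensorProduct.map F LinearMap.id))) _ (P := inr (inl Q)) (Q := inr (inr (inl δ)))
      (map_id_inr (map_id_inl _ _)) (map_id_inr (map_id_inr (map_inl_id hFL))), inl_smul,
    inr_smul, inr_smul, expOm_smul_right, hd.expOm_symm _ (inr (inl Q)),
    expOm_cancel _ _ _ _ (by ring), ← reassoc_map_right, swapMid_tensor, map_id_pentagon_reassoc,
    reassoc_map_mid, ← swapMid_map, reassoc_swapMid]

theorem IsDualPair.pentagon_1101 (hd : IsDualPair ω α β) [Parity C] (L δ : h →ₗ[ℂ] Module.End ℂ E)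
    [OddOp δ] [Anti δ δ] {F : E →ₗ[ℂ] E} (hF : ∀ u, F (par u) = par (F u))
    (hFL : ∀ a u, F (L a u) = ((-(Real.pi * Complex.I))⁻¹ • δ) a (F u))
    (R : h →ₗ[ℂ] Module.End ℂ C) [OddOp R] [Anti R R]
    (t : A ⊗[ℂ] (E ⊗[ℂ] (B ⊗[ℂ] (C ⊗[ℂ] D)))) :
    reassoc (E ⊗[ℂ] (A ⊗[ℂ] B)) C D (assoc111 F t) =
      TensorProduct.map (assoc110 α β δ R) LinearMap.id (assoc111 F
        (TensorProduct.map LinearMap.id (assoc101 α β L R) t)) := by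
  simp only [assoc111, assoc110, assoc101, LinearMap.comp_apply, map_comp_id, map_id_comp]
  rw [map_expOm_id, map_id_expOm,
    ← map_expOm α β (reassoc E (A ⊗[ℂ] (B ⊗[ℂ] C)) D) _
      (P := inr (inl (inr (inr R)))) (Q := inl δ) (reassoc_inr_inl _) (reassoc_inl _),
    ← map_expOm α β (TensorProduct.map LinearMap.id (reassoc A (B ⊗[ℂ] C) D)) _
      (P := inr (inr (inl (inr R)))) (Q := inl δ)
      (map_id_inr (reassoc_inr_inl _)) (map_id_inl _ _),
    ← map_expOm α β (swapMid A E ((B ⊗[ℂ] C) ⊗[ℂ] D)) _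
      (P := inr (inr (inl (inr R)))) (Q := inr (inl δ)) (swapMid_inr_inr _) (swapMid_inr_inl _),
    map_id_map_left_map_right,
    ← map_expOm α β (TensorProduct.map LinearMap.id (TensorProduct.map LinearMap.id
      (reassoc B C D))) _ (P := inr (inr (inr (inl R)))) (Q := inr (inl δ))
      (map_id_inr (map_id_inr (reassoc_inr_inl _))) (map_id_inr (map_id_inl _ _)),
    map_expOm α β (TensorProduct.map LinearMap.id (TensorProduct.map F LinearMap.id)) _
      (P := inr (inl L)) (Q := inr (inr (inr (inl R))))
      (map_id_inr (map_inl_id hFL)) (map_id_inr (map_inr_id hF _)), inl_smul,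
    inr_smul, expOm_smul_left, I_mul_pi_mul_inv, hd.expOm_symm _ (inr (inl δ)),
    expOm_cancel _ _ _ _ (by ring), swapMid_map, ← reassoc_map_id_pentagon_reassoc]

theorem IsDualPair.pentagon_1110 (hd : IsDualPair ω α β) [Parity C] (L δ : h →ₗ[ℂ] Module.End ℂ E)
    [OddOp L] {F : E →ₗ[ℂ] E} (hF : ∀ u, F (par u) = par (F u))
    (hFL : ∀ a u, F (δ a u) = ((Real.pi * Complex.I) • L) a (F u))
    (S : h →ₗ[ℂ] Module.End ℂ D) [Anti S S]
    (t : A ⊗[ℂ] (E ⊗[ℂ] (B ⊗[ℂ] (C ⊗[ℂ] D)))) :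
    assoc010 α β (inl L) S (assoc111 F t) =
      TensorProduct.map (assoc111 F) LinearMap.id (reassoc A (E ⊗[ℂ] (B ⊗[ℂ] C)) D
        (TensorProduct.map LinearMap.id (assoc110 α β δ S) t)) := by
  simp only [assoc111, assoc110, assoc010, LinearMap.comp_apply, map_comp_id, map_id_comp]
  have key (v : A ⊗[ℂ] (E ⊗[ℂ] (B ⊗[ℂ] (C ⊗[ℂ] D)))) :
      TensorProduct.map LinearMap.id
          (TensorProduct.map (TensorProduct.map F LinearMap.id) LinearMap.id)
          (TensorProduct.map LinearMap.id (reassoc E (B ⊗[ℂ] C) D)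
            (TensorProduct.map LinearMap.id
              (TensorProduct.map LinearMap.id (reassoc B C D)) v)) =
        TensorProduct.map LinearMap.id (reassoc E (B ⊗[ℂ] C) D)
          (TensorProduct.map LinearMap.id (TensorProduct.map LinearMap.id (reassoc B C D))
            (TensorProduct.map LinearMap.id (TensorProduct.map F LinearMap.id) v)) := by
    simp only [← LinearMap.comp_apply, ← map_id_comp]
    refine map_id_congr (fun w => ?_) v
    simp only [LinearMap.comp_apply]
    rw [← reassoc_map_left, map_left_map_right]
  rw [map_id_expOm, ← reassoc_map_mid, key,
    map_expOm α β (TensorProduct.map LinearMap.id (TensorProduct.map F LinearMap.id)) _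
      (P := inr (inr (inr (inr S)))) (Q := inr (inl δ))
      (map_id_inr (map_inr_id hF _)) (map_id_inr (map_inl_id hFL)), inl_smul,
    inr_smul, expOm_smul_right,
    ← map_expOm α β (reassoc E (A ⊗[ℂ] B) (C ⊗[ℂ] D)) _ (P := inl L) (Q := inr (inr (inr S)))
      (reassoc_inl _) (reassoc_inr_inr _),
    ← map_expOm α β (TensorProduct.map LinearMap.id (reassoc A B (C ⊗[ℂ] D))) _
      (P := inl L) (Q := inr (inr (inr (inr S)))) (map_id_inl _ _)
      (map_id_inr (reassoc_inr_inr _)),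
    ← map_expOm α β (swapMid A E (B ⊗[ℂ] (C ⊗[ℂ] D))) _ (P := inr (inl L))
      (Q := inr (inr (inr (inr S)))) (swapMid_inr_inl _) (swapMid_inr_inr _),
    pentagon_reassoc, map_id_pentagon_reassoc, reassoc_map_mid, ← swapMid_map, reassoc_swapMid,
    hd.expOm_symm _ (inr (inl L)), one_mul, mul_comm Complex.I]

set_option maxHeartbeats 800000 in
/-- The pentagon of four twisted objects. Moving `F` through all the exponentials leaves `F ∘ F`, which
is the parity, and the hypothesis `hE` on the exchange of two copies of `E` absorbs it. -/
theorem pentagon_1111 (L δ : h →ₗ[ℂ] Module.End ℂ E)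
    [OddOp L] [OddOp δ] {F : E →ₗ[ℂ] E} (hF : ∀ u, F (par u) = par (F u))
    (hFL : ∀ a u, F (L a u) = ((-(Real.pi * Complex.I))⁻¹ • δ) a (F u))
    (hFF : ∀ u, F (F u) = par u)
    (hE : ∀ t : E ⊗[ℂ] (E ⊗[ℂ] (A ⊗[ℂ] (B ⊗[ℂ] (C ⊗[ℂ] D)))),
      swapMid E E (A ⊗[ℂ] (B ⊗[ℂ] (C ⊗[ℂ] D))) (expOm α β (-1) (inl L) (inr (inl δ))
        (expOm α β 1 (inr (inl L)) (inl δ) t)) =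
      expOm α β (-1) (inl L) (inr (inl δ))
        (TensorProduct.map LinearMap.id (TensorProduct.map par LinearMap.id) t))
    (t : E ⊗[ℂ] (A ⊗[ℂ] (B ⊗[ℂ] (E ⊗[ℂ] (C ⊗[ℂ] D))))) :
    assoc011 α β δ (inl L) (assoc110 α β δ (inl L) t) =
      TensorProduct.map LinearMap.id (TensorProduct.map (assoc111 F) LinearMap.id)
        (assoc101 α β L (inl L) (TensorProduct.map LinearMap.id
          (TensorProduct.map LinearMap.id (assoc111 F)) t)) := by
  simp only [assoc111, assoc110, assoc101, assoc011, LinearMap.comp_apply, map_comp_id, map_id_comp]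
  rw [← map_expOm α β (TensorProduct.map LinearMap.id (TensorProduct.map LinearMap.id
        (reassoc E (B ⊗[ℂ] C) D))) _ (P := inl L) (Q := inr (inr (inl L)))
      (map_id_inl _ _) (map_id_inr (map_id_inr (reassoc_inl _))),
    ← map_expOm α β (TensorProduct.map LinearMap.id (TensorProduct.map LinearMap.id
        (TensorProduct.map LinearMap.id (reassoc B C D)))) _ (P := inl L)
      (Q := inr (inr (inl L))) (map_id_inl _ _) (map_id_inr (map_id_inr (map_id_inl _ _))),
    ← map_expOm α β (TensorProduct.map LinearMap.id (TensorProduct.map LinearMap.id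
        (swapMid B E (C ⊗[ℂ] D)))) _ (P := inl L)
      (Q := inr (inr (inr (inl L)))) (map_id_inl _ _)
      (map_id_inr (map_id_inr (swapMid_inr_inl _))),
    map_id_map_left_reassoc hF,
    map_expOm α β (TensorProduct.map LinearMap.id (TensorProduct.map LinearMap.id
      (TensorProduct.map LinearMap.id (TensorProduct.map F LinearMap.id)))) _
      (P := inl L) (Q := inr (inr (inr (inl L)))) (map_id_inl _ _)
      (map_id_inr (map_id_inr (map_id_inr (map_inl_id hFL)))), inl_smul, inr_smul, inr_smul,
    inr_smul, expOm_smul_right, I_mul_pi_mul_inv, map_id_map_map_self hFF,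
    map_id_reassoc_swapMid_swapMid,
    ← map_expOm α β (reassoc E (A ⊗[ℂ] B) (E ⊗[ℂ] (C ⊗[ℂ] D))) _ (P := inl L)
      (Q := inr (inr (inl δ))) (reassoc_inl _) (reassoc_inr_inr _),
    ← map_expOm α β (TensorProduct.map LinearMap.id (reassoc A B (E ⊗[ℂ] (C ⊗[ℂ] D)))) _
      (P := inl L) (Q := inr (inr (inr (inl δ)))) (map_id_inl _ _)
      (map_id_inr (reassoc_inr_inr _)),
    swapMid_tensor, map_id_swapMid_tensor, swapMid_map]
  rw [map_expOm α β (TensorProduct.map LinearMap.id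
        (TensorProduct.map LinearMap.id (swapMid B E (C ⊗[ℂ] D)))) _ (P := inl L)
      (Q := inr (inr (inr (inl δ)))) (map_id_inl _ _)
      (map_id_inr (map_id_inr (swapMid_inr_inl _))),
    map_expOm α β (TensorProduct.map LinearMap.id
        (TensorProduct.map LinearMap.id (swapMid B E (C ⊗[ℂ] D)))) _ (Q := inl δ)
      (P := inr (inr (inr (inl L))))
      (map_id_inr (map_id_inr (swapMid_inr_inl _))) (map_id_inl _ _),
    map_expOm α β (TensorProduct.map LinearMap.id (swapMid A E (B ⊗[ℂ] (C ⊗[ℂ] D)))) _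
      (P := inl L) (Q := inr (inr (inl δ))) (map_id_inl _ _)
      (map_id_inr (swapMid_inr_inl _)),
    map_expOm α β (TensorProduct.map LinearMap.id (swapMid A E (B ⊗[ℂ] (C ⊗[ℂ] D)))) _
      (Q := inl δ) (P := inr (inr (inl L)))
      (map_id_inr (swapMid_inr_inl _)) (map_id_inl _ _), hE,
    map_expOm α β (TensorProduct.map LinearMap.id
        (TensorProduct.map LinearMap.id (swapMid B E (C ⊗[ℂ] D)))) _ (P := inl L)
      (Q := inr (inr (inr (inl δ)))) (map_id_inl _ _)
      (map_id_inr (map_id_inr (swapMid_inr_inl _))),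
    map_expOm α β (TensorProduct.map LinearMap.id (swapMid A E (B ⊗[ℂ] (C ⊗[ℂ] D)))) _
      (P := inl L) (Q := inr (inr (inl δ))) (map_id_inl _ _)
      (map_id_inr (swapMid_inr_inl _)), map_id_swapMid_swapMid_par]

end Pentagon

/-! ### Exchanging two copies of the enveloping algebra -/

section Exchange

variable {h : Type u} [AddCommGroup h] [Module ℂ h] {ω : LinearMap.BilinForm ℂ h}
  {ι : Type*} [Fintype ι] {α β : ι → h} {Y : Type u} [AddCommGroup Y] [Module ℂ Y]

theorem swapMid_one_tmul_one_tmul (y : Y) :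
    swapMid (U h) (U h) Y (1 ⊗ₜ (1 ⊗ₜ y)) = 1 ⊗ₜ (1 ⊗ₜ y) := by
  rw [swapMid_tmul]
  simp only [par_one]
  module

/-- An operator anticommuting with both legs commutes with the exponential. -/
theorem expOm_apply_of_anti {V : Type*} [AddCommGroup V] [Module ℂ V] (c : ℂ)
    (P Q L : h →ₗ[ℂ] Module.End ℂ V) [Anti L P] [Anti L Q] (a : h) (v : V) :
    expOm α β c P Q (L a v) = L a (expOm α β c P Q v) :=
  (map_expOm_of_anti α β (L a) c (fun b v => Anti.apply_comm a b v)
    (fun b v => Anti.apply_comm a b v) v).symm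

theorem IsDualPair.swapMid_expOm_one_tmul (hd : IsDualPair ω α β) (m : U h ⊗[ℂ] Y) :
    swapMid (U h) (U h) Y (expOm α β (-1) (inl (LU h)) (inr (inl (DU ω))) (1 ⊗ₜ m)) =
      expOm α β (-1) (inl (LU h)) (inr (inl (DU ω)))
        (1 ⊗ₜ TensorProduct.map par LinearMap.id m) := by
  have hL (a : h) (v : U h ⊗[ℂ] (U h ⊗[ℂ] Y)) :=
    hd.expOm_apply_left (-1) (inl (W := U h ⊗[ℂ] Y) (LU h)) (inr (inl (DU ω)))
      (inr (inl (LU h))) a v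
  have h1 (a : h) (m : U h ⊗[ℂ] Y) :
      (1 : U h) ⊗ₜ[ℂ] inl (LU h) a m = inr (inl (LU h)) a (1 ⊗ₜ m) := by
    rw [inr_tmul, par_one]
  refine U_tensor_hom_ext (N := U h ⊗[ℂ] (U h ⊗[ℂ] Y)) (F := swapMid (U h) (U h) Y ∘ₗ
      expOm α β (-1) (inl (LU h)) (inr (inl (DU ω))) ∘ₗ TensorProduct.mk ℂ (U h) (U h ⊗[ℂ] Y) 1)
    (G := expOm α β (-1) (inl (LU h)) (inr (inl (DU ω))) ∘ₗ
      TensorProduct.mk ℂ (U h) (U h ⊗[ℂ] Y) 1 ∘ₗ TensorProduct.map par LinearMap.id)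
    (inl (LU h) + (-1 : ℂ) • inr (inl (LU h))) (fun y => ?_) (fun a m => ?_) (fun a m => ?_) m
  · have hz (a : h) : inr (V := U h) (inl (W := Y) (DU ω)) a (1 ⊗ₜ (1 ⊗ₜ y)) = 0 := by
      rw [inr_tmul, inl_tmul, DU_one, TensorProduct.zero_tmul, TensorProduct.tmul_zero]
    simp only [LinearMap.comp_apply, TensorProduct.mk_apply, TensorProduct.map_tmul, par_one,
      LinearMap.id_apply]
    rw [expOm_apply_of_eq_zero _ _ _ _ _ hz, swapMid_one_tmul_one_tmul]
  · simp only [LinearMap.comp_apply, TensorProduct.mk_apply]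
    rw [h1, hL, map_add, map_smul, swapMid_inr_inl, swapMid_inl]
    rfl
  · simp only [LinearMap.comp_apply, TensorProduct.mk_apply]
    have h2 : TensorProduct.map par LinearMap.id (inl (LU h) a m) =
        -inl (LU h) a (TensorProduct.map par LinearMap.id m) := by
      have := map_inl_id (X := Y) (F := par (V := U h)) (P := LU h) (P' := (-1 : ℂ) • LU h)
        (fun a v => by
          rw [LinearMap.smul_apply, LinearMap.smul_apply, neg_one_smul]
          exact par_ι_mul a v) a m
      rw [this, inl_smul, LinearMap.smul_apply, LinearMap.smul_apply, neg_one_smul]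
    rw [h2, TensorProduct.tmul_neg, h1, map_neg, hL]
    simp only [LinearMap.add_apply, LinearMap.smul_apply]
    module

/-- On `U(h) ⊗ U(h)` the exponentials compose to the exchange of the two factors, like
`(x, y) ↦ (y, x)` composed of shears: this is what makes the pentagon of four twisted objects hold. -/
theorem IsDualPair.swapMid_expOm_expOm (hd : IsDualPair ω α β) (t : U h ⊗[ℂ] (U h ⊗[ℂ] Y)) :
    swapMid (U h) (U h) Y (expOm α β (-1) (inl (LU h)) (inr (inl (DU ω)))
      (expOm α β 1 (inr (inl (LU h))) (inl (DU ω)) t)) =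
    expOm α β (-1) (inl (LU h)) (inr (inl (DU ω)))
      (TensorProduct.map LinearMap.id (TensorProduct.map par LinearMap.id) t) := by
  refine U_tensor_hom_ext (N := U h ⊗[ℂ] (U h ⊗[ℂ] Y)) (F := swapMid (U h) (U h) Y ∘ₗ
      expOm α β (-1) (inl (LU h)) (inr (inl (DU ω))) ∘ₗ
      expOm α β 1 (inr (inl (LU h))) (inl (DU ω)))
    (G := expOm α β (-1) (inl (LU h)) (inr (inl (DU ω))) ∘ₗ
      TensorProduct.map LinearMap.id (TensorProduct.map par LinearMap.id))
    (inl (LU h)) (fun m => ?_) (fun a t => ?_) (fun a t => ?_) t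
  · have hz (a : h) : inl (W := U h ⊗[ℂ] Y) (DU ω) a (1 ⊗ₜ m) = 0 := by
      rw [inl_tmul, DU_one, TensorProduct.zero_tmul]
    simp only [LinearMap.comp_apply, TensorProduct.map_tmul, LinearMap.id_apply]
    rw [expOm_apply_of_eq_zero _ _ _ _ _ hz, hd.swapMid_expOm_one_tmul]
  · simp only [LinearMap.comp_apply]
    rw [hd.expOm_apply_left 1 (inr (inl (LU h))) (inl (DU ω)) (inl (LU h)), map_add, map_smul,
      expOm_apply_of_anti,
      hd.expOm_apply_left (-1) (inl (LU h)) (inr (inl (DU ω))) (inr (inl (LU h))),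
      ← swapMid_inr_inl]
    congr 1
    module
  · simp only [LinearMap.comp_apply]
    rw [map_id_inl, expOm_apply_of_anti]

end Exchange

/-! ### Parity, naturality and invertibility of the associators -/

section Properties

variable {h : Type u} [AddCommGroup h] [Module ℂ h]
variable {A B C A' B' C' E X Y : Type u} [AddCommGroup A] [Module ℂ A] [AddCommGroup B]
  [Module ℂ B] [AddCommGroup C] [Module ℂ C] [AddCommGroup A'] [Module ℂ A'] [AddCommGroup B']
  [Module ℂ B'] [AddCommGroup C'] [Module ℂ C'] [AddCommGroup E] [Module ℂ E] [AddCommGroup X]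
  [Module ℂ X] [AddCommGroup Y] [Module ℂ Y]

theorem map_inl_apply {F : A →ₗ[ℂ] A'} (G : B →ₗ[ℂ] B') {P : h →ₗ[ℂ] Module.End ℂ A}
    {P' : h →ₗ[ℂ] Module.End ℂ A'} (hF : ∀ a v, F (P a v) = P' a (F v)) (a : h) (t : A ⊗[ℂ] B) :
    TensorProduct.map F G (inl P a t) = inl P' a (TensorProduct.map F G t) :=
  LinearMap.congr_fun (f := TensorProduct.map F G ∘ₗ inl P a)
    (g := inl P' a ∘ₗ TensorProduct.map F G) (TensorProduct.ext' fun x v => by simp [hF]) t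

theorem map_inr_apply [Parity A] [Parity A'] {F : A →ₗ[ℂ] A'} {G : B →ₗ[ℂ] B'}
    (hp : ∀ v, F (par v) = par (F v)) {Q : h →ₗ[ℂ] Module.End ℂ B}
    {Q' : h →ₗ[ℂ] Module.End ℂ B'} (hG : ∀ a v, G (Q a v) = Q' a (G v)) (a : h) (t : A ⊗[ℂ] B) :
    TensorProduct.map F G (inr Q a t) = inr Q' a (TensorProduct.map F G t) :=
  LinearMap.congr_fun (f := TensorProduct.map F G ∘ₗ inr Q a)
    (g := inr Q' a ∘ₗ TensorProduct.map F G) (TensorProduct.ext' fun x v => by simp [hp, hG]) t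

theorem map_par [Parity A] [Parity A'] [Parity B] [Parity B'] {F : A →ₗ[ℂ] A'} {G : B →ₗ[ℂ] B'}
    (hF : ∀ v, F (par v) = par (F v)) (hG : ∀ v, G (par v) = par (G v)) (t : A ⊗[ℂ] B) :
    TensorProduct.map F G (par t) = par (TensorProduct.map F G t) :=
  LinearMap.congr_fun (f := TensorProduct.map F G ∘ₗ par)
    (g := par ∘ₗ TensorProduct.map F G) (TensorProduct.ext' fun x v => by simp [hF, hG]) t

theorem reassoc_map (f : A →ₗ[ℂ] A') (g : B →ₗ[ℂ] B') (k : C →ₗ[ℂ] C')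
    (t : A ⊗[ℂ] (B ⊗[ℂ] C)) :
    reassoc A' B' C' (TensorProduct.map f (TensorProduct.map g k) t) =
      TensorProduct.map (TensorProduct.map f g) k (reassoc A B C t) :=
  tensor_ext₃ (N := (A' ⊗[ℂ] B') ⊗[ℂ] C')
    (F := reassoc A' B' C' ∘ₗ TensorProduct.map f (TensorProduct.map g k))
    (G := TensorProduct.map (TensorProduct.map f g) k ∘ₗ reassoc A B C) (fun _ _ _ => by rfl) t

theorem reassoc_par [Parity A] [Parity B] [Parity C] (t : A ⊗[ℂ] (B ⊗[ℂ] C)) :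
    reassoc A B C (par t) = par (reassoc A B C t) :=
  reassoc_map par par par t

theorem swapMid_natural [Parity A] [Parity A'] [Parity E] {f : A →ₗ[ℂ] A'} (g : X →ₗ[ℂ] Y)
    (hf : ∀ v, f (par v) = par (f v)) (t : A ⊗[ℂ] (E ⊗[ℂ] X)) :
    swapMid A' E Y (TensorProduct.map f (TensorProduct.map LinearMap.id g) t) =
      TensorProduct.map LinearMap.id (TensorProduct.map f g) (swapMid A E X t) := by
  refine tensor_ext₃ (N := E ⊗[ℂ] (A' ⊗[ℂ] Y)) (F := swapMid A' E Y ∘ₗ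
      TensorProduct.map f (TensorProduct.map LinearMap.id g))
    (G := TensorProduct.map LinearMap.id (TensorProduct.map f g) ∘ₗ swapMid A E X)
    (fun x u y => ?_) t
  simp only [LinearMap.comp_apply, swapMid_tmul, TensorProduct.map_tmul, LinearMap.id_apply,
    map_smul, map_add, map_sub, hf]

theorem swapMid_par [Parity A] [Parity E] [Parity X] (t : A ⊗[ℂ] (E ⊗[ℂ] X)) :
    swapMid A E X (par t) = par (swapMid A E X t) := by
  refine tensor_ext₃ (N := E ⊗[ℂ] (A ⊗[ℂ] X)) (F := swapMid A E X ∘ₗ par)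
    (G := par ∘ₗ swapMid A E X) (fun x u y => ?_) t
  simp only [LinearMap.comp_apply, swapMid_tmul, par_tmul, map_smul, map_add, map_sub]

theorem swapMid_bijective [Parity A] [Parity E] : Function.Bijective (swapMid A E X) := by
  have h1 : Function.Bijective (swap A E) :=
    ⟨Function.LeftInverse.injective (g := swap E A) swap_swap,
      Function.RightInverse.surjective (g := swap E A) swap_swap⟩
  have h2 : Function.Bijective (TensorProduct.map (swap A E) (LinearMap.id : X →ₗ[ℂ] X)) :=
    (LinearEquiv.rTensor X (LinearEquiv.ofBijective _ h1)).bijective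
  have h3 : Function.Bijective (reassoc A E X) := (TensorProduct.assoc ℂ A E X).symm.bijective
  have h4 : Function.Bijective (unassoc E A X) := (TensorProduct.assoc ℂ E A X).bijective
  exact h4.comp (h2.comp h3)

theorem map_id_bijective {F : A →ₗ[ℂ] B} (hF : Function.Bijective F) :
    Function.Bijective (TensorProduct.map (LinearMap.id : X →ₗ[ℂ] X) F) :=
  (LinearEquiv.lTensor X (LinearEquiv.ofBijective _ hF)).bijective

theorem map_bijective_id {F : A →ₗ[ℂ] B} (hF : Function.Bijective F) :
    Function.Bijective (TensorProduct.map F (LinearMap.id : X →ₗ[ℂ] X)) :=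
  (LinearEquiv.rTensor X (LinearEquiv.ofBijective _ hF)).bijective

theorem reassoc_bijective : Function.Bijective (reassoc A B C) :=
  (TensorProduct.assoc ℂ A B C).symm.bijective

variable {ι : Type*} [Fintype ι] {α β : ι → h}

theorem expOm_par {V : Type*} [AddCommGroup V] [Module ℂ V] [Parity V] (c : ℂ)
    (P Q : h →ₗ[ℂ] Module.End ℂ V) [OddOp P] [OddOp Q] (v : V) :
    expOm α β c P Q (par v) = par (expOm α β c P Q v) :=
  (map_expOm_of_anti α β par c (fun a v => by rw [OddOp.apply_par, neg_neg])
    (fun a v => by rw [OddOp.apply_par, neg_neg]) v).symm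

theorem expOm_bijective {V : Type*} [AddCommGroup V] [Module ℂ V] (c : ℂ)
    (P Q : h →ₗ[ℂ] Module.End ℂ V) [Anti P P] [Anti P Q] [Anti Q P] [Anti Q Q] :
    Function.Bijective (expOm α β c P Q) :=
  ⟨Function.LeftInverse.injective (expOm_cancel α β (-c) c (neg_add_cancel c) P Q),
    Function.RightInverse.surjective (expOm_cancel α β c (-c) (add_neg_cancel c) P Q)⟩

section Par

variable [Parity A] [Parity B] [Parity C]

theorem assoc010_par (P : h →ₗ[ℂ] Module.End ℂ A) (R : h →ₗ[ℂ] Module.End ℂ C) [OddOp P]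
    [OddOp R] (t : A ⊗[ℂ] (B ⊗[ℂ] C)) :
    assoc010 α β P R (par t) = par (assoc010 α β P R t) := by
  rw [assoc010, LinearMap.comp_apply, expOm_par, reassoc_par, LinearMap.comp_apply]

theorem map_id_reassoc_par [Parity E] (t : E ⊗[ℂ] (A ⊗[ℂ] (B ⊗[ℂ] C))) :
    TensorProduct.map LinearMap.id (reassoc A B C) (par t) =
      par (TensorProduct.map LinearMap.id (reassoc A B C) t) :=
  map_par (F := LinearMap.id) (fun _ => rfl) reassoc_par t

theorem assoc101_par [Parity E] (L : h →ₗ[ℂ] Module.End ℂ E) (Q : h →ₗ[ℂ] Module.End ℂ B) [OddOp L]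
    [OddOp Q] (t : E ⊗[ℂ] (A ⊗[ℂ] (B ⊗[ℂ] C))) :
    assoc101 α β L Q (par t) = par (assoc101 α β L Q t) := by
  rw [assoc101, LinearMap.comp_apply, expOm_par, map_id_reassoc_par, LinearMap.comp_apply]

theorem assoc011_par [Parity E] (δ : h →ₗ[ℂ] Module.End ℂ E) (P : h →ₗ[ℂ] Module.End ℂ A) [OddOp δ]
    [OddOp P] (t : A ⊗[ℂ] (E ⊗[ℂ] (B ⊗[ℂ] C))) :
    assoc011 α β δ P (par t) = par (assoc011 α β δ P t) := by
  simp only [assoc011, LinearMap.comp_apply]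
  rw [expOm_par, swapMid_par, map_id_reassoc_par]

theorem assoc110_par [Parity E] (δ : h →ₗ[ℂ] Module.End ℂ E) (R : h →ₗ[ℂ] Module.End ℂ C) [OddOp δ]
    [OddOp R] (t : E ⊗[ℂ] (A ⊗[ℂ] (B ⊗[ℂ] C))) :
    assoc110 α β δ R (par t) = par (assoc110 α β δ R t) := by
  simp only [assoc110, LinearMap.comp_apply]
  rw [expOm_par, map_id_reassoc_par, reassoc_par]

theorem assoc111_par [Parity E] {F : E →ₗ[ℂ] E} (hF : ∀ u, F (par u) = par (F u))
    (t : A ⊗[ℂ] (E ⊗[ℂ] (B ⊗[ℂ] C))) :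
    assoc111 F (par t) = par (assoc111 F t) := by
  simp only [assoc111, LinearMap.comp_apply]
  rw [map_par (F := LinearMap.id) (fun _ => rfl)
      (map_par (G := LinearMap.id) hF fun _ => rfl), swapMid_par, map_id_reassoc_par,
    reassoc_par]

end Par

section Natural

variable {f : A →ₗ[ℂ] A'} {g : B →ₗ[ℂ] B'} {k : C →ₗ[ℂ] C'}

theorem map_id_reassoc_natural (t : E ⊗[ℂ] (A ⊗[ℂ] (B ⊗[ℂ] C))) :
    TensorProduct.map LinearMap.id (reassoc A' B' C')
        (TensorProduct.map LinearMap.id (TensorProduct.map f (TensorProduct.map g k)) t) =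
      TensorProduct.map LinearMap.id (TensorProduct.map (TensorProduct.map f g) k)
        (TensorProduct.map LinearMap.id (reassoc A B C) t) := by
  simp only [← LinearMap.comp_apply, ← map_id_comp]
  exact map_id_congr (reassoc_map f g k) t

theorem assoc010_natural [Parity A] [Parity A'] [Parity B] [Parity B']
    {P : h →ₗ[ℂ] Module.End ℂ A} {R : h →ₗ[ℂ] Module.End ℂ C}
    {P' : h →ₗ[ℂ] Module.End ℂ A'} {R' : h →ₗ[ℂ] Module.End ℂ C'}
    (hf : ∀ v, f (par v) = par (f v)) (hg : ∀ v, g (par v) = par (g v))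
    (hP : ∀ a v, f (P a v) = P' a (f v)) (hR : ∀ a v, k (R a v) = R' a (k v))
    (t : A ⊗[ℂ] (B ⊗[ℂ] C)) :
    assoc010 α β P' R' (TensorProduct.map f (TensorProduct.map g k) t) =
      TensorProduct.map (TensorProduct.map f g) k (assoc010 α β P R t) := by
  simp only [assoc010, LinearMap.comp_apply]
  rw [← map_expOm α β (TensorProduct.map f (TensorProduct.map g k)) _ (map_inl_apply _ hP)
    (map_inr_apply hf (map_inr_apply hg hR)), reassoc_map]

theorem assoc101_natural [Parity A] [Parity A'] [Parity E] (L : h →ₗ[ℂ] Module.End ℂ E)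
    {Q : h →ₗ[ℂ] Module.End ℂ B}
    {Q' : h →ₗ[ℂ] Module.End ℂ B'} (hf : ∀ v, f (par v) = par (f v))
    (hQ : ∀ a v, g (Q a v) = Q' a (g v)) (t : E ⊗[ℂ] (A ⊗[ℂ] (B ⊗[ℂ] C))) :
    assoc101 α β L Q'
        (TensorProduct.map LinearMap.id (TensorProduct.map f (TensorProduct.map g k)) t) =
      TensorProduct.map LinearMap.id (TensorProduct.map (TensorProduct.map f g) k)
        (assoc101 α β L Q t) := by
  simp only [assoc101, LinearMap.comp_apply]
  rw [← map_expOm α β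
      (TensorProduct.map LinearMap.id (TensorProduct.map f (TensorProduct.map g k))) _
      (P := inl L) (Q := inr (inr (inl Q))) (P' := inl L) (Q' := inr (inr (inl Q')))
      (map_id_inl _ _) (map_id_inr (map_inr_apply hf (map_inl_apply k hQ))),
    map_id_reassoc_natural]

theorem assoc011_natural [Parity A] [Parity A'] [Parity E] (δ : h →ₗ[ℂ] Module.End ℂ E)
    {P : h →ₗ[ℂ] Module.End ℂ A}
    {P' : h →ₗ[ℂ] Module.End ℂ A'} (hf : ∀ v, f (par v) = par (f v))
    (hP : ∀ a v, f (P a v) = P' a (f v)) (t : A ⊗[ℂ] (E ⊗[ℂ] (B ⊗[ℂ] C))) :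
    assoc011 α β δ P'
        (TensorProduct.map f (TensorProduct.map LinearMap.id (TensorProduct.map g k)) t) =
      TensorProduct.map LinearMap.id (TensorProduct.map (TensorProduct.map f g) k)
        (assoc011 α β δ P t) := by
  simp only [assoc011, LinearMap.comp_apply]
  rw [← map_expOm α β
      (TensorProduct.map f (TensorProduct.map LinearMap.id (TensorProduct.map g k))) _
      (map_inl_apply _ hP) (map_inr_apply hf (map_id_inl _ _)),
    swapMid_natural _ hf, map_id_reassoc_natural]

theorem assoc110_natural [Parity A] [Parity A'] [Parity B] [Parity B'] [Parity E]
    (δ : h →ₗ[ℂ] Module.End ℂ E) {R : h →ₗ[ℂ] Module.End ℂ C}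
    {R' : h →ₗ[ℂ] Module.End ℂ C'} (hf : ∀ v, f (par v) = par (f v))
    (hg : ∀ v, g (par v) = par (g v))
    (hR : ∀ a v, k (R a v) = R' a (k v)) (t : E ⊗[ℂ] (A ⊗[ℂ] (B ⊗[ℂ] C))) :
    assoc110 α β δ R'
        (TensorProduct.map LinearMap.id (TensorProduct.map f (TensorProduct.map g k)) t) =
      TensorProduct.map (TensorProduct.map LinearMap.id (TensorProduct.map f g)) k
        (assoc110 α β δ R t) := by
  simp only [assoc110, LinearMap.comp_apply]
  rw [← map_expOm α β
      (TensorProduct.map LinearMap.id (TensorProduct.map f (TensorProduct.map g k))) _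
      (P := inr (inr (inr R))) (Q := inl δ) (P' := inr (inr (inr R'))) (Q' := inl δ)
      (map_id_inr (map_inr_apply hf (map_inr_apply hg hR))) (map_id_inl _ _),
    map_id_reassoc_natural, reassoc_map]

theorem assoc111_natural [Parity A] [Parity A'] [Parity E] (F : E →ₗ[ℂ] E)
    (hf : ∀ v, f (par v) = par (f v))
    (t : A ⊗[ℂ] (E ⊗[ℂ] (B ⊗[ℂ] C))) :
    assoc111 F
        (TensorProduct.map f (TensorProduct.map LinearMap.id (TensorProduct.map g k)) t) =
      TensorProduct.map (TensorProduct.map LinearMap.id (TensorProduct.map f g)) k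
        (assoc111 F t) := by
  simp only [assoc111, LinearMap.comp_apply]
  have key : TensorProduct.map LinearMap.id (TensorProduct.map F LinearMap.id)
        (TensorProduct.map f (TensorProduct.map LinearMap.id (TensorProduct.map g k)) t) =
      TensorProduct.map f (TensorProduct.map LinearMap.id (TensorProduct.map g k))
        (TensorProduct.map LinearMap.id (TensorProduct.map F LinearMap.id) t) := by
    simp only [← LinearMap.comp_apply, ← TensorProduct.map_comp, LinearMap.id_comp,
      LinearMap.comp_id]
  rw [key, swapMid_natural _ hf, map_id_reassoc_natural, reassoc_map]

end Natural

section Bijective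

theorem assoc010_bijective [Parity A] [Parity B]
    (P : h →ₗ[ℂ] Module.End ℂ A) (R : h →ₗ[ℂ] Module.End ℂ C) [OddOp P]
    [Anti P P] [Anti R R] : Function.Bijective (assoc010 (B := B) α β P R) :=
  reassoc_bijective.comp (expOm_bijective _ _ _)

theorem assoc101_bijective [Parity A] [Parity E]
    (L : h →ₗ[ℂ] Module.End ℂ E) (Q : h →ₗ[ℂ] Module.End ℂ B) [OddOp L]
    [Anti L L] [Anti Q Q] : Function.Bijective (assoc101 (A := A) (C := C) α β L Q) :=
  (map_id_bijective reassoc_bijective).comp (expOm_bijective _ _ _)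

theorem assoc011_bijective [Parity A] [Parity E]
    (δ : h →ₗ[ℂ] Module.End ℂ E) (P : h →ₗ[ℂ] Module.End ℂ A) [OddOp P]
    [Anti P P] [Anti δ δ] : Function.Bijective (assoc011 (B := B) (C := C) α β δ P) :=
  (map_id_bijective reassoc_bijective).comp (swapMid_bijective.comp (expOm_bijective _ _ _))

theorem assoc110_bijective [Parity A] [Parity B] [Parity E]
    (δ : h →ₗ[ℂ] Module.End ℂ E) (R : h →ₗ[ℂ] Module.End ℂ C) [OddOp δ]
    [Anti δ δ] [Anti R R] : Function.Bijective (assoc110 (A := A) (B := B) α β δ R) :=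
  reassoc_bijective.comp ((map_id_bijective reassoc_bijective).comp (expOm_bijective _ _ _))

theorem assoc111_bijective [Parity A] [Parity E] {F : E →ₗ[ℂ] E} (hF : Function.Bijective F) :
    Function.Bijective (assoc111 (A := A) (B := B) (C := C) F) :=
  reassoc_bijective.comp ((map_id_bijective reassoc_bijective).comp
    (swapMid_bijective.comp (map_id_bijective (map_bijective_id hF))))

end Bijective

section Equivariant

theorem reassoc_equivariant [Parity A] [Parity B] (P : h →ₗ[ℂ] Module.End ℂ A)
    (Q : h →ₗ[ℂ] Module.End ℂ B)
    (R : h →ₗ[ℂ] Module.End ℂ C) (a : h) (t : A ⊗[ℂ] (B ⊗[ℂ] C)) :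
    reassoc A B C ((inl P + inr (inl Q + inr R) : h →ₗ[ℂ] Module.End ℂ (A ⊗[ℂ] (B ⊗[ℂ] C))) a t) =
      (inl (inl P + inr Q) + inr R : h →ₗ[ℂ] Module.End ℂ ((A ⊗[ℂ] B) ⊗[ℂ] C)) a
        (reassoc A B C t) := by
  rw [inr_add, inl_add]
  simp only [LinearMap.add_apply, map_add]
  rw [reassoc_inl, reassoc_inr_inl, reassoc_inr_inr, add_assoc]

variable {ω : LinearMap.BilinForm ℂ h}

theorem IsDualPair.assoc011_equivariant [Parity A] [Parity E] (hd : IsDualPair ω α β)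
    (L δ : h →ₗ[ℂ] Module.End ℂ E)
    [OddOp L] [Anti δ δ] [Heis ω δ L] (P : h →ₗ[ℂ] Module.End ℂ A) [OddOp P] [Anti P P] (a : h)
    (t : A ⊗[ℂ] (E ⊗[ℂ] (B ⊗[ℂ] C))) :
    assoc011 α β δ P
        ((inl P + inr (inl L) : h →ₗ[ℂ] Module.End ℂ (A ⊗[ℂ] (E ⊗[ℂ] (B ⊗[ℂ] C)))) a t) =
      inl L a (assoc011 α β δ P t) := by
  simp only [assoc011, LinearMap.comp_apply, LinearMap.add_apply, map_add]
  rw [hd.expOm_apply_left (-1) (inl P) (inr (inl δ)) (inr (inl L)), expOm_apply_of_anti,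
    map_add, map_smul, swapMid_inr_inl, map_add, map_id_inl, map_smul]
  module

theorem assoc101_equivariant [Parity A] [Parity E] (L : h →ₗ[ℂ] Module.End ℂ E) [OddOp L] [Anti L L]
    (Q : h →ₗ[ℂ] Module.End ℂ B) (a : h) (t : E ⊗[ℂ] (A ⊗[ℂ] (B ⊗[ℂ] C))) :
    assoc101 α β L Q (inl L a t) = inl L a (assoc101 α β L Q t) := by
  simp only [assoc101, LinearMap.comp_apply]
  rw [expOm_apply_of_anti, map_id_inl]

theorem IsDualPair.assoc110_equivariant [Parity A] [Parity B] [Parity E]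
    (hd : IsDualPair ω α β) (L δ : h →ₗ[ℂ] Module.End ℂ E)
    [OddOp L] [OddOp δ] [Anti δ δ] [Heis ω δ L] (R : h →ₗ[ℂ] Module.End ℂ C) [Anti R R] (a : h)
    (t : E ⊗[ℂ] (A ⊗[ℂ] (B ⊗[ℂ] C))) :
    assoc110 α β δ R (inl L a t) =
      (inl (inl L) + inr R : h →ₗ[ℂ] Module.End ℂ ((E ⊗[ℂ] (A ⊗[ℂ] B)) ⊗[ℂ] C)) a
        (assoc110 α β δ R t) := by
  simp only [assoc110, LinearMap.comp_apply, LinearMap.add_apply]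
  rw [hd.expOm_apply_left 1 (inr (inr (inr R))) (inl δ) (inl L), one_smul, map_add, map_add,
    map_id_inl, reassoc_inl, map_id_inr (reassoc_inr_inr R), reassoc_inr_inr]

end Equivariant

end Properties

/-! ### The associators of the category -/

section Reorder

variable {h : Type u} [AddCommGroup h] [Module ℂ h]
variable {A B C E : Type u} [AddCommGroup A] [Module ℂ A] [AddCommGroup B] [Module ℂ B]
  [AddCommGroup C] [Module ℂ C] [AddCommGroup E] [Module ℂ E]
  {ι : Type*} [Fintype ι] {α β : ι → h}

theorem assoc011_apply [Parity A] [Parity E] (δ : h →ₗ[ℂ] Module.End ℂ E)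
    (P : h →ₗ[ℂ] Module.End ℂ A) (t : A ⊗[ℂ] (E ⊗[ℂ] (B ⊗[ℂ] C))) :
    assoc011 α β δ P t = TensorProduct.map LinearMap.id (reassoc A B C)
      (unassoc E A (B ⊗[ℂ] C) (TensorProduct.map (swap A E ∘ₗ expOm α β (-1) (inl P) (inr δ))
        LinearMap.id (reassoc A E (B ⊗[ℂ] C) t))) := by
  simp only [assoc011, swapMid, LinearMap.comp_apply, map_comp_id]
  rw [map_expOm_id, map_expOm α β (reassoc A E (B ⊗[ℂ] C)) _ (P := inl P) (Q := inr (inl δ))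
    (reassoc_inl _) (reassoc_inr_inl _)]

theorem assoc110_apply [Parity A] [Parity B] [Parity E] (δ : h →ₗ[ℂ] Module.End ℂ E)
    (R : h →ₗ[ℂ] Module.End ℂ C) (t : E ⊗[ℂ] (A ⊗[ℂ] (B ⊗[ℂ] C))) :
    assoc110 α β δ R t = reassoc E (A ⊗[ℂ] B) C (expOm α β 1 (inr (inr R)) (inl δ)
      (TensorProduct.map LinearMap.id (reassoc A B C) t)) := by
  simp only [assoc110, LinearMap.comp_apply]
  rw [map_expOm α β (TensorProduct.map LinearMap.id (reassoc A B C)) _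
    (P := inr (inr (inr R))) (Q := inl δ) (map_id_inr (reassoc_inr_inr _)) (map_id_inl _ _)]

theorem assoc111_apply [Parity A] [Parity E] {F : E →ₗ[ℂ] E} (hF : ∀ u, F (par u) = par (F u))
    (t : A ⊗[ℂ] (E ⊗[ℂ] (B ⊗[ℂ] C))) :
    assoc111 F t = reassoc E (A ⊗[ℂ] B) C (TensorProduct.map LinearMap.id (reassoc A B C)
      (unassoc E A (B ⊗[ℂ] C) (TensorProduct.map (TensorProduct.map F LinearMap.id) LinearMap.id
        (TensorProduct.map (swap A E) LinearMap.id (reassoc A E (B ⊗[ℂ] C) t))))) := by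
  have h1 (s : (E ⊗[ℂ] A) ⊗[ℂ] (B ⊗[ℂ] C)) : unassoc E A (B ⊗[ℂ] C)
      (TensorProduct.map (TensorProduct.map F LinearMap.id) LinearMap.id s) =
      TensorProduct.map F LinearMap.id (unassoc E A (B ⊗[ℂ] C) s) :=
    tensor_ext₃' (N := E ⊗[ℂ] (A ⊗[ℂ] (B ⊗[ℂ] C))) (F := unassoc E A (B ⊗[ℂ] C) ∘ₗ
        TensorProduct.map (TensorProduct.map F LinearMap.id) LinearMap.id)
      (G := TensorProduct.map F LinearMap.id ∘ₗ unassoc E A (B ⊗[ℂ] C)) (fun _ _ _ => by simp) s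
  rw [h1]
  simp only [assoc111, LinearMap.comp_apply]
  rw [swapMid_map_left hF]
  rfl

end Reorder

section Bridge

variable {h : Type u} [AddCommGroup h] [Module ℂ h] {ω : LinearMap.BilinForm ℂ h}
  {ι : Type*} [Fintype ι] {α β : ι → h} {lam : U h →ₗ[ℂ] ℂ}

theorem par_tensor_eq (V W : SuperVect.{u}) [pV : Parity V.carrier] [pW : Parity W.carrier]
    (hV : pV.par = V.par) (hW : pW.par = W.par) :
    (par : V.carrier ⊗[ℂ] W.carrier →ₗ[ℂ] V.carrier ⊗[ℂ] W.carrier) = (V.tensor W).par := by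
  refine LinearMap.ext fun x => ((super_par_tmul V W x).trans ?_).symm
  rw [← hV, ← hW]
  rfl

theorem par_U_eq : (par : U h →ₗ[ℂ] U h) = (USuper h).par :=
  LinearMap.ext fun x => (super_par_U x).symm

theorem assocLin_010 (A C : SuperRep h) (B : SuperVect.{u}) [pA : Parity A.space.carrier]
    [pB : Parity B.carrier] (hA : pA.par = A.space.par) (hB : pB.par = B.par) :
    assocLin α β lam (.untw A) (.tw B) (.untw C) = assoc010 α β A.act C.act :=
  congrArg (fun T => reassoc A.space.carrier B.carrier C.space.carrier ∘ₗ T)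
    (twist010_eq A C B pA pB hA hB)

theorem assocLin_101 (A C : SuperVect.{u}) (B : SuperRep h) [pA : Parity A.carrier]
    (hA : pA.par = A.par) :
    assocLin α β lam (.tw A) (.untw B) (.tw C) = assoc101 α β (LU h) B.act :=
  congrArg (fun T => TensorProduct.map (LinearMap.id : U h →ₗ[ℂ] U h)
    (reassoc A.carrier B.space.carrier C.carrier) ∘ₗ T) (twist101_eq A C B pA hA)

theorem IsDualPair.assocLin_011 (hd : IsDualPair ω α β) (A : SuperRep h) (B C : SuperVect.{u})
    [pA : Parity A.space.carrier] (hA : pA.par = A.space.par) :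
    assocLin α β lam (.untw A) (.tw B) (.tw C) = assoc011 α β (DU ω) A.act := by
  have : twist011 A = swap A.space.carrier (U h) ∘ₗ
      expOm α β (-1) (inl A.act) (inr (DU ω)) := LinearMap.ext (hd.twist011_apply A pA hA)
  refine LinearMap.ext fun t => Eq.trans ?_ (assoc011_apply (DU ω) A.act t).symm
  rw [← this]
  rfl

theorem IsDualPair.assocLin_110 (hd : IsDualPair ω α β) (A B : SuperVect.{u}) (C : SuperRep h)
    [pA : Parity A.carrier] [pB : Parity B.carrier] (hA : pA.par = A.par) (hB : pB.par = B.par) :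
    assocLin α β lam (.tw A) (.tw B) (.untw C) = assoc110 α β (DU ω) C.act := by
  refine LinearMap.ext fun t => Eq.trans ?_ (assoc110_apply (DU ω) C.act t).symm
  exact congrArg (reassoc (U h) (A.carrier ⊗[ℂ] B.carrier) C.space.carrier)
    (hd.twist110_apply (A.tensor B) C inferInstance (par_tensor_eq A B hA hB) _)

theorem assocLin_111 (hF : ∀ u, phi α β lam (par u) = par (phi α β lam u)) (A B C : SuperVect.{u})
    [pA : Parity A.carrier] (hA : pA.par = A.par) :
    assocLin α β lam (.tw A) (.tw B) (.tw C) = assoc111 (phi α β lam) := by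
  have : SuperVect.braid A (USuper h) = swap A.carrier (U h) :=
    braid_eq_swap A (USuper h) (pW := (inferInstance : Parity (U h)))
      (LinearMap.congr_fun hA) (LinearMap.congr_fun par_U_eq)
  refine LinearMap.ext fun t => Eq.trans ?_ (assoc111_apply hF t).symm
  rw [← this]
  rfl

end Bridge

/-! ### The associators and unitors are isomorphisms -/

section Spec

variable {h : Type u} [AddCommGroup h] [Module ℂ h] {ω : LinearMap.BilinForm ℂ h}
  {ι : Type*} [Fintype ι] {α β : ι → h} {lam : U h →ₗ[ℂ] ℂ}

/-- An even endomorphism of `U(h)` with the properties of the Fourier transform: up to scalars it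
exchanges the multiplication by elements of `h` and the contraction with them, and its square is
the parity. -/
structure IsFourier (ω : LinearMap.BilinForm ℂ h) (F : U h →ₗ[ℂ] U h) : Prop where
  map_par : ∀ u, F (par u) = par (F u)
  map_ι_mul : ∀ a u, F (ExteriorAlgebra.ι ℂ a * u) = (-((Real.pi : ℂ) * Complex.I))⁻¹ • DU ω a (F u)
  map_DU : ∀ a u, F (DU ω a u) = ((Real.pi : ℂ) * Complex.I) • (ExteriorAlgebra.ι ℂ a * F u)
  apply_apply : ∀ u, F (F u) = par u

theorem IsDualPair.isFourier_phi [FiniteDimensional ℂ h] {α β : Module.Basis ι ℂ h}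
    (hd : IsDualPair ω α β)
    (he : Even (finrank ℂ h)) (hlam : IsTopForm α β lam) : IsFourier ω (phi α β lam) where
  map_par := phi_par lam (hlam.apply_par he)
  map_ι_mul := hd.phi_ι_mul lam
  map_DU := hd.phi_DU lam hlam.apply_DU
  apply_apply := hd.phi_phi hlam.apply_DU (hlam.apply_gauss he)

theorem smul_apply_apply {E : Type*} [AddCommGroup E] [Module ℂ E] (c : ℂ)
    (D : h →ₗ[ℂ] Module.End ℂ E) (a : h) (x : E) : (c • D) a x = c • D a x := rfl

theorem IsFourier.map_LU_apply {F : U h →ₗ[ℂ] U h} (hF : IsFourier ω F) (a : h) (u : U h) :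
    F (LU h a u) = ((-((Real.pi : ℂ) * Complex.I))⁻¹ • DU ω) a (F u) :=
  (hF.map_ι_mul a u).trans (smul_apply_apply _ (DU ω) a (F u)).symm

theorem IsFourier.map_DU_apply {F : U h →ₗ[ℂ] U h} (hF : IsFourier ω F) (a : h) (u : U h) :
    F (DU ω a u) = (((Real.pi : ℂ) * Complex.I) • LU h) a (F u) :=
  (hF.map_DU a u).trans (smul_apply_apply _ (LU h) a (F u)).symm

theorem IsFourier.bijective {F : U h →ₗ[ℂ] U h} (hF : IsFourier ω F) : Function.Bijective F := by
  have h1 : Function.Bijective (F ∘ F) := by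
    rw [show F ∘ F = par from funext hF.apply_apply]
    exact Function.Involutive.bijective par_par
  exact ⟨h1.injective.of_comp, h1.surjective.of_comp⟩

/-- The linear map `f` underlies an isomorphism `A → B` in `𝒞`. -/
structure IsIsoLin (A B : Obj h) (f : A.und.carrier →ₗ[ℂ] B.und.carrier) : Prop where
  isEven : SuperVect.IsEven (V := A.und) (W := B.und) f
  compat : Obj.Compat A B f
  bijective : Function.Bijective f

theorem IsIsoLin.congr {A B : Obj h} {f g : A.und.carrier →ₗ[ℂ] B.und.carrier}
    (hg : IsIsoLin A B g) (hfg : f = g) : IsIsoLin A B f := hfg ▸ hg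

theorem isEven_of_parity {V W : SuperVect.{u}} {pV : Parity V.carrier} {pW : Parity W.carrier}
    (hV : pV.par = V.par) (hW : pW.par = W.par) {f : V.carrier →ₗ[ℂ] W.carrier}
    (hf : ∀ v, f (pV.par v) = pW.par (f v)) : SuperVect.IsEven (V := V) (W := W) f :=
  isEven_of_par fun v => by rw [← hV, ← hW, hf]

theorem isIsoLin_untw {R S : SuperRep h} {pR : Parity R.space.carrier} {pS : Parity S.space.carrier}
    (hR : pR.par = R.space.par) (hS : pS.par = S.space.par)
    {f : R.space.carrier →ₗ[ℂ] S.space.carrier} (hf : ∀ v, f (pR.par v) = pS.par (f v))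
    (hact : ∀ a v, f (R.act a v) = S.act a (f v)) (hbij : Function.Bijective f) :
    IsIsoLin (.untw R) (.untw S) f :=
  ⟨isEven_of_parity hR hS hf, hact, hbij⟩

theorem isIsoLin_tw {V W : SuperVect.{u}} {pV : Parity V.carrier} {pW : Parity W.carrier}
    (hV : pV.par = V.par) (hW : pW.par = W.par)
    {f : V.carrier →ₗ[ℂ] W.carrier} (hf : ∀ v, f (pV.par v) = pW.par (f v))
    (hbij : Function.Bijective f) : IsIsoLin (h := h) (.tw V) (.tw W) f :=
  ⟨isEven_of_parity hV hW hf, True.intro, hbij⟩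

theorem par_tensor_right (V W X : SuperVect.{u}) :
    (par : V.carrier ⊗[ℂ] (W.carrier ⊗[ℂ] X.carrier) →ₗ[ℂ] _) = (V.tensor (W.tensor X)).par :=
  @par_tensor_eq V (W.tensor X) _ _ rfl (@par_tensor_eq W X _ _ rfl rfl)

theorem par_tensor_left (V W X : SuperVect.{u}) :
    (par : (V.carrier ⊗[ℂ] W.carrier) ⊗[ℂ] X.carrier →ₗ[ℂ] _) = ((V.tensor W).tensor X).par :=
  @par_tensor_eq (V.tensor W) X _ _ (@par_tensor_eq V W _ _ rfl rfl) rfl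

theorem par_U_tensor (V W : SuperVect.{u}) :
    (par : U h ⊗[ℂ] (V.carrier ⊗[ℂ] W.carrier) →ₗ[ℂ] _) =
      ((USuper h).tensor (V.tensor W)).par :=
  @par_tensor_eq (USuper h) (V.tensor W) _ _ par_U_eq (@par_tensor_eq V W _ _ rfl rfl)

theorem par_U_tensor_right (V W X : SuperVect.{u}) :
    (par : U h ⊗[ℂ] (V.carrier ⊗[ℂ] (W.carrier ⊗[ℂ] X.carrier)) →ₗ[ℂ] _) =
      ((USuper h).tensor (V.tensor (W.tensor X))).par :=
  @par_tensor_eq (USuper h) (V.tensor (W.tensor X)) _ _ par_U_eq (par_tensor_right V W X)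

theorem par_U_tensor_left (V W X : SuperVect.{u}) :
    (par : U h ⊗[ℂ] ((V.carrier ⊗[ℂ] W.carrier) ⊗[ℂ] X.carrier) →ₗ[ℂ] _) =
      ((USuper h).tensor ((V.tensor W).tensor X)).par :=
  @par_tensor_eq (USuper h) ((V.tensor W).tensor X) _ _ par_U_eq (par_tensor_left V W X)

theorem par_tensor_U (V W X : SuperVect.{u}) :
    (par : V.carrier ⊗[ℂ] (U h ⊗[ℂ] (W.carrier ⊗[ℂ] X.carrier)) →ₗ[ℂ] _) =
      (V.tensor ((USuper h).tensor (W.tensor X))).par :=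
  @par_tensor_eq V ((USuper h).tensor (W.tensor X)) _ _ rfl (par_U_tensor W X)

theorem par_U_tensor_tensor (V W X : SuperVect.{u}) :
    par (V := (U h ⊗[ℂ] (V.carrier ⊗[ℂ] W.carrier)) ⊗[ℂ] X.carrier) =
      (((USuper h).tensor (V.tensor W)).tensor X).par :=
  @par_tensor_eq ((USuper h).tensor (V.tensor W)) X _ _ (par_U_tensor V W) rfl

/-- The action on `R ⊗ S` in terms of `inl` and `inr`, for any parity structure on `R` that agrees with
the given one; iterated tensor products carry two such structures that are not definitionally equal. -/
theorem tensor_act (R S : SuperRep h) [pR : Parity R.space.carrier]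
    (hR : pR.par = R.space.par) : (R.tensor S).act = inl R.act + inr S.act := by
  obtain rfl : pR = superParity R.space := parity_ext hR
  rfl

theorem reassoc_isIsoLin (A B C : SuperRep h) :
    IsIsoLin (.untw (A.tensor (B.tensor C))) (.untw ((A.tensor B).tensor C))
      (reassoc A.space.carrier B.space.carrier C.space.carrier) := by
  refine isIsoLin_untw (par_tensor_right A.space B.space C.space)
    (par_tensor_left A.space B.space C.space) reassoc_par (fun a v => ?_) reassoc_bijective
  have h1 : ((A.tensor B).tensor C).act = inl (inl A.act + inr B.act) + inr C.act :=
    @tensor_act _ _ _ (A.tensor B) C _ (@par_tensor_eq A.space B.space _ _ rfl rfl)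
  rw [h1]
  exact reassoc_equivariant A.act B.act C.act a v

theorem reassoc_isIsoLin_tw (V W X : SuperVect.{u}) :
    IsIsoLin (h := h) (.tw (V.tensor (W.tensor X))) (.tw ((V.tensor W).tensor X))
      (reassoc V.carrier W.carrier X.carrier) :=
  isIsoLin_tw (par_tensor_right V W X) (par_tensor_left V W X) reassoc_par reassoc_bijective

theorem assoc010_isIsoLin (A C : SuperRep h) (B : SuperVect.{u}) :
    IsIsoLin (h := h) (.tw (A.space.tensor (B.tensor C.space)))
      (.tw ((A.space.tensor B).tensor C.space)) (assoc010 α β A.act C.act) :=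
  isIsoLin_tw (par_tensor_right A.space B C.space) (par_tensor_left A.space B C.space)
    (assoc010_par A.act C.act) (assoc010_bijective A.act C.act)

theorem IsDualPair.assoc011_isIsoLin (hd : IsDualPair ω α β) (A : SuperRep h)
    (B C : SuperVect.{u}) :
    IsIsoLin (.untw (A.tensor (SuperRep.free (B.tensor C))))
      (.untw (SuperRep.free ((A.space.tensor B).tensor C))) (assoc011 α β (DU ω) A.act) :=
  isIsoLin_untw (par_tensor_U A.space B C) (par_U_tensor_left A.space B C)
    (assoc011_par (DU ω) A.act) (hd.assoc011_equivariant (LU h) (DU ω) A.act)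
    (assoc011_bijective (DU ω) A.act)

theorem assoc101_isIsoLin (A C : SuperVect.{u}) (B : SuperRep h) :
    IsIsoLin (.untw (SuperRep.free (A.tensor (B.space.tensor C))))
      (.untw (SuperRep.free ((A.tensor B.space).tensor C))) (assoc101 α β (LU h) B.act) :=
  isIsoLin_untw (par_U_tensor_right A B.space C) (par_U_tensor_left A B.space C)
    (assoc101_par (LU h) B.act) (assoc101_equivariant (LU h) B.act)
    (assoc101_bijective (LU h) B.act)

theorem IsDualPair.assoc110_isIsoLin (hd : IsDualPair ω α β) (A B : SuperVect.{u})
    (C : SuperRep h) :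
    IsIsoLin (.untw (SuperRep.free (A.tensor (B.tensor C.space))))
      (.untw ((SuperRep.free (A.tensor B)).tensor C)) (assoc110 α β (DU ω) C.act) := by
  refine isIsoLin_untw (par_U_tensor_right A B C.space) (par_U_tensor_tensor A B C.space)
    (assoc110_par (DU ω) C.act) (fun a v => ?_) (assoc110_bijective (DU ω) C.act)
  have h1 : ((SuperRep.free (A.tensor B)).tensor C).act = inl (inl (LU h)) + inr C.act :=
    @tensor_act _ _ _ (SuperRep.free (A.tensor B)) C _ (par_U_tensor A B)
  rw [h1]
  exact hd.assoc110_equivariant (LU h) (DU ω) C.act a v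

theorem IsFourier.assoc111_isIsoLin {F : U h →ₗ[ℂ] U h} (hF : IsFourier ω F)
    (A B C : SuperVect.{u}) :
    IsIsoLin (h := h) (.tw (A.tensor ((USuper h).tensor (B.tensor C))))
      (.tw (((USuper h).tensor (A.tensor B)).tensor C)) (assoc111 F) :=
  isIsoLin_tw (par_tensor_U A B C) (par_U_tensor_tensor A B C)
    (assoc111_par hF.map_par) (assoc111_bijective hF.bijective)

theorem IsDualPair.assocLin_isIsoLin (hd : IsDualPair ω α β) (hF : IsFourier ω (phi α β lam)) :
    ∀ A B C : Obj h, IsIsoLin (A.star (B.star C)) ((A.star B).star C) (assocLin α β lam A B C)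
  | .untw A, .untw B, .untw C => reassoc_isIsoLin A B C
  | .untw A, .untw B, .tw C => reassoc_isIsoLin_tw A.space B.space C
  | .tw A, .untw B, .untw C => reassoc_isIsoLin_tw A B.space C.space
  | .untw A, .tw B, .untw C => (assoc010_isIsoLin A C B).congr (assocLin_010 A C B rfl rfl)
  | .untw A, .tw B, .tw C => (hd.assoc011_isIsoLin A B C).congr (hd.assocLin_011 A B C rfl)
  | .tw A, .untw B, .tw C => (assoc101_isIsoLin A C B).congr (assocLin_101 A C B rfl)
  | .tw A, .tw B, .untw C => (hd.assoc110_isIsoLin A B C).congr (hd.assocLin_110 A B C rfl rfl)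
  | .tw A, .tw B, .tw C => (hF.assoc111_isIsoLin A B C).congr (assocLin_111 hF.map_par A B C rfl)

theorem IsIsoLin.symm {A B : Obj h} {f : A.und.carrier →ₗ[ℂ] B.und.carrier}
    (hf : IsIsoLin A B f) :
    IsIsoLin B A (LinearEquiv.ofBijective f hf.bijective).symm.toLinearMap := by
  have key (w) : f ((LinearEquiv.ofBijective f hf.bijective).symm w) = w :=
    LinearEquiv.apply_symm_apply (LinearEquiv.ofBijective f hf.bijective) w
  have hinj := hf.bijective.injective
  refine ⟨isEven_of_par fun v => hinj ?_, ?_,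
    (LinearEquiv.ofBijective f hf.bijective).symm.bijective⟩
  · exact (key _).trans ((congrArg _ (key v).symm).trans (Obj.lin_par hf.isEven _).symm)
  · have h2 := hf.compat
    rcases A with R | X <;> rcases B with S | Y
    · exact fun a v => hinj ((key _).trans ((congrArg _ (key v).symm).trans (h2 a _).symm))
    · obtain rfl : f = 0 := h2
      exact LinearMap.ext fun v => hinj rfl
    · obtain rfl : f = 0 := h2
      exact LinearMap.ext fun v => hinj rfl
    · trivial

/-- The isomorphism of `𝒞` with a given underlying linear map. -/
def IsIsoLin.iso {A B : Obj h} {f : A.und.carrier →ₗ[ℂ] B.und.carrier}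
    (hf : IsIsoLin A B f) : A ≅ B where
  hom := (⟨f, hf.isEven, hf.compat⟩ : Obj.Hom A B)
  inv := (⟨_, hf.symm.isEven, hf.symm.compat⟩ : Obj.Hom B A)
  hom_inv_id := Obj.Hom.ext (LinearMap.ext fun v =>
    LinearEquiv.symm_apply_apply (LinearEquiv.ofBijective f hf.bijective) v)
  inv_hom_id := Obj.Hom.ext (LinearMap.ext fun v =>
    LinearEquiv.apply_symm_apply (LinearEquiv.ofBijective f hf.bijective) v)

section Unit

variable {V : Type u} [AddCommGroup V] [Module ℂ V]

variable (V) in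
/-- The left unitor of vector spaces. -/
abbrev lidLin : ULift.{u} ℂ ⊗[ℂ] V →ₗ[ℂ] V :=
  (TensorProduct.lid ℂ V).toLinearMap ∘ₗ
    TensorProduct.map ULift.moduleEquiv.toLinearMap LinearMap.id

variable (V) in
/-- The right unitor of vector spaces. -/
abbrev ridLin : V ⊗[ℂ] ULift.{u} ℂ →ₗ[ℂ] V :=
  (TensorProduct.rid ℂ V).toLinearMap ∘ₗ
    TensorProduct.map LinearMap.id ULift.moduleEquiv.toLinearMap

theorem lidLin_bijective : Function.Bijective (lidLin V) :=
  (TensorProduct.lid ℂ V).bijective.comp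
    (LinearEquiv.rTensor V (ULift.moduleEquiv (R := ℂ) (M := ℂ))).bijective

theorem ridLin_bijective : Function.Bijective (ridLin V) :=
  (TensorProduct.rid ℂ V).bijective.comp
    (LinearEquiv.lTensor V (ULift.moduleEquiv (R := ℂ) (M := ℂ))).bijective

theorem lidLin_map {W : Type u} [AddCommGroup W] [Module ℂ W] (F : V →ₗ[ℂ] W)
    (t : ULift.{u} ℂ ⊗[ℂ] V) : lidLin W (TensorProduct.map LinearMap.id F t) = F (lidLin V t) :=
  LinearMap.congr_fun (f := lidLin W ∘ₗ TensorProduct.map LinearMap.id F) (g := F ∘ₗ lidLin V)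
    (TensorProduct.ext' fun z v => by
      simp only [LinearMap.comp_apply, TensorProduct.map_tmul, LinearMap.id_apply]
      exact (F.map_smul z.down v).symm) t

theorem ridLin_map {W : Type u} [AddCommGroup W] [Module ℂ W] (F : V →ₗ[ℂ] W)
    (t : V ⊗[ℂ] ULift.{u} ℂ) : ridLin W (TensorProduct.map F LinearMap.id t) = F (ridLin V t) :=
  LinearMap.congr_fun (f := ridLin W ∘ₗ TensorProduct.map F LinearMap.id) (g := F ∘ₗ ridLin V)
    (TensorProduct.ext' fun v z => by
      simp only [LinearMap.comp_apply, TensorProduct.map_tmul, LinearMap.id_apply]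
      exact (F.map_smul z.down v).symm) t

theorem par_unit : SuperVect.unit.{u}.par = LinearMap.id :=
  LinearMap.ext fun _ => SuperVect.par_of_even _ trivial

end Unit

theorem leftUnitLin_isIsoLin : ∀ A : Obj h, IsIsoLin (Obj.one.star A) A A.leftUnitLin := by
  have hpar (V : SuperVect.{u}) (t : ULift.{u} ℂ ⊗[ℂ] V.carrier) :
      lidLin V.carrier ((SuperVect.unit.tensor V).par t) = V.par (lidLin V.carrier t) := by
    rw [super_par_tmul, par_unit]
    exact lidLin_map V.par t
  rintro (R | X)
  · refine ⟨isEven_of_par (hpar R.space), fun a t => ?_, lidLin_bijective⟩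
    have h1 : (SuperRep.trivial.tensor R).act a = TensorProduct.map LinearMap.id (R.act a) := by
      change TensorProduct.map 0 LinearMap.id + TensorProduct.map SuperVect.unit.par (R.act a) = _
      rw [TensorProduct.map_zero_left, zero_add, par_unit]
    refine (congrArg _ (LinearMap.congr_fun h1 t)).trans ?_
    exact lidLin_map (R.act a) t
  · exact ⟨isEven_of_par (hpar X), True.intro, lidLin_bijective⟩

theorem rightUnitLin_isIsoLin : ∀ A : Obj h, IsIsoLin (A.star Obj.one) A A.rightUnitLin := by
  have hpar (V : SuperVect.{u}) (t : V.carrier ⊗[ℂ] ULift.{u} ℂ) :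
      ridLin V.carrier ((V.tensor SuperVect.unit).par t) = V.par (ridLin V.carrier t) := by
    rw [super_par_tmul, par_unit]
    exact ridLin_map V.par t
  rintro (R | X)
  · refine ⟨isEven_of_par (hpar R.space), fun a t => ?_, ridLin_bijective⟩
    have h1 : (R.tensor SuperRep.trivial).act a = TensorProduct.map (R.act a) LinearMap.id := by
      change TensorProduct.map (R.act a) LinearMap.id + TensorProduct.map R.space.par 0 = _
      rw [TensorProduct.map_zero_right, add_zero]
    refine (congrArg _ (LinearMap.congr_fun h1 t)).trans ?_
    exact ridLin_map (R.act a) t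
  · exact ⟨isEven_of_par (hpar X), True.intro, ridLin_bijective⟩

end Spec

/-! ### Functoriality, naturality and the coherence axioms -/

section Linear

variable {A B V₀ V₁ V₂ W₁ W₂ E : Type u} [AddCommGroup A] [Module ℂ A] [AddCommGroup B]
  [Module ℂ B] [AddCommGroup V₀] [Module ℂ V₀] [AddCommGroup V₁] [Module ℂ V₁] [AddCommGroup V₂]
  [Module ℂ V₂] [AddCommGroup W₁] [Module ℂ W₁] [AddCommGroup W₂] [Module ℂ W₂]
  [AddCommGroup E] [Module ℂ E]

theorem pentagon_congr {f₁ g₁ : V₁ →ₗ[ℂ] V₂} {f₂ g₂ : V₀ →ₗ[ℂ] V₁} {f₃ g₃ : W₂ →ₗ[ℂ] V₂}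
    {f₄ g₄ : W₁ →ₗ[ℂ] W₂} {f₅ g₅ : V₀ →ₗ[ℂ] W₁} (h₁ : f₁ = g₁) (h₂ : f₂ = g₂) (h₃ : f₃ = g₃)
    (h₄ : f₄ = g₄) (h₅ : f₅ = g₅) (H : ∀ t, g₁ (g₂ t) = g₃ (g₄ (g₅ t))) :
    f₁ ∘ₗ f₂ = f₃ ∘ₗ f₄ ∘ₗ f₅ := by
  subst h₁ h₂ h₃ h₄ h₅
  exact LinearMap.ext H

theorem triangle_reassoc (t : A ⊗[ℂ] (ULift.{u} ℂ ⊗[ℂ] B)) :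
    TensorProduct.map (ridLin A) LinearMap.id (reassoc A (ULift.{u} ℂ) B t) =
      TensorProduct.map LinearMap.id (lidLin B) t :=
  tensor_ext₃ (F := TensorProduct.map (ridLin A) LinearMap.id ∘ₗ reassoc A (ULift.{u} ℂ) B)
    (G := TensorProduct.map LinearMap.id (lidLin B))
    (fun x z y => TensorProduct.smul_tmul z.down x y) t

theorem triangle_assoc101 {h : Type u} [AddCommGroup h] [Module ℂ h] {ι : Type*} [Fintype ι]
    {α β : ι → h} [Parity A] [Parity E] (L : h →ₗ[ℂ] Module.End ℂ E)
    (t : E ⊗[ℂ] (A ⊗[ℂ] (ULift.{u} ℂ ⊗[ℂ] B))) :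
    TensorProduct.map LinearMap.id (TensorProduct.map (ridLin A) LinearMap.id)
        (assoc101 α β L 0 t) =
      TensorProduct.map LinearMap.id (TensorProduct.map LinearMap.id (lidLin B)) t := by
  have h0 : inl (W := B) (0 : h →ₗ[ℂ] Module.End ℂ (ULift.{u} ℂ)) = 0 :=
    LinearMap.ext fun a => LinearMap.rTensor_zero _
  have h1 (V W : Type u) [AddCommGroup V] [Module ℂ V] [AddCommGroup W] [Module ℂ W] [Parity V] :
      inr (V := V) (0 : h →ₗ[ℂ] Module.End ℂ W) = 0 :=
    LinearMap.ext fun a => TensorProduct.map_zero_right _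
  rw [assoc101, LinearMap.comp_apply, h0, h1, h1, expOm_apply_of_eq_zero _ _ _ _ _ fun a => rfl]
  simp only [← LinearMap.comp_apply, ← map_id_comp]
  exact map_id_congr triangle_reassoc t

end Linear

section Functor

variable {h : Type u} [AddCommGroup h] [Module ℂ h]

open Obj

/-- A non-zero morphism of `𝒞` stays in one component. -/
theorem lin_eq_zero_or {A B : Obj h} (f : Hom A B) : f.lin = 0 ∨
    (∃ R S : SuperRep h, A = .untw R ∧ B = .untw S) ∨
      ∃ X Y : SuperVect.{u}, A = .tw X ∧ B = .tw Y := by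
  rcases A with R | X <;> rcases B with S | Y
  · exact Or.inr (Or.inl ⟨R, S, rfl, rfl⟩)
  · exact Or.inl f.compat
  · exact Or.inl f.compat
  · exact Or.inr (Or.inr ⟨X, Y, rfl, rfl⟩)

theorem starLin_zero_left : ∀ {A A' B B' : Obj h} (g : B.und.carrier →ₗ[ℂ] B'.und.carrier),
    starLin (A := A) (A' := A') 0 g = 0
  | .untw _, .untw _, .untw _, .untw _, g => TensorProduct.map_zero_left g
  | .untw _, .untw _, .tw _, .tw _, g => TensorProduct.map_zero_left g
  | .tw _, .tw _, .untw _, .untw _, g => TensorProduct.map_zero_left g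
  | .tw _, .tw _, .tw _, .tw _, g =>
    (congrArg (TensorProduct.map LinearMap.id) (TensorProduct.map_zero_left g)).trans
      (TensorProduct.map_zero_right _)
  | .untw _, .tw _, _, _, _ => rfl
  | .tw _, .untw _, _, _, _ => rfl
  | .untw _, .untw _, .untw _, .tw _, _ => rfl
  | .untw _, .untw _, .tw _, .untw _, _ => rfl
  | .tw _, .tw _, .untw _, .tw _, _ => rfl
  | .tw _, .tw _, .tw _, .untw _, _ => rfl

theorem starLin_zero_right : ∀ {A A' B B' : Obj h} (f : A.und.carrier →ₗ[ℂ] A'.und.carrier),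
    starLin (B := B) (B' := B') f 0 = 0
  | .untw _, .untw _, .untw _, .untw _, f => TensorProduct.map_zero_right f
  | .untw _, .untw _, .tw _, .tw _, f => TensorProduct.map_zero_right f
  | .tw _, .tw _, .untw _, .untw _, f => TensorProduct.map_zero_right f
  | .tw _, .tw _, .tw _, .tw _, f =>
    (congrArg (TensorProduct.map LinearMap.id) (TensorProduct.map_zero_right f)).trans
      (TensorProduct.map_zero_right _)
  | .untw _, .tw _, _, _, _ => rfl
  | .tw _, .untw _, _, _, _ => rfl
  | .untw _, .untw _, .untw _, .tw _, _ => rfl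
  | .untw _, .untw _, .tw _, .untw _, _ => rfl
  | .tw _, .tw _, .untw _, .tw _, _ => rfl
  | .tw _, .tw _, .tw _, .untw _, _ => rfl

theorem starLin_id : ∀ A B : Obj h,
    starLin (LinearMap.id : A.und.carrier →ₗ[ℂ] _) (LinearMap.id : B.und.carrier →ₗ[ℂ] _) =
      LinearMap.id
  | .untw _, .untw _ => TensorProduct.map_id
  | .untw _, .tw _ => TensorProduct.map_id
  | .tw _, .untw _ => TensorProduct.map_id
  | .tw _, .tw _ => (congrArg _ TensorProduct.map_id).trans TensorProduct.map_id

theorem starLin_comp {A A' A'' B B' B'' : Obj h} (f : Hom A A') (f' : Hom A' A'') (g : Hom B B')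
    (g' : Hom B' B'') :
    starLin (f'.lin ∘ₗ f.lin) (g'.lin ∘ₗ g.lin) =
      starLin f'.lin g'.lin ∘ₗ starLin f.lin g.lin := by
  rcases lin_eq_zero_or f with hz | ⟨R, R', rfl, rfl⟩ | ⟨X, X', rfl, rfl⟩
  · rw [hz, LinearMap.comp_zero, starLin_zero_left, starLin_zero_left, LinearMap.comp_zero]
  all_goals
    rcases lin_eq_zero_or f' with hz | ⟨R₁, R'', hR, rfl⟩ | ⟨X₁, X'', hX, rfl⟩
    · rw [hz, LinearMap.zero_comp, starLin_zero_left, starLin_zero_left, LinearMap.zero_comp]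
    all_goals first | cases hR | cases hX
    all_goals
      rcases lin_eq_zero_or g with hz | ⟨S, S', rfl, rfl⟩ | ⟨Y, Y', rfl, rfl⟩
      · rw [hz, LinearMap.comp_zero, starLin_zero_right, starLin_zero_right, LinearMap.comp_zero]
      all_goals
        rcases lin_eq_zero_or g' with hz | ⟨S₁, S'', hS, rfl⟩ | ⟨Y₁, Y'', hY, rfl⟩
        · rw [hz, LinearMap.zero_comp, starLin_zero_right, starLin_zero_right,
            LinearMap.zero_comp]
        all_goals first | cases hS | cases hY
  · exact TensorProduct.map_comp _ _ _ _
  · exact TensorProduct.map_comp _ _ _ _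
  · exact TensorProduct.map_comp _ _ _ _
  · exact (congrArg (TensorProduct.map LinearMap.id) (TensorProduct.map_comp f'.lin g'.lin f.lin
      g.lin)).trans (map_id_comp _ _)

variable {ω : LinearMap.BilinForm ℂ h} {ι : Type*} [Fintype ι] {α β : ι → h} {lam : U h →ₗ[ℂ] ℂ}

theorem IsDualPair.assocLin_naturality (hd : IsDualPair ω α β) (hF : IsFourier ω (phi α β lam))
    {A A' B B' C C' : Obj h} (f : Hom A A') (g : Hom B B') (k : Hom C C') :
    assocLin α β lam A' B' C' ∘ₗ starLin f.lin (starLin g.lin k.lin) =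
      starLin (starLin f.lin g.lin) k.lin ∘ₗ assocLin α β lam A B C := by
  rcases lin_eq_zero_or f with hz | ⟨R, R', rfl, rfl⟩ | ⟨X, X', rfl, rfl⟩
  · rw [hz, starLin_zero_left, starLin_zero_left, starLin_zero_left, LinearMap.comp_zero,
      LinearMap.zero_comp]
  all_goals
    rcases lin_eq_zero_or g with hz | ⟨S, S', rfl, rfl⟩ | ⟨Y, Y', rfl, rfl⟩
    · rw [hz, starLin_zero_left, starLin_zero_right, starLin_zero_right, starLin_zero_left,
        LinearMap.comp_zero, LinearMap.zero_comp]
    all_goals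
      rcases lin_eq_zero_or k with hz | ⟨T, T', rfl, rfl⟩ | ⟨Z, Z', rfl, rfl⟩
      · rw [hz, starLin_zero_right, starLin_zero_right, starLin_zero_right, LinearMap.comp_zero,
          LinearMap.zero_comp]
  · exact LinearMap.ext (reassoc_map f.lin g.lin k.lin)
  · exact LinearMap.ext (reassoc_map f.lin g.lin k.lin)
  · rw [assocLin_010 R T Y rfl rfl, assocLin_010 R' T' Y' rfl rfl]
    exact LinearMap.ext (assoc010_natural (lin_par f.isEven) (lin_par g.isEven) f.compat k.compat)
  · rw [hd.assocLin_011 R Y Z rfl, hd.assocLin_011 R' Y' Z' rfl]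
    exact LinearMap.ext (assoc011_natural (DU ω) (lin_par f.isEven) f.compat)
  · exact LinearMap.ext (reassoc_map f.lin g.lin k.lin)
  · rw [assocLin_101 X Z S rfl, assocLin_101 X' Z' S' rfl]
    exact LinearMap.ext (assoc101_natural (LU h) (lin_par f.isEven) g.compat)
  · rw [hd.assocLin_110 X Y T rfl rfl, hd.assocLin_110 X' Y' T' rfl rfl]
    exact LinearMap.ext (assoc110_natural (DU ω) (lin_par f.isEven) (lin_par g.isEven) k.compat)
  · rw [assocLin_111 hF.map_par X Y Z rfl, assocLin_111 hF.map_par X' Y' Z' rfl]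
    exact LinearMap.ext (assoc111_natural (phi α β lam) (lin_par f.isEven))

theorem leftUnitLin_naturality {A B : Obj h} (f : Hom A B) :
    B.leftUnitLin ∘ₗ starLin (LinearMap.id : (one (h := h)).und.carrier →ₗ[ℂ] _) f.lin =
      f.lin ∘ₗ A.leftUnitLin := by
  rcases lin_eq_zero_or f with hz | ⟨R, R', rfl, rfl⟩ | ⟨X, X', rfl, rfl⟩
  · rw [hz, starLin_zero_right, LinearMap.comp_zero, LinearMap.zero_comp]
  · exact LinearMap.ext (lidLin_map f.lin)
  · exact LinearMap.ext (lidLin_map f.lin)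

theorem rightUnitLin_naturality {A B : Obj h} (f : Hom A B) :
    B.rightUnitLin ∘ₗ starLin f.lin (LinearMap.id : (one (h := h)).und.carrier →ₗ[ℂ] _) =
      f.lin ∘ₗ A.rightUnitLin := by
  rcases lin_eq_zero_or f with hz | ⟨R, R', rfl, rfl⟩ | ⟨X, X', rfl, rfl⟩
  · rw [hz, starLin_zero_left, LinearMap.comp_zero, LinearMap.zero_comp]
  · exact LinearMap.ext (ridLin_map f.lin)
  · exact LinearMap.ext (ridLin_map f.lin)

theorem assocLin_triangle : ∀ A B : Obj h,
    starLin A.rightUnitLin (LinearMap.id : B.und.carrier →ₗ[ℂ] _) ∘ₗ assocLin α β lam A one B =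
      starLin (LinearMap.id : A.und.carrier →ₗ[ℂ] _) B.leftUnitLin
  | .untw _, .untw _ => LinearMap.ext triangle_reassoc
  | .untw _, .tw _ => LinearMap.ext triangle_reassoc
  | .tw _, .untw _ => LinearMap.ext triangle_reassoc
  | .tw A, .tw B => by
    rw [assocLin_101 A B SuperRep.trivial rfl]
    exact LinearMap.ext (triangle_assoc101 (LU h))

end Functor

section Pentagon

variable {h : Type u} [AddCommGroup h] [Module ℂ h] {ω : LinearMap.BilinForm ℂ h}
  {ι : Type*} [Fintype ι] {α β : ι → h} {lam : U h →ₗ[ℂ] ℂ}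

open Obj

theorem par_tensor (V W : SuperVect.{u}) :
    (par : V.carrier ⊗[ℂ] W.carrier →ₗ[ℂ] V.carrier ⊗[ℂ] W.carrier) = (V.tensor W).par :=
  par_tensor_eq V W rfl rfl

theorem IsDualPair.assocLin_pentagon (hd : IsDualPair ω α β) (hF : IsFourier ω (phi α β lam)) :
    ∀ A B C D : Obj h,
      assocLin α β lam (A.star B) C D ∘ₗ assocLin α β lam A B (C.star D) =
        starLin (assocLin α β lam A B C) (LinearMap.id : D.und.carrier →ₗ[ℂ] _) ∘ₗ
          assocLin α β lam A (B.star C) D ∘ₗ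
          starLin (LinearMap.id : A.und.carrier →ₗ[ℂ] _) (assocLin α β lam B C D)
  | .untw _, .untw _, .untw _, .untw _ => LinearMap.ext pentagon_reassoc
  | .untw _, .untw _, .untw _, .tw _ => LinearMap.ext pentagon_reassoc
  | .tw _, .untw _, .untw _, .untw _ => LinearMap.ext pentagon_reassoc
  | .untw A, .untw B, .tw C, .untw D =>
    pentagon_congr (@assocLin_010 _ _ _ _ _ α β lam (A.tensor B) D C _ _
        (par_tensor A.space B.space) rfl) rfl rfl
      (@assocLin_010 _ _ _ _ _ α β lam A D (B.space.tensor C) _ _ rfl (par_tensor B.space C))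
      (congrArg (TensorProduct.map LinearMap.id) (assocLin_010 B D C rfl rfl))
      (pentagon_0010 A.act B.act D.act)
  | .untw A, .tw B, .untw C, .untw D =>
    pentagon_congr rfl (assocLin_010 A (C.tensor D) B rfl rfl)
      (congrArg (TensorProduct.map · LinearMap.id) (assocLin_010 A C B rfl rfl))
      (@assocLin_010 _ _ _ _ _ α β lam A D (B.tensor C.space) _ _ rfl (par_tensor B C.space))
      rfl (pentagon_0100 A.act C.act D.act)
  | .untw A, .untw B, .tw C, .tw D =>
    pentagon_congr (@IsDualPair.assocLin_011 _ _ _ _ _ _ α β lam hd (A.tensor B) C D _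
        (par_tensor A.space B.space)) rfl rfl
      (hd.assocLin_011 A (B.space.tensor C) D rfl)
      (congrArg (TensorProduct.map LinearMap.id) (hd.assocLin_011 B C D rfl))
      (pentagon_0011 (DU ω) A.act B.act)
  | .untw A, .tw B, .untw C, .tw D =>
    pentagon_congr (@assocLin_101 _ _ _ _ _ α β lam (A.space.tensor B) D C _
        (par_tensor A.space B)) (hd.assocLin_011 A B (C.space.tensor D) rfl)
      (congrArg (fun f => TensorProduct.map LinearMap.id (TensorProduct.map f LinearMap.id))
        (assocLin_010 A C B rfl rfl))
      (hd.assocLin_011 A (B.tensor C.space) D rfl)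
      (congrArg (TensorProduct.map LinearMap.id) (assocLin_101 B D C rfl))
      (hd.pentagon_0101 (LU h) (DU ω) A.act C.act)
  | .untw A, .tw B, .tw C, .untw D =>
    pentagon_congr (@IsDualPair.assocLin_110 _ _ _ _ _ _ α β lam hd (A.space.tensor B) C D _ _
        (par_tensor A.space B) rfl) (hd.assocLin_011 A B (C.tensor D.space) rfl)
      (congrArg (TensorProduct.map · LinearMap.id) (hd.assocLin_011 A B C rfl))
      rfl
      (congrArg (TensorProduct.map LinearMap.id) (hd.assocLin_110 B C D rfl rfl))
      (pentagon_0110 (DU ω) A.act D.act)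
  | .tw A, .untw B, .untw C, .tw D =>
    pentagon_congr (@assocLin_101 _ _ _ _ _ α β lam (A.tensor B.space) D C _
        (par_tensor A B.space)) (assocLin_101 A (C.space.tensor D) B rfl)
      rfl (assocLin_101 A D (B.tensor C) rfl) rfl
      (pentagon_1001 (LU h) B.act C.act)
  | .tw A, .untw B, .tw C, .untw D =>
    pentagon_congr (@IsDualPair.assocLin_110 _ _ _ _ _ _ α β lam hd (A.tensor B.space) C D _ _
        (par_tensor A B.space) rfl) (assocLin_101 A (C.tensor D.space) B rfl)
      (congrArg (TensorProduct.map · LinearMap.id) (assocLin_101 A C B rfl))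
      (@IsDualPair.assocLin_110 _ _ _ _ _ _ α β lam hd A (B.space.tensor C) D _ _ rfl
        (par_tensor B.space C))
      (congrArg (fun f => TensorProduct.map LinearMap.id (TensorProduct.map LinearMap.id f))
        (assocLin_010 B D C rfl rfl))
      (hd.pentagon_1010 (LU h) (DU ω) B.act D.act)
  | .tw A, .tw B, .untw C, .untw D =>
    pentagon_congr rfl (hd.assocLin_110 A B (C.tensor D) rfl rfl)
      (congrArg (TensorProduct.map · LinearMap.id) (hd.assocLin_110 A B C rfl rfl))
      (@IsDualPair.assocLin_110 _ _ _ _ _ _ α β lam hd A (B.tensor C.space) D _ _ rfl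
        (par_tensor B C.space))
      rfl (pentagon_1100 (DU ω) C.act D.act)
  | .untw A, .tw B, .tw C, .tw D =>
    pentagon_congr (@assocLin_111 _ _ _ _ _ α β lam hF.map_par (A.space.tensor B) C D _
        (par_tensor A.space B)) (assocLin_010 A (SuperRep.free (C.tensor D)) B rfl rfl)
      (congrArg (TensorProduct.map · LinearMap.id) (hd.assocLin_011 A B C rfl))
      rfl
      (congrArg (TensorProduct.map LinearMap.id) (assocLin_111 hF.map_par B C D rfl))
      (pentagon_0111 (LU h) (DU ω) hF.map_LU_apply A.act)
  | .tw A, .untw B, .tw C, .tw D =>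
    pentagon_congr (@assocLin_111 _ _ _ _ _ α β lam hF.map_par (A.tensor B.space) C D _
        (par_tensor A B.space)) rfl
      (congrArg (TensorProduct.map · LinearMap.id) (assocLin_101 A C B rfl))
      (assocLin_111 hF.map_par A (B.space.tensor C) D rfl)
      (congrArg (TensorProduct.map LinearMap.id) (hd.assocLin_011 B C D rfl))
      (hd.pentagon_1011 (LU h) (DU ω) hF.map_par hF.map_DU_apply B.act)
  | .tw A, .tw B, .untw C, .tw D =>
    pentagon_congr rfl (assocLin_111 hF.map_par A B (C.space.tensor D) rfl)
      (congrArg (TensorProduct.map · LinearMap.id) (hd.assocLin_110 A B C rfl rfl))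
      (assocLin_111 hF.map_par A (B.tensor C.space) D rfl)
      (congrArg (TensorProduct.map LinearMap.id) (assocLin_101 B D C rfl))
      (hd.pentagon_1101 (LU h) (DU ω) hF.map_par hF.map_LU_apply C.act)
  | .tw A, .tw B, .tw C, .untw D =>
    pentagon_congr (@assocLin_010 _ _ _ _ _ α β lam (SuperRep.free (A.tensor B)) D C _ _
        (par_U_tensor A B) rfl) (assocLin_111 hF.map_par A B (C.tensor D.space) rfl)
      (congrArg (TensorProduct.map · LinearMap.id) (assocLin_111 hF.map_par A B C rfl))
      rfl
      (congrArg (TensorProduct.map LinearMap.id) (hd.assocLin_110 B C D rfl rfl))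
      (hd.pentagon_1110 (LU h) (DU ω) hF.map_par hF.map_DU_apply D.act)
  | .tw A, .tw B, .tw C, .tw D =>
    pentagon_congr (@IsDualPair.assocLin_011 _ _ _ _ _ _ α β lam hd (SuperRep.free (A.tensor B)) C D
        _ (par_U_tensor A B)) (hd.assocLin_110 A B (SuperRep.free (C.tensor D)) rfl rfl)
      (congrArg (fun f => TensorProduct.map LinearMap.id (TensorProduct.map f LinearMap.id))
        (assocLin_111 hF.map_par A B C rfl))
      (assocLin_101 A D (SuperRep.free (B.tensor C)) rfl)
      (congrArg (fun f => TensorProduct.map LinearMap.id (TensorProduct.map LinearMap.id f))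
        (assocLin_111 hF.map_par B C D rfl))
      (pentagon_1111 (LU h) (DU ω) hF.map_par hF.map_LU_apply hF.apply_apply
        hd.swapMid_expOm_expOm)

end Pentagon

section Monoidal

variable {h : Type u} [AddCommGroup h] [Module ℂ h] {ω : LinearMap.BilinForm ℂ h}
  {ι : Type*} [Fintype ι] {α β : ι → h} {lam : U h →ₗ[ℂ] ℂ}

open Obj

theorem starHom_id (A B : Obj h) : starHom (𝟙 A) (𝟙 B) = 𝟙 (star A B) :=
  Hom.ext (starLin_id A B)

theorem starHom_comp {A A' A'' B B' B'' : Obj h} (f : A ⟶ A') (f' : A' ⟶ A'') (g : B ⟶ B')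
    (g' : B' ⟶ B'') : starHom (f ≫ f') (g ≫ g') = starHom f g ≫ starHom f' g' :=
  Hom.ext (starLin_comp f f' g g')

/-- The tensor product of isomorphisms. -/
def starIso {A A' B B' : Obj h} (f : A ≅ A') (g : B ≅ B') : star A B ≅ star A' B' where
  hom := starHom f.hom g.hom
  inv := starHom f.inv g.inv
  hom_inv_id := by rw [← starHom_comp, f.hom_inv_id, g.hom_inv_id, starHom_id]
  inv_hom_id := by rw [← starHom_comp, f.inv_hom_id, g.inv_hom_id, starHom_id]

/-- The associator of `𝒞`. -/
def assocIso (hd : IsDualPair ω α β) (hF : IsFourier ω (phi α β lam)) (A B C : Obj h) :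
    A.star (B.star C) ≅ (A.star B).star C :=
  (hd.assocLin_isIsoLin hF A B C).iso

/-- The left unitor of `𝒞`. -/
def leftUnitIso (A : Obj h) : Obj.one.star A ≅ A := (leftUnitLin_isIsoLin A).iso

/-- The right unitor of `𝒞`. -/
def rightUnitIso (A : Obj h) : A.star Obj.one ≅ A := (rightUnitLin_isIsoLin A).iso

theorem assocIso_naturality (hd : IsDualPair ω α β) (hF : IsFourier ω (phi α β lam))
    {A A' B B' C C' : Obj h} (f : A ⟶ A') (g : B ⟶ B') (k : C ⟶ C') :
    starHom (starHom f g) k ≫ (assocIso hd hF A' B' C').inv =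
      (assocIso hd hF A B C).inv ≫ starHom f (starHom g k) := by
  rw [Iso.comp_inv_eq, Category.assoc, Iso.eq_inv_comp]
  exact Hom.ext (hd.assocLin_naturality hF f g k).symm

theorem assocIso_pentagon (hd : IsDualPair ω α β) (hF : IsFourier ω (phi α β lam))
    (A B C D : Obj h) :
    starHom (assocIso hd hF A B C).inv (𝟙 D) ≫ (assocIso hd hF A (B.star C) D).inv ≫
        starHom (𝟙 A) (assocIso hd hF B C D).inv =
      (assocIso hd hF (A.star B) C D).inv ≫ (assocIso hd hF A B (C.star D)).inv := by
  have key : (starIso (Iso.refl A) (assocIso hd hF B C D) ≪≫ assocIso hd hF A (B.star C) D) ≪≫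
        starIso (assocIso hd hF A B C) (Iso.refl D) =
      assocIso hd hF A B (C.star D) ≪≫ assocIso hd hF (A.star B) C D :=
    Iso.ext (Hom.ext (hd.assocLin_pentagon hF A B C D).symm)
  exact congrArg Iso.inv key

theorem assocIso_triangle (hd : IsDualPair ω α β) (hF : IsFourier ω (phi α β lam)) (A B : Obj h) :
    (assocIso hd hF A one B).inv ≫ starHom (𝟙 A) (leftUnitIso B).hom =
      starHom (rightUnitIso A).hom (𝟙 B) := by
  rw [Iso.inv_comp_eq]
  exact Hom.ext (assocLin_triangle A B).symm

/-- The monoidal category `𝒞`. -/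
abbrev monoidalCategory (hd : IsDualPair ω α β) (hF : IsFourier ω (phi α β lam)) :
    MonoidalCategory (Obj h) where
  __ := starStruct (assocIso hd hF) leftUnitIso rightUnitIso
  tensorHom_def {_ Y₁ X₂ _} f g :=
    (congrArg₂ starHom (Category.comp_id f).symm (Category.id_comp g).symm).trans
      (starHom_comp f (𝟙 Y₁) (𝟙 X₂) g)
  id_tensorHom_id := starHom_id
  tensorHom_comp_tensorHom f₁ f₂ g₁ g₂ := (starHom_comp f₁ g₁ f₂ g₂).symm
  whiskerLeft_id := starHom_id
  id_whiskerRight := starHom_id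
  associator_naturality := assocIso_naturality hd hF
  leftUnitor_naturality f := Hom.ext (leftUnitLin_naturality f)
  rightUnitor_naturality f := Hom.ext (rightUnitLin_naturality f)
  pentagon := assocIso_pentagon hd hF
  triangle := assocIso_triangle hd hF

end Monoidal

end SymplecticFermions

end

theorem theorem5p2 {h : Type u} [AddCommGroup h] [Module ℂ h] [FiniteDimensional ℂ h]
    (ω : LinearMap.BilinForm ℂ h) (hskew : ∀ a b, ω a b = -ω b a) (hω : ω.Nondegenerate)
    {ι : Type*} [Fintype ι] [DecidableEq ι] (α β : Module.Basis ι ℂ h)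
    (hαβ : ∀ i j, ω (α i) (β j) = if i = j then 1 else 0) :
    (∃! lam : SymplecticFermions.U h →ₗ[ℂ] ℂ, SymplecticFermions.IsTopForm α β lam) ∧
    ∀ lam : SymplecticFermions.U h →ₗ[ℂ] ℂ, SymplecticFermions.IsTopForm α β lam →
      ∃ (assoc : ∀ A B C : SymplecticFermions.Obj h, A.star (B.star C) ≅ (A.star B).star C)
        (lu : ∀ A : SymplecticFermions.Obj h, SymplecticFermions.Obj.one.star A ≅ A)
        (ru : ∀ A : SymplecticFermions.Obj h, A.star SymplecticFermions.Obj.one ≅ A),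
        (∀ A B C, SymplecticFermions.Obj.toLin (assoc A B C).hom =
          SymplecticFermions.assocLin α β lam A B C) ∧
        (∀ A, SymplecticFermions.Obj.toLin (lu A).hom = SymplecticFermions.Obj.leftUnitLin A) ∧
        (∀ A, SymplecticFermions.Obj.toLin (ru A).hom = SymplecticFermions.Obj.rightUnitLin A) ∧
        ∃ M : CategoryTheory.MonoidalCategory (SymplecticFermions.Obj h),
          M.toMonoidalCategoryStruct = SymplecticFermions.Obj.starStruct assoc lu ru := by
  have hd := SymplecticFermions.isDualPair_of_basis ω hskew α β hαβ
  have he := SymplecticFermions.even_finrank hskew hω α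
  refine ⟨hd.existsUnique_topForm hαβ he, fun lam hlam => ?_⟩
  have hF := hd.isFourier_phi he hlam
  exact ⟨SymplecticFermions.assocIso hd hF, SymplecticFermions.leftUnitIso,
    SymplecticFermions.rightUnitIso, fun _ _ _ => rfl, fun _ => rfl, fun _ => rfl,
    SymplecticFermions.monoidalCategory hd hF, rfl⟩
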